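/- Let $d\ge 1$, let $X_1,X_2,\dots$ be i.i.d. random vectors in $\mathbb R^d$ with density $f$, and let $\varphi,K:\mathbb R^d\to\mathbb R$ be measurable, $s>0$, and $r\ge s$ an integer. For a bandwidth sequence $h=h_n>0$ put $$\hat f^{(i)}(x)=\frac1{nh^d}\sum_{j\ne i}K\big(h^{-1}(X_j-x)\big),\qquad \hat v^{(i)}(x)=\frac1{(n-1)(n-2)}\sum_{j\neq i}\Big(h^{-d}K\big(h^{-1}(x-X_j)\big)-\hat f^{(i)}(x)\Big)^2,$$ where $1\le i,j\le n$, and $$\hat I(\varphi)=\frac1n\sum_{i=1}^n\frac{\varphi(X_i)}{\hat f^{(i)}(X_i)},\qquad \hat I_{cor}(\varphi)=\frac1n\sum_{i=1}^n\frac{\varphi(X_i)}{\hat f^{(i)}(X_i)}\Big(1-\frac{\hat v^{(i)}(X_i)}{\hat f^{(i)}(X_i)^2}\Big).$$ Write $s=k+\alpha$ with $k\in\mathbb N=\{0,1,\dots\}$ and $0<\alpha\le1$. Assume: (A1) $\varphi$ has compact support $Q$ and lies in the Nikol'ski class $\mathcal H_s$: it is $k$ times differentiable and there is $C$ such that, for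 every multi-index $l$ with $|l|\le k$ and every $u\in\mathbb R^d$, $\int(\varphi^{(l)}(x+u)-\varphi^{(l)}(x))^2\,dx\le C|u|^{2\alpha}$. (A2) $f$ is bounded and $r$ times differentiable on $\mathbb R^d$, and its partial derivatives of order $r$ are bounded. (A3) For some $b>0$, $f(x)\ge b$ for every $x\in Q$. (A4) $K(-x)=K(x)$ for every $x$; there are constants $C_1,C_2>0$ with $|K(x)|\le C_1\exp(-C_2\|x\|)$ for every $x$; and $K$ is of order (at least) $r$, that is, $\int K=1$ and $\int u_1^{l_1}\cdots u_d^{l_d}K(u)\,du=0$ whenever $1\le l_1+\dots+l_d\le r-1$. If $h^s+n^{1/2}h^r+n^{-1/2}h^{-d}\to0$ as $n\to\infty$, then $$n^{1/2}\Big(\hat I(\varphi)-\int\varphi(x)\,dx\Big)=O_{\mathbb P}\big(h^s+n^{1/2}h^r+n^{-1/2}h^{-d}\big).$$ If $h^s+n^{1/2}h^r+n^{-1/2}h^{-d/2}+n^{-1}h^{-3d/2}\to0$ as $n\to\infty$, then $$n^{1/2}\Big(\hat I_{cor}(\varphi)-\int\varphi(x)\,dx\Big)=O_{\mathbb P}\big(h^s+n^{1/2}h^r+n^{-1/2}h^{-d/2}+n^{-1}h^{-3d/2}\big).$$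 -/

import Mathlib

open MeasureTheory ProbabilityTheory Filter Topology

noncomputable section

namespace KernelAcc

/-- The Euclidean space of dimension `d`. -/
abbrev E (d : ℕ) : Type := EuclideanSpace ℝ (Fin d)

/-- `g` is `k` times differentiable (for `k = 0` this is no condition). -/
def TimesDifferentiable {d : ℕ} (k : ℕ) (g : E d → ℝ) : Prop :=
  ∀ m : ℕ, m < k → Differentiable ℝ (iteratedFDeriv ℝ m g)

/-- The partial derivative of order `m` of `g` at `x`, in the coordinate directions
`I 0, …, I (m - 1)`. For `m = 0` it is `g x`. -/
def partialDeriv {d m : ℕ} (I : Fin m → Fin d) (g : E d → ℝ) (x : E d) : ℝ :=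
  iteratedFDeriv ℝ m g x (fun j => EuclideanSpace.single (I j) (1 : ℝ))

/-- The Nikol'ski class of regularity `s = k + α`, with `k` a natural number and `0 < α ≤ 1`:
the (measurable) functions that are `k` times differentiable and whose partial derivatives `D`
of order at most `k` satisfy `∫ (D (x + u) - D x)² dx ≤ C |u|^(2 α)` for every `u`.
The integral is the Lebesgue integral with values in `[0, ∞]`. -/
def Nikolskii {d : ℕ} (s : ℝ) : Set (E d → ℝ) :=
  {φ | Measurable φ ∧ ∃ (k : ℕ) (α C : ℝ), s = k + α ∧ 0 < α ∧ α ≤ 1 ∧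
    TimesDifferentiable k φ ∧
    ∀ m : ℕ, m ≤ k → ∀ (I : Fin m → Fin d) (u : E d),
      ∫⁻ x, ENNReal.ofReal ((partialDeriv I φ (x + u) - partialDeriv I φ x) ^ 2)
        ≤ ENNReal.ofReal (C * ‖u‖ ^ (2 * α))}

/-- `f` is `r` times differentiable and its partial derivatives of order `r` are bounded. -/
def HasBoundedDerivs {d : ℕ} (r : ℕ) (f : E d → ℝ) : Prop :=
  TimesDifferentiable r f ∧
    ∃ M : ℝ, ∀ (I : Fin r → Fin d) (x : E d), |partialDeriv I f x| ≤ M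

/-- `|K|` is bounded by a decaying exponential of the norm. -/
def HasExpTails {d : ℕ} (K : E d → ℝ) : Prop :=
  ∃ C₁ C₂ : ℝ, 0 < C₁ ∧ 0 < C₂ ∧ ∀ x, |K x| ≤ C₁ * Real.exp (-(C₂ * ‖x‖))

/-- `K` is a kernel of order (at least) `r`: its integral is `1` and its moments of degree
`1, …, r - 1` vanish. Used together with `HasExpTails`, so that all the moments exist. -/
def IsKernelOfOrder {d : ℕ} (r : ℕ) (K : E d → ℝ) : Prop :=
  Measurable K ∧ ∫ u, K u = 1 ∧
    ∀ l : Fin d → ℕ, 1 ≤ ∑ i, l i → ∑ i, l i < r → ∫ u, (∏ i, u i ^ l i) * K u = 0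

/-- The leave-one-out kernel density estimator at `y`, computed from the sample
`x 0, …, x (n - 1)` without `x i`. -/
def looDensity {d : ℕ} (K : E d → ℝ) (h : ℝ) (n : ℕ) (x : ℕ → E d) (i : ℕ) (y : E d) : ℝ :=
  ((n : ℝ) * h ^ d)⁻¹ * ∑ j ∈ (Finset.range n).erase i, K (h⁻¹ • (x j - y))

/-- The leave-one-out variance estimator at `y`. -/
def looVar {d : ℕ} (K : E d → ℝ) (h : ℝ) (n : ℕ) (x : ℕ → E d) (i : ℕ) (y : E d) : ℝ :=
  (((n : ℝ) - 1) * ((n : ℝ) - 2))⁻¹ *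
    ∑ j ∈ (Finset.range n).erase i,
      ((h ^ d)⁻¹ * K (h⁻¹ • (y - x j)) - looDensity K h n x i y) ^ 2

/-- The kernel-weighted estimator of `∫ φ`. -/
def estimator {d : ℕ} (φ K : E d → ℝ) (h : ℝ) (n : ℕ) (x : ℕ → E d) : ℝ :=
  (n : ℝ)⁻¹ * ∑ i ∈ Finset.range n, φ (x i) / looDensity K h n x i (x i)

/-- The variance-corrected kernel-weighted estimator of `∫ φ`. -/
def corEstimator {d : ℕ} (φ K : E d → ℝ) (h : ℝ) (n : ℕ) (x : ℕ → E d) : ℝ :=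
  (n : ℝ)⁻¹ * ∑ i ∈ Finset.range n,
    φ (x i) / looDensity K h n x i (x i) *
      (1 - looVar K h n x i (x i) / looDensity K h n x i (x i) ^ 2)

/-- `Z n = O_P (a n)`: the sequence `Z n / a n` is bounded in probability. -/
def IsBigOP {Ω : Type*} [MeasurableSpace Ω] (P : Measure Ω) (Z : ℕ → Ω → ℝ) (a : ℕ → ℝ) : Prop :=
  ∀ ε : ℝ, 0 < ε → ∃ M : ℝ, ∀ᶠ n in atTop,
    P {ω | M * |a n| < |Z n ω|} ≤ ENNReal.ofReal ε

/-- `h^s + n^(1/2) h^r + n^(-1/2) h^(-d)`. -/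
def rate (d r : ℕ) (s : ℝ) (h : ℕ → ℝ) (n : ℕ) : ℝ :=
  h n ^ s + (n : ℝ) ^ (1 / 2 : ℝ) * h n ^ r + (n : ℝ) ^ (-(1 / 2) : ℝ) * h n ^ (-(d : ℝ))

/-- `h^s + n^(1/2) h^r + n^(-1/2) h^(-d/2) + n^(-1) h^(-3d/2)`. -/
def corRate (d r : ℕ) (s : ℝ) (h : ℕ → ℝ) (n : ℕ) : ℝ :=
  h n ^ s + (n : ℝ) ^ (1 / 2 : ℝ) * h n ^ r + (n : ℝ) ^ (-(1 / 2) : ℝ) * h n ^ (-((d : ℝ) / 2))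
    + (n : ℝ)⁻¹ * h n ^ (-(3 * (d : ℝ) / 2))

end KernelAcc

end

noncomputable section

namespace KernelAcc

/-! Fix a bandwidth `h ≤ 1` and put `D = h^(-d)`. Let `p(x)` be the mean of the rescaled kernel at
`x` and `ξ(x, y) = h^(-d) K((y - x)/h) - p(x)`. At the sample point `x i` the density estimator is
`p + δ` with `δ = (S - p)/n`, where `S` is the sum of `ξ(x i, x j)` over `j ≠ i`; its typical size
is `θ = √(D/n)`. The proof expands `1/(p + δ)` around `p`.

The first order terms form `linearPart`. By the Hoeffding decomposition of its double sum
(`linearPart_eq`), the leading random term is an i.i.d. sum of `φ/p` minus `φ f/p²` smoothed by the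
kernel. Since `p` is close to `f` on the support of `φ`, this is nearly `φ/f` minus its own
smoothing, of order `h^s` in mean square. This cancellation is why the error is smaller than
`n^(-1/2)`. The bias of `p` gives `√n h^r`, and the degenerate double sum, whose terms are nearly
orthogonal, gives `√(D/n)`.

For the plain estimator the remainder is of order `δ²`, and `√n θ² = n^(-1/2) h^(-d)`. The variance
correction subtracts `v`, which is close to `T/n²` with `T` the sum of the `ξ²`; so `δ² - v` is
close to `(S² - T)/n²`, which contains only products over distinct indices. Their weighted sum is
`quadraticPart`, and `lintegral_sq_triple_sum_le` shows that it contributes `√(D/n) + D/n`. What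
remains is cubic, and `√n θ³ = n^(-1) h^(-3d/2)`.

The expansions require estimators bounded away from zero, so bad samples are removed.
`lintegral_mul_exp_le` bounds exponential moments of `|S|/(nθ)` and `T/(nθ)²` given `x i`. This
bounds the mean of the remainders and, through a union bound, makes bad samples have probability
`O(1/n)`. Markov's inequality concludes.

The bound `h^s` is analytic. `L2Expandable` describes functions of a point and a displacement which
are polynomials of degree less than `r` in the displacement, up to a mean square error of order `s`.
Shifts of `φ` have this property by Taylor's formula in mean square; it survives multiplication by
`f`, hence passes to `φ/f` through a truncated geometric series. A kernel of order `r` evaluates the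
polynomial part exactly. -/

/-! ### Independence as invariance under resampling one coordinate. -/

/-- `ν` is unchanged when one coordinate is replaced by an independent draw from `μ`. -/
def ResampleInvariant {S : Type*} [MeasurableSpace S] (ν : Measure (ℕ → S)) (μ : Measure S) :
    Prop :=
  ∀ j, (ν.prod μ).map (fun p => Function.update p.1 j p.2) = ν

/-- The sequence with coordinate `j` overwritten by a constant depends only on the other variables,
so it is independent of `X j`; writing `X j` back recovers the sample. Since a second overwriting
cancels the first, the constant disappears from the final identity. -/
theorem resampleInvariant_of_iIndepFun {Ω S : Type*} [MeasurableSpace Ω] [MeasurableSpace S]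
    [Nonempty S] {P : Measure Ω} [IsProbabilityMeasure P] {X : ℕ → Ω → S}
    (hXm : ∀ i, Measurable (X i)) (hXi : iIndepFun X P) {μ : Measure S}
    (hXμ : ∀ i, P.map (X i) = μ) :
    ResampleInvariant (P.map (fun ω i => X i ω)) μ := by
  intro j
  obtain ⟨z⟩ := ‹Nonempty S›
  set Y : Ω → ℕ → S := fun ω i => X i ω with hY
  have hYm : Measurable Y := measurable_pi_iff.2 hXm
  set W : Ω → ℕ → S := fun ω => Function.update (Y ω) j z with hW
  have hWi : ∀ i, Measurable[⨆ i ∈ ({j}ᶜ : Set ℕ), MeasurableSpace.comap (X i) inferInstance]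
      (fun ω => W ω i) := by
    intro i
    by_cases hij : i = j
    · subst hij
      simp only [hW, Function.update_self]
      exact measurable_const
    · simp only [hW, ne_eq, hij, not_false_eq_true, Function.update_of_ne, hY]
      have : MeasurableSpace.comap (X i) inferInstance ≤
          ⨆ i ∈ ({j}ᶜ : Set ℕ), MeasurableSpace.comap (X i) inferInstance :=
        le_iSup₂_of_le i (by simpa using hij) le_rfl
      exact (comap_measurable (X i)).mono this le_rfl
  have hWm : Measurable W := by
    refine measurable_pi_iff.2 fun i => (hWi i).mono ?_ le_rfl
    exact iSup₂_le fun i _ => (hXm i).comap_le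
  have hind : IndepFun W (X j) P := by
    have h := indep_iSup_of_disjoint (fun i => (hXm i).comap_le) hXi
      (S := {j}ᶜ) (T := {j}) disjoint_compl_left
    rw [IndepFun_iff_Indep]
    refine indep_of_indep_of_le_left (indep_of_indep_of_le_right h ?_) ?_
    · simp
    · have : Measurable[⨆ i ∈ ({j}ᶜ : Set ℕ), MeasurableSpace.comap (X i) inferInstance] W :=
        @measurable_pi_iff Ω ℕ (fun _ => S) (_) _ _ |>.2 hWi
      exact this.comap_le
  have hprod := (indepFun_iff_map_prod_eq_prod_map_map hWm.aemeasurable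
    (hXm j).aemeasurable).1 hind
  rw [hXμ j] at hprod
  have hu : Measurable (fun p : (ℕ → S) × S => Function.update p.1 j p.2) := measurable_update'
  have hμ : IsProbabilityMeasure μ := by
    rw [← hXμ j]; exact Measure.isProbabilityMeasure_map (hXm j).aemeasurable
  have hPY : IsProbabilityMeasure (P.map Y) :=
    Measure.isProbabilityMeasure_map hYm.aemeasurable
  have h1 : P.map Y = (P.map (fun ω => (W ω, X j ω))).map
      (fun p => Function.update p.1 j p.2) := by
    rw [Measure.map_map hu (hWm.prodMk (hXm j))]
    congr 1
    funext ω
    simp [hW, hY]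
  have h2 : P.map W = (P.map Y).map (fun x => Function.update x j z) := by
    rw [Measure.map_map _ hYm]
    · rfl
    · exact measurable_update_left
  rw [hprod, h2] at h1
  conv_rhs => rw [h1]
  have h3 : ((P.map Y).map (fun x => Function.update x j z)).prod μ =
      ((P.map Y).prod μ).map (Prod.map (fun x => Function.update x j z) id) := by
    rw [← Measure.map_prod_map _ _ measurable_update_left measurable_id, Measure.map_id]
  rw [h3, Measure.map_map hu (measurable_update_left.prodMap measurable_id)]
  congr 1
  funext p
  simp

namespace ResampleInvariant

variable {S : Type*} [MeasurableSpace S] {ν : Measure (ℕ → S)} {μ : Measure S}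
  [IsProbabilityMeasure μ]

theorem lintegral_eq (hν : ResampleInvariant ν μ) (j : ℕ) {G : (ℕ → S) → ENNReal}
    (hG : Measurable G) :
    ∫⁻ x, G x ∂ν = ∫⁻ x, ∫⁻ y, G (Function.update x j y) ∂μ ∂ν := by
  conv_lhs => rw [← hν j]
  rw [lintegral_map hG measurable_update', lintegral_prod]
  exact (hG.comp measurable_update').aemeasurable

theorem lintegral_le (hν : ResampleInvariant ν μ) (j : ℕ) {G H : (ℕ → S) → ENNReal}
    (hG : Measurable G) (h : ∀ x, ∫⁻ y, G (Function.update x j y) ∂μ ≤ H x) :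
    ∫⁻ x, G x ∂ν ≤ ∫⁻ x, H x ∂ν := by
  rw [hν.lintegral_eq j hG]
  exact lintegral_mono h

theorem lintegral_eval [IsProbabilityMeasure ν] (hν : ResampleInvariant ν μ) (j : ℕ)
    {w : S → ENNReal}
    (hw : Measurable w) : ∫⁻ x, w (x j) ∂ν = ∫⁻ y, w y ∂μ := by
  have h := hν.lintegral_eq j (G := fun x => w (x j)) (hw.comp (measurable_pi_apply j))
  simpa using h

/-- This is the source of all orthogonality below: a product has mean zero as soon as one coordinate
occurs in a single factor that is centered in it. -/
theorem integral_eq_zero [SFinite ν] (hν : ResampleInvariant ν μ) (j : ℕ) {G : (ℕ → S) → ℝ}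
    (hG : Integrable G ν) (h : ∀ x, ∫ y, G (Function.update x j y) ∂μ = 0) :
    ∫ x, G x ∂ν = 0 := by
  have hm : AEMeasurable (fun p : (ℕ → S) × S => Function.update p.1 j p.2) (ν.prod μ) :=
    measurable_update'.aemeasurable
  rw [← hν j] at hG
  have h1 := (integrable_map_measure hG.aestronglyMeasurable hm).1 hG
  conv_lhs => rw [← hν j]
  rw [integral_map hm hG.aestronglyMeasurable]
  rw [show (fun p : (ℕ → S) × S => G (Function.update p.1 j p.2)) =
    G ∘ (fun p : (ℕ → S) × S => Function.update p.1 j p.2) from rfl, integral_prod _ h1]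
  simp [h]

/-- Conditionally on the coordinate `i`, the expectation of a product over other coordinates
factorizes. -/
theorem lintegral_prod_le [IsProbabilityMeasure ν] (hν : ResampleInvariant ν μ)
    {w : S → ENNReal} (hw : Measurable w)
    {g : S → S → ENNReal} (hg : Measurable (Function.uncurry g)) {c : ENNReal}
    (hgc : ∀ x, w x ≠ 0 → ∫⁻ y, g x y ∂μ ≤ c) (i : ℕ) (s : Finset ℕ) (his : i ∉ s) :
    ∫⁻ x, w (x i) * ∏ j ∈ s, g (x i) (x j) ∂ν ≤ c ^ s.card * ∫⁻ y, w y ∂μ := by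
  have hgm : ∀ j, Measurable fun x : ℕ → S => g (x i) (x j) := fun j => by
    have : Measurable fun x : ℕ → S => (x i, x j) :=
      (measurable_pi_apply i).prodMk (measurable_pi_apply j)
    exact hg.comp this
  induction s using Finset.induction_on with
  | empty => simp [hν.lintegral_eval i hw]
  | insert j s hj ih =>
    have hij : i ≠ j := fun h => his (by simp [h])
    have hme : Measurable fun x : ℕ → S => w (x i) * ∏ k ∈ s, g (x i) (x k) :=
      (hw.comp (measurable_pi_apply i)).mul (Finset.measurable_fun_prod _ fun k _ => hgm k)
    calc ∫⁻ x, w (x i) * ∏ k ∈ insert j s, g (x i) (x k) ∂ν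
        ≤ ∫⁻ x, c * (w (x i) * ∏ k ∈ s, g (x i) (x k)) ∂ν := by
          refine hν.lintegral_le j ?_ fun x => ?_
          · exact (hw.comp (measurable_pi_apply i)).mul
              (Finset.measurable_fun_prod _ fun k _ => hgm k)
          · have h1 : ∀ y, w (Function.update x j y i) *
                ∏ k ∈ insert j s, g (Function.update x j y i) (Function.update x j y k) =
                (w (x i) * ∏ k ∈ s, g (x i) (x k)) * g (x i) y := by
              intro y
              rw [Finset.prod_insert hj]
              have h2 : ∏ k ∈ s, g (Function.update x j y i) (Function.update x j y k) =
                  ∏ k ∈ s, g (x i) (x k) := by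
                refine Finset.prod_congr rfl fun k hk => ?_
                have hkj : k ≠ j := fun h => hj (h ▸ hk)
                simp [hkj, hij]
              rw [h2]
              simp only [ne_eq, hij, not_false_eq_true, Function.update_of_ne,
                Function.update_self]
              ring
            simp_rw [h1]
            rw [lintegral_const_mul _ (f := fun y => g (x i) y) hg.of_uncurry_left]
            -- The bound on `g` is only assumed where the weight is nonzero; elsewhere both sides
            -- vanish.
            by_cases h0 : w (x i) = 0
            · simp [h0]
            · rw [mul_comm]
              gcongr
              exact hgc _ h0
      _ = c * ∫⁻ x, w (x i) * ∏ k ∈ s, g (x i) (x k) ∂ν := lintegral_const_mul _ hme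
      _ ≤ c * (c ^ s.card * ∫⁻ y, w y ∂μ) := by
          gcongr
          exact ih fun h => his (Finset.mem_insert_of_mem h)
      _ = _ := by rw [Finset.card_insert_of_notMem hj]; ring

end ResampleInvariant

/-! ### Second moments of sums -/

theorem memLp_two_of_lintegral_sq {Ω : Type*} [MeasurableSpace Ω] {P : Measure Ω} {F : Ω → ℝ}
    (hF : Measurable F) (h : ∫⁻ ω, ENNReal.ofReal (F ω ^ 2) ∂P < ⊤) : MemLp F 2 P := by
  rw [memLp_two_iff_integrable_sq hF.aestronglyMeasurable]
  refine ⟨(hF.pow_const 2).aestronglyMeasurable, ?_⟩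
  rw [hasFiniteIntegral_iff_ofReal (ae_of_all _ fun ω => sq_nonneg _)]
  exact h

/-- Expanding the square reduces a second moment estimate to counting the pairs of terms whose
product does not have mean zero. -/
theorem lintegral_sq_sum_le {Ω ι : Type*} [MeasurableSpace Ω] {P : Measure Ω}
    (A : Finset ι) {H : ι → Ω → ℝ} (hH : ∀ a ∈ A, MemLp (H a) 2 P) {β : ι → ι → ℝ}
    (hβ : ∀ a ∈ A, ∀ b ∈ A, ∫ ω, H a ω * H b ω ∂P ≤ β a b) :
    ∫⁻ ω, ENNReal.ofReal ((∑ a ∈ A, H a ω) ^ 2) ∂P ≤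
      ENNReal.ofReal (∑ a ∈ A, ∑ b ∈ A, β a b) := by
  have hint : ∀ a ∈ A, ∀ b ∈ A, Integrable (fun ω => H a ω * H b ω) P :=
    fun a ha b hb => (hH a ha).integrable_mul (hH b hb)
  have h1 : ∀ ω, (∑ a ∈ A, H a ω) ^ 2 = ∑ a ∈ A, ∑ b ∈ A, H a ω * H b ω := by
    intro ω; rw [sq, Finset.sum_mul_sum]
  simp_rw [h1]
  have hi : Integrable (fun ω => ∑ a ∈ A, ∑ b ∈ A, H a ω * H b ω) P :=
    integrable_finsetSum _ fun a ha => integrable_finsetSum _ fun b hb => hint a ha b hb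
  rw [← ofReal_integral_eq_lintegral_ofReal hi (ae_of_all _ fun ω => by
    simp only [Pi.zero_apply]; rw [← h1]; positivity)]
  refine ENNReal.ofReal_le_ofReal ?_
  rw [integral_finsetSum _ fun a ha => integrable_finsetSum _ fun b hb => hint a ha b hb]
  refine Finset.sum_le_sum fun a ha => ?_
  rw [integral_finsetSum _ fun b hb => hint a ha b hb]
  exact Finset.sum_le_sum fun b hb => hβ a ha b hb

theorem integral_le_of_lintegral {Ω : Type*} [MeasurableSpace Ω] {P : Measure Ω} {F G : Ω → ℝ}
    {B : ℝ} (hB : 0 ≤ B) (hF : Measurable F) (hFG : ∀ ω, |F ω| ≤ G ω)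
    (h : ∫⁻ ω, ENNReal.ofReal (G ω) ∂P ≤ ENNReal.ofReal B) : ∫ ω, F ω ∂P ≤ B := by
  have h1 : ∫⁻ ω, ENNReal.ofReal |F ω| ∂P ≤ ENNReal.ofReal B :=
    (lintegral_mono fun ω => ENNReal.ofReal_le_ofReal (hFG ω)).trans h
  have h2 := integral_eq_lintegral_of_nonneg_ae (μ := P) (f := fun ω => |F ω|)
    (ae_of_all _ fun ω => abs_nonneg _) hF.abs.aestronglyMeasurable
  calc ∫ ω, F ω ∂P ≤ |∫ ω, F ω ∂P| := le_abs_self _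
    _ ≤ ∫ ω, |F ω| ∂P := abs_integral_le_integral_abs
    _ ≤ B := by rw [h2]; exact ENNReal.toReal_le_of_le_ofReal hB h1

/-! ### Monomials and directional derivatives -/

/-- The monomial `∏ i, v i ^ l i`. -/
def monomial {d : ℕ} (l : Fin d → ℕ) (v : E d) : ℝ := ∏ i, v i ^ l i

theorem monomial_add {d : ℕ} (l m : Fin d → ℕ) (v : E d) :
    monomial (l + m) v = monomial l v * monomial m v := by
  simp [monomial, pow_add, Finset.prod_mul_distrib]

theorem monomial_zero {d : ℕ} (v : E d) : monomial 0 v = 1 := by simp [monomial]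

theorem abs_monomial_le {d : ℕ} (l : Fin d → ℕ) (v : E d) :
    |monomial l v| ≤ ‖v‖ ^ (∑ i, l i) := by
  rw [monomial, Finset.abs_prod, ← Finset.prod_pow_eq_pow_sum]
  refine Finset.prod_le_prod (fun i _ => abs_nonneg _) fun i _ => ?_
  rw [abs_pow]
  gcongr
  exact PiLp.norm_apply_le v i

theorem monomial_smul {d : ℕ} (l : Fin d → ℕ) (t : ℝ) (v : E d) :
    monomial l (t • v) = t ^ (∑ i, l i) * monomial l v := by
  simp [monomial, mul_pow, Finset.prod_mul_distrib, Finset.prod_pow_eq_pow_sum]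

theorem measurable_monomial {d : ℕ} (l : Fin d → ℕ) :
    Measurable (monomial l : E d → ℝ) := by
  unfold monomial
  fun_prop

/-- The exponents of the monomial `∏ j, v (I j)`. -/
def exponents {d m : ℕ} (I : Fin m → Fin d) (i : Fin d) : ℕ :=
  (Finset.univ.filter fun j => I j = i).card

theorem sum_exponents {d m : ℕ} (I : Fin m → Fin d) : ∑ i, exponents I i = m := by
  have := Finset.card_eq_sum_card_fiberwise (f := I) (s := Finset.univ) (t := Finset.univ)
    (fun _ _ => Finset.mem_coe.2 (Finset.mem_univ _))
  simpa [exponents] using this.symm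

theorem prod_apply_eq_monomial {d m : ℕ} (I : Fin m → Fin d) (v : E d) :
    ∏ j, v (I j) = monomial (exponents I) v := by
  rw [monomial, ← Finset.prod_fiberwise (Finset.univ) I]
  refine Finset.prod_congr rfl fun i _ => ?_
  rw [exponents, Finset.prod_congr rfl (g := fun _ => v i), Finset.prod_const]
  intro j hj
  rw [(Finset.mem_filter.1 hj).2]

/-- Summing over words of coordinate directions instead of multi-indices requires neither
multinomial coefficients nor symmetry of the derivative. -/
theorem iteratedFDeriv_apply_const {d m : ℕ} (g : E d → ℝ) (x v : E d) :
    iteratedFDeriv ℝ m g x (fun _ => v) =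
      ∑ I : Fin m → Fin d, monomial (exponents I) v * partialDeriv I g x := by
  have hv : v = ∑ i, v i • EuclideanSpace.single i (1 : ℝ) := by
    have := (EuclideanSpace.basisFun (Fin d) ℝ).sum_repr v
    simpa using this.symm
  conv_lhs => rw [hv]
  rw [ContinuousMultilinearMap.map_sum (iteratedFDeriv ℝ m g x)
    (fun (_ : Fin m) (i : Fin d) => v i • EuclideanSpace.single i (1 : ℝ))]
  refine Finset.sum_congr rfl fun I _ => ?_
  rw [ContinuousMultilinearMap.map_smul_univ, prod_apply_eq_monomial, smul_eq_mul]
  rfl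

theorem hasDerivAt_iteratedFDeriv_line {d m k : ℕ} {g : E d → ℝ} (hg : TimesDifferentiable k g)
    (hm : m < k) (x v : E d) (t : ℝ) :
    HasDerivAt (fun t : ℝ => iteratedFDeriv ℝ m g (x + t • v) (fun _ => v))
      (iteratedFDeriv ℝ (m + 1) g (x + t • v) (fun _ => v)) t := by
  have h1 : HasDerivAt (fun t : ℝ => x + t • v) v t := by
    simpa using ((hasDerivAt_id t).smul_const v).const_add x
  have h2 := (hg m hm (x + t • v)).hasFDerivAt.comp_hasDerivAt t h1
  have h3 := ((ContinuousMultilinearMap.apply ℝ (fun _ : Fin m => E d) ℝ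
    (fun _ => v)).hasFDerivAt (x := iteratedFDeriv ℝ m g (x + t • v))).comp_hasDerivAt t h2
  rw [iteratedFDeriv_succ_apply_left]
  exact h3

/-! ### Taylor's formula along a chain of derivatives -/

theorem hasDerivAt_taylor_sum (r : ℕ) (c : ℕ → ℝ) (t : ℝ) :
    HasDerivAt (fun t : ℝ => ∑ m ∈ Finset.range (r + 1), t ^ m / m.factorial * c m)
      (∑ m ∈ Finset.range r, t ^ m / m.factorial * c (m + 1)) t := by
  have : ∀ t : ℝ, ∑ m ∈ Finset.range (r + 1), t ^ m / m.factorial * c m =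
      ∑ m ∈ Finset.range r, t ^ (m + 1) / (m + 1).factorial * c (m + 1) + c 0 := by
    intro t; rw [Finset.sum_range_succ']; simp
  simp_rw [this]
  refine HasDerivAt.add_const _ (HasDerivAt.fun_sum fun m _ => ?_)
  refine (((hasDerivAt_pow (m + 1) t).div_const ((m + 1).factorial : ℝ)).mul_const
    (c (m + 1))).congr_deriv ?_
  rw [Nat.factorial_succ]
  have : (m.factorial : ℝ) ≠ 0 := by positivity
  push_cast
  field_simp

/-- Induction on the order: the derivative of the remainder is the remainder of the shifted chain,
and the mean value inequality integrates its bound over `[0, 1]`. The top derivative need not be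
continuous, and the factor `1 / r!` is not needed. -/
theorem abs_sub_taylor_le {r : ℕ} {F : ℕ → ℝ → ℝ}
    (hF : ∀ m < r, ∀ t, HasDerivAt (F m) (F (m + 1) t) t) {B : ℝ}
    (hB : ∀ t ∈ Set.Icc (0 : ℝ) 1, |F r t| ≤ B) {t : ℝ} (ht : t ∈ Set.Icc (0 : ℝ) 1) :
    |F 0 t - ∑ m ∈ Finset.range r, t ^ m / m.factorial * F m 0| ≤ B := by
  induction r generalizing F t with
  | zero => simpa using hB t ht
  | succ r ih =>
    have hB0 : 0 ≤ B := (abs_nonneg _).trans (hB 0 (by simp))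
    set R : ℝ → ℝ := fun t => F 0 t - ∑ m ∈ Finset.range (r + 1), t ^ m / m.factorial * F m 0
    have hR : ∀ t, HasDerivAt R
        (F 1 t - ∑ m ∈ Finset.range r, t ^ m / m.factorial * F (m + 1) 0) t := by
      intro t
      exact (hF 0 (by omega) t).sub (hasDerivAt_taylor_sum r (fun m => F m 0) t)
    have h1 := norm_image_sub_le_of_norm_deriv_le_segment' (f := R) (a := 0) (b := 1) (C := B)
      (fun t _ => (hR t).hasDerivWithinAt)
      (fun t ht' => ih (F := fun m => F (m + 1)) (fun m hm t => hF (m + 1) (by omega) t) hB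
        (t := t) ⟨ht'.1, ht'.2.le⟩) t ht
    have h0 : R 0 = 0 := by
      simp only [R]
      rw [Finset.sum_range_succ']
      simp
    rw [h0, sub_zero, Real.norm_eq_abs, sub_zero] at h1
    exact h1.trans (by nlinarith [ht.2])

/-! ### Squares of integrals -/

theorem lintegral_mul_sq_le {α : Type*} [MeasurableSpace α] {μ : Measure α} {k H : α → ENNReal}
    (hk : Measurable k) (hH : Measurable H) :
    (∫⁻ a, k a * H a ∂μ) ^ 2 ≤ (∫⁻ a, k a ∂μ) * ∫⁻ a, k a * H a ^ 2 ∂μ := by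
  have h := ENNReal.lintegral_mul_le_Lp_mul_Lq μ (p := 2) (q := 2)
    (Real.HolderConjugate.two_two) (f := fun a => k a ^ (1 / 2 : ℝ))
    (g := fun a => k a ^ (1 / 2 : ℝ) * H a) (hk.pow_const _).aemeasurable
    ((hk.pow_const _).mul hH).aemeasurable
  have e1 : ∀ a, (k a ^ (1 / 2 : ℝ)) ^ (2 : ℝ) = k a := by
    intro a; rw [← ENNReal.rpow_mul]; norm_num
  have e2 : ∀ a, (k a ^ (1 / 2 : ℝ) * H a) ^ (2 : ℝ) = k a * H a ^ 2 := by
    intro a; rw [ENNReal.mul_rpow_of_nonneg _ _ (by norm_num), e1]; norm_num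
  have e3 : ∀ a, ((fun a => k a ^ (1 / 2 : ℝ)) * fun a => k a ^ (1 / 2 : ℝ) * H a) a =
      k a * H a := by
    intro a
    simp only [Pi.mul_apply]
    rw [← mul_assoc, ← ENNReal.rpow_add_of_nonneg _ _ (by norm_num) (by norm_num)]
    norm_num
  simp_rw [e1, e2, e3] at h
  calc (∫⁻ a, k a * H a ∂μ) ^ 2
      ≤ ((∫⁻ a, k a ∂μ) ^ (1 / 2 : ℝ) * (∫⁻ a, k a * H a ^ 2 ∂μ) ^ (1 / 2 : ℝ)) ^ 2 := by gcongr
    _ = _ := by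
        rw [mul_pow]
        congr 1 <;>
        · rw [← ENNReal.rpow_natCast, ← ENNReal.rpow_mul]; norm_num

theorem sq_integral_le_lintegral {α : Type*} [MeasurableSpace α] {μ : Measure α}
    [IsProbabilityMeasure μ] {F : α → ℝ} (hF : Measurable F) :
    ENNReal.ofReal ((∫ a, F a ∂μ) ^ 2) ≤ ∫⁻ a, ENNReal.ofReal (F a ^ 2) ∂μ := by
  have h := lintegral_mul_sq_le (μ := μ) (k := fun _ => 1) (H := fun a => ENNReal.ofReal |F a|)
    measurable_const hF.abs.ennreal_ofReal
  simp only [one_mul, lintegral_const, measure_univ, mul_one] at h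
  have e : ∀ a, ENNReal.ofReal |F a| ^ 2 = ENNReal.ofReal (F a ^ 2) := by
    intro a; rw [← ENNReal.ofReal_pow (abs_nonneg _), sq_abs]
  simp_rw [e] at h
  refine le_trans ?_ h
  rw [← sq_abs, ENNReal.ofReal_pow (abs_nonneg _)]
  gcongr
  simpa [Real.enorm_eq_ofReal_abs] using enorm_integral_le_lintegral_enorm (μ := μ) F

/-- Taylor's formula in mean square along a chain of derivatives in the direction `v`. -/
theorem lintegral_sq_sub_taylor_le {d k : ℕ} {F : ℕ → E d → ℝ} {v : E d}
    (hF : ∀ m < k, ∀ x, ∀ t : ℝ,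
      HasDerivAt (fun t : ℝ => F m (x + t • v)) (F (m + 1) (x + t • v)) t)
    (hFm : ∀ m ≤ k, Measurable (F m)) {B : ENNReal}
    (hB : ∀ t ∈ Set.Icc (0 : ℝ) 1,
      ∫⁻ x, ENNReal.ofReal ((F k (x + t • v) - F k x) ^ 2) ≤ B)
    {t : ℝ} (ht : t ∈ Set.Icc (0 : ℝ) 1) :
    ∫⁻ x, ENNReal.ofReal
      ((F 0 (x + t • v) - ∑ m ∈ Finset.range (k + 1), t ^ m / m.factorial * F m x) ^ 2) ≤ B := by
  induction k generalizing F t with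
  | zero => simpa using hB t ht
  | succ k ih =>
    -- `R'` is the remainder of the shifted chain, which is also the `τ`-derivative of the remainder
    -- to be bounded.
    set R' : E d → ℝ → ℝ := fun x τ =>
      F 1 (x + τ • v) - ∑ m ∈ Finset.range (k + 1), τ ^ m / m.factorial * F (m + 1) x with hR'
    have hR'm : Measurable (Function.uncurry R') := by
      simp only [hR', Function.uncurry_def]
      refine Measurable.sub ?_ (Finset.measurable_fun_sum _ fun m hm => ?_)
      · exact (hFm 1 (by omega)).comp (by fun_prop)
      · have := hFm (m + 1) (by have := Finset.mem_range.1 hm; omega)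
        have h2 : Measurable fun p : E d × ℝ => F (m + 1) p.1 := this.comp measurable_fst
        fun_prop
    have key : ∀ x, ENNReal.ofReal ((F 0 (x + t • v) -
        ∑ m ∈ Finset.range (k + 1 + 1), t ^ m / m.factorial * F m x) ^ 2) ≤
        ∫⁻ τ in Set.Icc (0 : ℝ) 1, ENNReal.ofReal (R' x τ ^ 2) := by
      intro x
      -- The top derivative may be discontinuous along the segment, so the fundamental theorem of
      -- calculus needs integrability of `R' x`. It follows from square integrability when the right
      -- side is finite; otherwise there is nothing to prove.
      by_cases hfin : ∫⁻ τ in Set.Icc (0 : ℝ) 1, ENNReal.ofReal (R' x τ ^ 2) = ⊤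
      · rw [hfin]; exact le_top
      have hmx : Measurable (R' x) := hR'm.of_uncurry_left
      have hL2 : MemLp (R' x) 2 (volume.restrict (Set.Icc (0 : ℝ) 1)) :=
        memLp_two_of_lintegral_sq hmx (lt_top_iff_ne_top.2 hfin)
      have hint : IntegrableOn (R' x) (Set.Icc (0 : ℝ) 1) := hL2.integrable (by norm_num)
      have hii : IntervalIntegrable (R' x) volume 0 t := by
        rw [intervalIntegrable_iff_integrableOn_Icc_of_le ht.1]
        exact hint.mono_set (Set.Icc_subset_Icc_right ht.2)
      set R : ℝ → ℝ := fun t => F 0 (x + t • v) -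
        ∑ m ∈ Finset.range (k + 1 + 1), t ^ m / m.factorial * F m x with hR
      have hRd : ∀ τ, HasDerivAt R (R' x τ) τ := by
        intro τ
        exact (hF 0 (by omega) x τ).sub (hasDerivAt_taylor_sum (k + 1) (fun m => F m x) τ)
      have h0 : R 0 = 0 := by
        simp only [hR]
        rw [Finset.sum_range_succ']
        simp
      have hftc := intervalIntegral.integral_eq_sub_of_hasDerivAt (fun τ _ => hRd τ) hii
      rw [h0, sub_zero] at hftc
      have hRt : |R t| ≤ ∫ τ in Set.Icc (0 : ℝ) 1, |R' x τ| := by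
        rw [← hftc, intervalIntegral.integral_of_le ht.1]
        refine abs_integral_le_integral_abs.trans ?_
        refine setIntegral_mono_set hint.abs (ae_of_all _ fun _ => abs_nonneg _) ?_
        exact (Set.Ioc_subset_Icc_self.trans (Set.Icc_subset_Icc_right ht.2)).eventuallyLE
      have : IsProbabilityMeasure (volume.restrict (Set.Icc (0 : ℝ) 1)) := ⟨by simp⟩
      calc ENNReal.ofReal (R t ^ 2)
          ≤ ENNReal.ofReal ((∫ τ in Set.Icc (0 : ℝ) 1, |R' x τ|) ^ 2) := by
            refine ENNReal.ofReal_le_ofReal ?_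
            rw [← sq_abs]
            gcongr
        _ ≤ ∫⁻ τ in Set.Icc (0 : ℝ) 1, ENNReal.ofReal (|R' x τ| ^ 2) :=
            sq_integral_le_lintegral hmx.abs
        _ = _ := by simp_rw [sq_abs]
    refine (lintegral_mono key).trans ?_
    rw [lintegral_lintegral_swap (hR'm.pow_const 2).ennreal_ofReal.aemeasurable]
    calc ∫⁻ τ in Set.Icc (0 : ℝ) 1, ∫⁻ x, ENNReal.ofReal (R' x τ ^ 2)
        ≤ ∫⁻ τ in Set.Icc (0 : ℝ) 1, B := by
          refine setLIntegral_mono' measurableSet_Icc fun τ hτ => ?_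
          exact ih (F := fun m => F (m + 1)) (fun m hm => hF (m + 1) (by omega))
            (fun m hm => hFm (m + 1) (by omega)) hB hτ
      _ = B := by simp

/-- A function with bounded support and one finite mean square increment for each shift is square
integrable. -/
theorem lintegral_sq_lt_top_of_increments {d : ℕ} (hd : 1 ≤ d) {a : E d → ℝ} {Q : Set (E d)}
    (hQ : Bornology.IsBounded Q) (haQ : ∀ x ∉ Q, a x = 0)
    (h : ∀ u : E d, ∫⁻ x, ENNReal.ofReal ((a (x + u) - a x) ^ 2) < ⊤) :
    ∫⁻ x, ENNReal.ofReal (a x ^ 2) < ⊤ := by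
  obtain ⟨R, hR⟩ := hQ.exists_norm_le
  set u : E d := EuclideanSpace.single ⟨0, hd⟩ (2 * |R| + 1) with hu
  have hun : ‖u‖ = 2 * |R| + 1 := by
    rw [hu, PiLp.norm_single, Real.norm_eq_abs, abs_of_nonneg (by positivity)]
  refine lt_of_le_of_lt (lintegral_mono fun x => ENNReal.ofReal_le_ofReal ?_) (h u)
  by_cases hx : x ∈ Q
  · have : x + u ∉ Q := by
      intro hxu
      have h1 := hR _ hx
      have h2 := hR _ hxu
      have h3 : ‖u‖ ≤ ‖x + u‖ + ‖x‖ := by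
        have := norm_sub_le (x + u) x
        simpa using this
      have := le_abs_self R
      linarith
    rw [haQ _ this]
    simp
  · rw [haQ _ hx]
    simp only [ne_eq, OfNat.ofNat_ne_zero, not_false_eq_true, zero_pow]
    positivity

/-! ### Remainders that are small in mean square -/

theorem two_mul_ofReal_add {a b : ℝ} (ha : 0 ≤ a) (hb : 0 ≤ b) :
    2 * ENNReal.ofReal a + 2 * ENNReal.ofReal b = ENNReal.ofReal (2 * a + 2 * b) := by
  rw [ENNReal.ofReal_add (by positivity) (by positivity), ENNReal.ofReal_mul (by norm_num),
    ENNReal.ofReal_mul (by norm_num)]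
  simp

theorem lintegral_sq_add_le {α : Type*} [MeasurableSpace α] {μ : Measure α} {F G : α → ℝ}
    (hF : Measurable F) :
    ∫⁻ a, ENNReal.ofReal ((F a + G a) ^ 2) ∂μ ≤
      2 * ∫⁻ a, ENNReal.ofReal (F a ^ 2) ∂μ + 2 * ∫⁻ a, ENNReal.ofReal (G a ^ 2) ∂μ := by
  rw [← lintegral_const_mul' 2 _ (by simp), ← lintegral_const_mul' 2 _ (by simp),
    ← lintegral_add_left ((hF.pow_const 2).ennreal_ofReal.const_mul 2)]
  refine lintegral_mono fun a => ?_
  rw [two_mul_ofReal_add (sq_nonneg _) (sq_nonneg _)]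
  exact ENNReal.ofReal_le_ofReal (by nlinarith [sq_nonneg (F a - G a)])

theorem lintegral_sq_const_mul_le {α : Type*} [MeasurableSpace α] {μ : Measure α} {F G : α → ℝ}
    {c : ℝ} (h : ∀ a, |F a| ≤ c * |G a|) :
    ∫⁻ a, ENNReal.ofReal (F a ^ 2) ∂μ ≤
      ENNReal.ofReal (c ^ 2) * ∫⁻ a, ENNReal.ofReal (G a ^ 2) ∂μ := by
  rw [← lintegral_const_mul' _ _ ENNReal.ofReal_ne_top]
  refine lintegral_mono fun a => ?_
  rw [← ENNReal.ofReal_mul (sq_nonneg _)]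
  refine ENNReal.ofReal_le_ofReal ?_
  rw [← sq_abs (F a), ← sq_abs (G a), ← mul_pow]
  exact pow_le_pow_left₀ (abs_nonneg _) (h a) 2

/-- The mean square in `x` of `R x v` is at most of order `‖v‖ ^ (2 s)` near `0` and grows at most
polynomially. -/
def L2Small {d : ℕ} (s : ℝ) (R : E d → E d → ℝ) : Prop :=
  Measurable (Function.uncurry R) ∧ ∃ (C : ℝ) (p : ℕ), ∀ v,
    ∫⁻ x, ENNReal.ofReal (R x v ^ 2) ≤ ENNReal.ofReal (C * (‖v‖ ^ s * (1 + ‖v‖) ^ p) ^ 2)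

namespace L2Small

variable {d : ℕ} {s : ℝ} {R T : E d → E d → ℝ}

theorem add (hR : L2Small s R) (hT : L2Small s T) : L2Small s (fun x v => R x v + T x v) := by
  obtain ⟨hRm, C, p, h⟩ := hR
  obtain ⟨hTm, D, q, h'⟩ := hT
  refine ⟨hRm.add hTm, 2 * |C| + 2 * |D|, p + q, fun v => ?_⟩
  refine (lintegral_sq_add_le (F := fun x => R x v) (G := fun x => T x v)
    hRm.of_uncurry_right).trans ?_
  have h1 : (1 : ℝ) ≤ 1 + ‖v‖ := by linarith [norm_nonneg v]
  have e1 : C * (‖v‖ ^ s * (1 + ‖v‖) ^ p) ^ 2 ≤ |C| * (‖v‖ ^ s * (1 + ‖v‖) ^ (p + q)) ^ 2 := by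
    refine mul_le_mul (le_abs_self _) ?_ (by positivity) (abs_nonneg _)
    exact pow_le_pow_left₀ (by positivity) (mul_le_mul_of_nonneg_left
      (pow_le_pow_right₀ h1 (by omega)) (by positivity)) 2
  have e2 : D * (‖v‖ ^ s * (1 + ‖v‖) ^ q) ^ 2 ≤ |D| * (‖v‖ ^ s * (1 + ‖v‖) ^ (p + q)) ^ 2 := by
    refine mul_le_mul (le_abs_self _) ?_ (by positivity) (abs_nonneg _)
    exact pow_le_pow_left₀ (by positivity) (mul_le_mul_of_nonneg_left
      (pow_le_pow_right₀ h1 (by omega)) (by positivity)) 2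
  calc _ ≤ 2 * ENNReal.ofReal (|C| * (‖v‖ ^ s * (1 + ‖v‖) ^ (p + q)) ^ 2) +
        2 * ENNReal.ofReal (|D| * (‖v‖ ^ s * (1 + ‖v‖) ^ (p + q)) ^ 2) := by
        gcongr
        · exact (h v).trans (ENNReal.ofReal_le_ofReal e1)
        · exact (h' v).trans (ENNReal.ofReal_le_ofReal e2)
    _ = _ := by
        rw [two_mul_ofReal_add (by positivity) (by positivity)]
        congr 1; ring

theorem of_abs_le (hR : L2Small s R) (hT : Measurable (Function.uncurry T)) {c : ℝ}
    (h : ∀ x v, |T x v| ≤ c * |R x v|) : L2Small s T := by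
  obtain ⟨hRm, C, p, hC⟩ := hR
  refine ⟨hT, c ^ 2 * C, p, fun v => ?_⟩
  refine (lintegral_sq_const_mul_le fun x => h x v).trans ?_
  rw [mul_assoc, ENNReal.ofReal_mul (sq_nonneg c)]
  gcongr
  exact hC v

theorem sum {ι : Type*} (A : Finset ι) {R : ι → E d → E d → ℝ} (hR : ∀ i ∈ A, L2Small s (R i)) :
    L2Small s (fun x v => ∑ i ∈ A, R i x v) := by
  classical
  induction A using Finset.induction_on with
  | empty => exact ⟨by simp [Function.uncurry_def], 0, 0, by simp⟩
  | insert i A hi ih =>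
    simp_rw [Finset.sum_insert hi]
    exact (hR i (Finset.mem_insert_self _ _)).add
      (ih fun j hj => hR j (Finset.mem_insert_of_mem hj))

/-- An integer order `N ≥ s` suffices: near `0` the power `N` is the smaller one, and far away it is
absorbed by the polynomial factor. -/
theorem of_le_mul_norm_pow {N q : ℕ} (hsN : s ≤ N) {C : ℝ}
    (hR : Measurable (Function.uncurry R)) (h : ∀ v,
      ∫⁻ x, ENNReal.ofReal (R x v ^ 2) ≤ ENNReal.ofReal (C * (‖v‖ ^ N * (1 + ‖v‖) ^ q) ^ 2))
    (hs : 0 < s) : L2Small s R := by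
  refine ⟨hR, |C|, N + q, fun v => (h v).trans (ENNReal.ofReal_le_ofReal ?_)⟩
  refine mul_le_mul (le_abs_self _) ?_ (by positivity) (abs_nonneg _)
  have h1 : (1 : ℝ) ≤ 1 + ‖v‖ := by linarith [norm_nonneg v]
  have key : ‖v‖ ^ N ≤ ‖v‖ ^ s * (1 + ‖v‖) ^ N := by
    rcases le_total ‖v‖ 1 with hv | hv
    · rcases (norm_nonneg v).eq_or_lt with h0 | h0
      · rw [← h0, Real.zero_rpow hs.ne']
        have : N ≠ 0 := by rintro rfl; simp at hsN; linarith
        simp [this]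
      · calc ‖v‖ ^ N = ‖v‖ ^ (N : ℝ) := (Real.rpow_natCast _ _).symm
          _ ≤ ‖v‖ ^ s := Real.rpow_le_rpow_of_exponent_ge h0 hv hsN
          _ ≤ _ := le_mul_of_one_le_right (by positivity) (one_le_pow₀ h1)
    · calc ‖v‖ ^ N ≤ 1 * (1 + ‖v‖) ^ N := by rw [one_mul]; gcongr; linarith
        _ ≤ _ := by gcongr; exact Real.one_le_rpow hv hs.le
  refine pow_le_pow_left₀ (by positivity) ?_ 2
  calc ‖v‖ ^ N * (1 + ‖v‖) ^ q ≤ (‖v‖ ^ s * (1 + ‖v‖) ^ N) * (1 + ‖v‖) ^ q := by gcongr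
    _ = _ := by rw [pow_add, mul_assoc]

end L2Small

/-! ### Polynomial expansions in mean square -/

/-- `G x v` is, up to a remainder of order `s` in mean square, a polynomial of degree less than `r`
in `v` with square integrable coefficients vanishing off `Q`. -/
def L2Expandable {d : ℕ} (Q : Set (E d)) (r : ℕ) (s : ℝ) (G : E d → E d → ℝ) : Prop :=
  ∃ (ι : Type) (_ : Fintype ι) (l : ι → Fin d → ℕ) (a : ι → E d → ℝ),
    (∀ i, ∑ k, l i k < r) ∧ (∀ i, Measurable (a i)) ∧ (∀ i, ∀ x ∉ Q, a i x = 0) ∧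
    (∀ i, ∫⁻ x, ENNReal.ofReal (a i x ^ 2) < ⊤) ∧
    L2Small s (fun x v => G x v - ∑ i, a i x * monomial (l i) v)

/-- Uniformly in `x ∈ Q`, `f (x + v)` is a polynomial of degree less than `r` in `v` up to
`O(‖v‖ ^ r)`, with bounded coefficients. -/
def TaylorOn {d : ℕ} (Q : Set (E d)) (r : ℕ) (f : E d → ℝ) : Prop :=
  ∃ (κ : Type) (_ : Fintype κ) (m : κ → Fin d → ℕ) (b : κ → E d → ℝ) (C : ℝ), 0 ≤ C ∧
    (∀ j, ∑ k, m j k < r) ∧ (∀ j, Measurable (b j)) ∧ (∀ j x, |b j x| ≤ C) ∧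
    ∀ x ∈ Q, ∀ v, |f (x + v) - ∑ j, b j x * monomial (m j) v| ≤ C * ‖v‖ ^ r

theorem measurable_mul_monomial {d : ℕ} {a : E d → ℝ} (ha : Measurable a) (l : Fin d → ℕ) :
    Measurable fun p : E d × E d => a p.1 * monomial l p.2 :=
  (ha.comp measurable_fst).mul ((measurable_monomial l).comp measurable_snd)

namespace L2Expandable

variable {d : ℕ} {Q : Set (E d)} {r : ℕ} {s : ℝ} {G H : E d → E d → ℝ}

theorem measurable (hG : L2Expandable Q r s G) : Measurable (Function.uncurry G) := by
  obtain ⟨ι, _, l, a, hl, ham, haQ, ha2, hR⟩ := hG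
  have h1 : Measurable fun p : E d × E d => ∑ i, a i p.1 * monomial (l i) p.2 :=
    Finset.measurable_fun_sum _ fun i _ => measurable_mul_monomial (ham i) (l i)
  convert hR.1.add h1 using 1
  funext p
  simp [Function.uncurry_def]

theorem add_small (hG : L2Expandable Q r s G) (hR : L2Small s H) :
    L2Expandable Q r s (fun x v => G x v + H x v) := by
  obtain ⟨ι, _, l, a, hl, ham, haQ, ha2, hT⟩ := hG
  refine ⟨ι, inferInstance, l, a, hl, ham, haQ, ha2, ?_⟩
  convert! hT.add hR using 3
  ring

theorem add (hG : L2Expandable Q r s G) (hH : L2Expandable Q r s H) :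
    L2Expandable Q r s (fun x v => G x v + H x v) := by
  obtain ⟨ι, _, l, a, hl, ham, haQ, ha2, hR⟩ := hG
  obtain ⟨κ, _, m, b, hm, hbm, hbQ, hb2, hT⟩ := hH
  refine ⟨ι ⊕ κ, inferInstance, Sum.elim l m, Sum.elim a b, ?_, ?_, ?_, ?_, ?_⟩
  · rintro (i | j); exacts [hl i, hm j]
  · rintro (i | j); exacts [ham i, hbm j]
  · rintro (i | j); exacts [haQ i, hbQ j]
  · rintro (i | j); exacts [ha2 i, hb2 j]
  · convert! hR.add hT using 3
    rw [Fintype.sum_sum_type]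
    simp only [Sum.elim_inl, Sum.elim_inr]
    ring

theorem zero : L2Expandable Q r s (fun _ _ => 0) :=
  ⟨Empty, inferInstance, fun i => i.elim, fun i => i.elim, fun i => i.elim, fun i => i.elim,
    fun i => i.elim, fun i => i.elim, ⟨by simp [Function.uncurry_def],
      0, 0, by simp⟩⟩

theorem sum {ι : Type*} (A : Finset ι) {G : ι → E d → E d → ℝ}
    (hG : ∀ i ∈ A, L2Expandable Q r s (G i)) :
    L2Expandable Q r s (fun x v => ∑ i ∈ A, G i x v) := by
  classical
  induction A using Finset.induction_on with
  | empty => simpa using zero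
  | insert i A hi ih =>
    simp_rw [Finset.sum_insert hi]
    exact (hG i (Finset.mem_insert_self _ _)).add
      (ih fun j hj => hG j (Finset.mem_insert_of_mem hj))

theorem const_mul (hG : L2Expandable Q r s G) {c : E d → ℝ} (hc : Measurable c) {B : ℝ}
    (hB : ∀ x, |c x| ≤ B) : L2Expandable Q r s (fun x v => c x * G x v) := by
  obtain ⟨ι, _, l, a, hl, ham, haQ, ha2, hR⟩ := hG
  refine ⟨ι, inferInstance, l, fun i x => c x * a i x, hl, fun i => hc.mul (ham i), ?_, ?_, ?_⟩
  · intro i x hx; simp [haQ i x hx]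
  · intro i
    refine (lintegral_sq_const_mul_le (c := B) (G := a i) fun x => ?_).trans_lt
      (ENNReal.mul_lt_top ENNReal.ofReal_lt_top (ha2 i))
    rw [abs_mul]; gcongr; exact hB x
  · have hc1 : Measurable fun p : E d × E d => c p.1 := hc.comp measurable_fst
    refine (L2Small.of_abs_le (c := B) hR (T := fun x v => c x *
      (G x v - ∑ i, a i x * monomial (l i) v)) (hc1.mul hR.1) fun x v => ?_).of_abs_le
      (c := 1) ?_ fun x v => ?_
    · rw [abs_mul]; gcongr; exact hB x
    · convert hc1.mul hR.1 using 1
      funext p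
      simp only [Function.uncurry_def, Pi.mul_apply, mul_sub, Finset.mul_sum]
      congr 1
      exact Finset.sum_congr rfl fun i _ => by ring
    · rw [one_mul, mul_sub, Finset.mul_sum]
      refine le_of_eq ?_
      congr 2
      exact Finset.sum_congr rfl fun i _ => by ring

/-- Multiply the two expansions. Products of monomials of total degree at least `r ≥ s` go to the
remainder, together with `f` times the remainder of `G` and the polynomial part of `G` times the
Taylor remainder of `f`. In the last product the coefficients vanish off `Q`, so a Taylor formula at
the points of `Q` is enough. -/
theorem mul_taylor (hs : 0 < s) (hsr : s ≤ r) (hG : L2Expandable Q r s G) {f : E d → ℝ}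
    (hfm : Measurable f) {M : ℝ} (hM : ∀ x, |f x| ≤ M) (hf : TaylorOn Q r f) :
    L2Expandable Q r s (fun x v => f (x + v) * G x v) := by
  classical
  have hr : 0 < r := by
    rcases Nat.eq_zero_or_pos r with rfl | h
    · simp at hsr; linarith
    · exact h
  have hGm := hG.measurable
  obtain ⟨ι, _, l, a, hl, ham, haQ, ha2, hR⟩ := hG
  obtain ⟨κ, _, m, b, C, hC, hm, hbm, hbC, hT⟩ := hf
  have hfv : Measurable fun p : E d × E d => f (p.1 + p.2) :=
    hfm.comp (measurable_fst.add measurable_snd)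
  have hab2 : ∀ i j, ∫⁻ x, ENNReal.ofReal ((a i x * b j x) ^ 2) < ⊤ := fun i j => by
    refine (lintegral_sq_const_mul_le (c := C) (G := a i) fun x => ?_).trans_lt
      (ENNReal.mul_lt_top ENNReal.ofReal_lt_top (ha2 i))
    rw [abs_mul, mul_comm]; gcongr; exact hbC j x
  set low : ι × κ → Prop := fun p => ∑ k, (l p.1 + m p.2) k < r with hlow
  have hpow : ∀ n (v : E d), ‖v‖ ^ n ≤ 1 * (1 + ‖v‖) ^ n := fun n v => by
    rw [one_mul]; gcongr; linarith [norm_nonneg v]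
  -- Pairs of too high degree stay in the index set with coefficient `0` and exponent `0`; the
  -- degree condition then holds because `0 < r`.
  refine ⟨ι × κ, inferInstance, fun p => if low p then l p.1 + m p.2 else 0,
    fun p x => if low p then a p.1 x * b p.2 x else 0, ?_, ?_, ?_, ?_, ?_⟩
  · intro p
    by_cases hp : low p
    · simp only [hp, if_true]; exact hp
    · simpa [hp] using hr
  · intro p
    by_cases hp : low p
    · simp only [hp, if_true]; exact (ham p.1).mul (hbm p.2)
    · simp [hp]
  · intro p x hx; simp [haQ p.1 x hx]
  · intro p
    by_cases hp : low p
    · simpa [hp] using hab2 p.1 p.2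
    · simp [hp]
  · have hsplit : ∀ x v, f (x + v) * G x v - ∑ p : ι × κ, (if low p then a p.1 x * b p.2 x else 0) *
          monomial (if low p then l p.1 + m p.2 else 0) v =
        f (x + v) * (G x v - ∑ i, a i x * monomial (l i) v) +
        (∑ i, a i x * monomial (l i) v * (f (x + v) - ∑ j, b j x * monomial (m j) v) +
        ∑ p : ι × κ, (if low p then 0 else a p.1 x * b p.2 x) * monomial (l p.1 + m p.2) v) := by
      intro x v
      have h1 : (∑ i, a i x * monomial (l i) v) * ∑ j, b j x * monomial (m j) v =
          ∑ p : ι × κ, (a p.1 x * b p.2 x) * monomial (l p.1 + m p.2) v := by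
        rw [Finset.sum_mul_sum, Fintype.sum_prod_type]
        refine Finset.sum_congr rfl fun i _ => Finset.sum_congr rfl fun j _ => ?_
        rw [monomial_add]; ring
      have h2 : ∑ p : ι × κ, (a p.1 x * b p.2 x) * monomial (l p.1 + m p.2) v =
          ∑ p : ι × κ, (if low p then a p.1 x * b p.2 x else 0) *
            monomial (if low p then l p.1 + m p.2 else 0) v +
          ∑ p : ι × κ, (if low p then 0 else a p.1 x * b p.2 x) *
            monomial (l p.1 + m p.2) v := by
        rw [← Finset.sum_add_distrib]
        refine Finset.sum_congr rfl fun p _ => ?_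
        by_cases hp : low p <;> simp [hp]
      rw [← Finset.sum_mul, mul_sub, mul_sub, h1, h2]
      ring
    simp_rw [hsplit]
    refine L2Small.add ?_ (L2Small.add (L2Small.sum _ fun i _ => ?_) (L2Small.sum _ fun p _ => ?_))
    · refine hR.of_abs_le (c := M) (hfv.mul hR.1) fun x v => ?_
      rw [abs_mul]; gcongr; exact hM _
    · refine L2Small.of_le_mul_norm_pow (N := r) (q := ∑ k, l i k) hsr
        (C := C ^ 2 * (∫⁻ x, ENNReal.ofReal (a i x ^ 2)).toReal) ?_ (fun v => ?_) hs
      · refine (measurable_mul_monomial (ham i) (l i)).mul (hfv.sub ?_)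
        exact Finset.measurable_fun_sum _ fun j _ => measurable_mul_monomial (hbm j) (m j)
      · refine (lintegral_sq_const_mul_le (c := C * (‖v‖ ^ r * (1 + ‖v‖) ^ ∑ k, l i k))
          (G := a i) fun x => ?_).trans ?_
        · by_cases hx : x ∈ Q
          · rw [abs_mul, abs_mul]
            calc |a i x| * |monomial (l i) v| * |f (x + v) - ∑ j, b j x * monomial (m j) v|
                ≤ |a i x| * (1 * (1 + ‖v‖) ^ ∑ k, l i k) * (C * ‖v‖ ^ r) := by
                  gcongr
                  · exact (abs_monomial_le _ _).trans (hpow _ _)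
                  · exact hT x hx v
              _ = _ := by ring
          · simp [haQ i x hx]
        · rw [mul_pow, mul_right_comm (C ^ 2), ENNReal.ofReal_mul (p := C ^ 2 * _)
            (by positivity), ENNReal.ofReal_toReal (ha2 i).ne]
    · by_cases hp : low p
      · simp only [hp, if_true, zero_mul]
        exact ⟨by simp [Function.uncurry_def], 0, 0, by simp⟩
      · simp only [hp, if_false]
        refine L2Small.of_le_mul_norm_pow (N := ∑ k, (l p.1 + m p.2) k) (q := 0)
          (hsr.trans (by exact_mod_cast not_lt.1 hp))
          (C := (∫⁻ x, ENNReal.ofReal ((a p.1 x * b p.2 x) ^ 2)).toReal)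
          (measurable_mul_monomial ((ham p.1).mul (hbm p.2)) _) (fun v => ?_) hs
        refine (lintegral_sq_const_mul_le (c := ‖v‖ ^ (∑ k, (l p.1 + m p.2) k))
          (G := fun x => a p.1 x * b p.2 x) fun x => ?_).trans ?_
        · rw [abs_mul _ (monomial _ _), mul_comm]
          gcongr
          exact abs_monomial_le _ _
        · rw [mul_comm _ ((_ : ℝ) ^ 2), ENNReal.ofReal_mul (by positivity),
            ENNReal.ofReal_toReal (hab2 _ _).ne]
          simp

end L2Expandable

/-! ### Taylor expansions of the density and of the integrand -/

theorem sum_partialDeriv_eq {d : ℕ} (n : ℕ) (g : E d → ℝ) (x v : E d) :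
    ∑ p : (m : Fin n) × (Fin m → Fin d),
      partialDeriv p.2 g x / (p.1 : ℕ).factorial * monomial (exponents p.2) v =
    ∑ m ∈ Finset.range n, (1 : ℝ) ^ m / m.factorial * iteratedFDeriv ℝ m g x (fun _ => v) := by
  rw [Fintype.sum_sigma, Finset.sum_range]
  refine Finset.sum_congr rfl fun m _ => ?_
  rw [iteratedFDeriv_apply_const, Finset.mul_sum]
  refine Finset.sum_congr rfl fun I _ => ?_
  rw [one_pow]
  ring

theorem TimesDifferentiable.continuous_partialDeriv {d k m : ℕ} {g : E d → ℝ}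
    (hg : TimesDifferentiable k g) (hm : m < k) (I : Fin m → Fin d) :
    Continuous (partialDeriv I g) :=
  (ContinuousMultilinearMap.apply ℝ (fun _ : Fin m => E d) ℝ
    (fun j => EuclideanSpace.single (I j) (1 : ℝ))).continuous.comp (hg m hm).continuous

/-- Derivatives of the top order exist but may be discontinuous; they are measurable as directional
derivatives of the previous order. -/
theorem TimesDifferentiable.measurable_partialDeriv {d k m : ℕ} {g : E d → ℝ}
    (hg : TimesDifferentiable k g) (hgm : Measurable g) (hm : m ≤ k) (I : Fin m → Fin d) :
    Measurable (partialDeriv I g) := by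
  cases m with
  | zero =>
    convert hgm using 1
    funext x
    simp [partialDeriv]
  | succ m =>
    set A := ContinuousMultilinearMap.apply ℝ (fun _ : Fin m => E d) ℝ
      (Fin.tail fun j => EuclideanSpace.single (I j) (1 : ℝ)) with hA
    have h : partialDeriv I g = fun x => fderiv ℝ (fun x => A (iteratedFDeriv ℝ m g x)) x
        (EuclideanSpace.single (I 0) (1 : ℝ)) := by
      funext x
      have h1 := (A.hasFDerivAt (x := iteratedFDeriv ℝ m g x)).comp x
        (hg m (by omega) x).hasFDerivAt
      have h2 : fderiv ℝ (fun x => A (iteratedFDeriv ℝ m g x)) x =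
        A.comp (fderiv ℝ (iteratedFDeriv ℝ m g) x) := h1.fderiv
      rw [partialDeriv, iteratedFDeriv_succ_apply_left, h2]
      rfl
    rw [h]
    exact measurable_fderiv_apply_const ℝ _ _

/-- Only the derivatives of order `r` are bounded everywhere. The lower ones are continuous, hence
bounded on the compact set `Q`, and the coefficients are cut off outside it. -/
theorem HasBoundedDerivs.taylorOn {d r : ℕ} {f : E d → ℝ} (hf : HasBoundedDerivs r f)
    {Q : Set (E d)} (hQ : IsCompact Q) : TaylorOn Q r f := by
  obtain ⟨hd, M, hM⟩ := hf
  have hbd : ∀ p : (m : Fin r) × (Fin m → Fin d), ∃ C, ∀ x ∈ Q, |partialDeriv p.2 f x| ≤ C :=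
    fun p => by
      obtain ⟨C, hC⟩ := hQ.exists_bound_of_continuousOn
        (hd.continuous_partialDeriv p.1.2 p.2).continuousOn
      exact ⟨C, hC⟩
  choose B hB using hbd
  set C : ℝ := ∑ p, |B p| + (d : ℝ) ^ r * |M| with hC
  have hC0 : 0 ≤ C := by positivity
  refine ⟨(m : Fin r) × (Fin m → Fin d), inferInstance, fun p => exponents p.2,
    fun p => Q.indicator fun x => partialDeriv p.2 f x / (p.1 : ℕ).factorial, C, hC0,
    fun p => ?_, fun p => ?_, fun p x => ?_, fun x hx v => ?_⟩
  · rw [sum_exponents]; exact p.1.2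
  · exact ((hd.continuous_partialDeriv p.1.2 p.2).measurable.div_const _).indicator
      hQ.measurableSet
  · beta_reduce
    by_cases hx : x ∈ Q
    · rw [Set.indicator_of_mem hx, abs_div, Nat.abs_cast]
      have h1 : (1 : ℝ) ≤ (p.1 : ℕ).factorial := by
        exact_mod_cast Nat.one_le_iff_ne_zero.2 (Nat.factorial_ne_zero _)
      calc |partialDeriv p.2 f x| / (p.1 : ℕ).factorial ≤ |partialDeriv p.2 f x| :=
            div_le_self (abs_nonneg _) h1
        _ ≤ B p := hB p x hx
        _ ≤ |B p| := le_abs_self _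
        _ ≤ ∑ p, |B p| := Finset.single_le_sum (f := fun p => |B p|)
            (fun _ _ => abs_nonneg _) (Finset.mem_univ p)
        _ ≤ C := by rw [hC]; linarith [show 0 ≤ (d : ℝ) ^ r * |M| by positivity]
    · rw [Set.indicator_of_notMem hx, abs_zero]; exact hC0
  · simp_rw [Set.indicator_of_mem hx]
    rw [sum_partialDeriv_eq]
    have h := abs_sub_taylor_le (r := r)
      (F := fun m t => iteratedFDeriv ℝ m f (x + t • v) (fun _ => v))
      (fun m hm t => hasDerivAt_iteratedFDeriv_line hd hm x v t)
      (B := (d : ℝ) ^ r * |M| * ‖v‖ ^ r) (fun t _ => ?_) (t := 1) (by simp)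
    · simp only [iteratedFDeriv_zero_apply, one_smul, zero_smul, add_zero] at h
      refine h.trans ?_
      gcongr
      rw [hC]
      linarith [show 0 ≤ ∑ p, |B p| by positivity]
    · rw [iteratedFDeriv_apply_const]
      refine (Finset.abs_sum_le_sum_abs _ _).trans ?_
      calc ∑ I : Fin r → Fin d, |monomial (exponents I) v * partialDeriv I f (x + t • v)|
          ≤ ∑ I : Fin r → Fin d, ‖v‖ ^ r * |M| := by
            refine Finset.sum_le_sum fun I _ => ?_
            rw [abs_mul]
            exact mul_le_mul ((abs_monomial_le _ _).trans (by rw [sum_exponents]))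
              ((hM I _).trans (le_abs_self _)) (abs_nonneg _) (by positivity)
        _ = _ := by
            simp only [Finset.sum_const, Finset.card_univ, Fintype.card_pi, Fintype.card_fin,
              Finset.prod_const, nsmul_eq_mul, Nat.cast_pow]
            ring

/-- A bounded function with Taylor expansions on `Q` is Lipschitz at the points of `Q`. -/
theorem TaylorOn.exists_lipschitz {d r : ℕ} {f : E d → ℝ} {Q : Set (E d)} (hf : TaylorOn Q r f)
    (hr : 0 < r) {M : ℝ} (hM : ∀ x, |f x| ≤ M) :
    ∃ L : ℝ, 0 < L ∧ ∀ x ∈ Q, ∀ v, |f (x + v) - f x| ≤ L * ‖v‖ := by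
  obtain ⟨κ, _, m, b, C, hC, hm, hbm, hbC, hT⟩ := hf
  have hM0 : 0 ≤ M := (abs_nonneg _).trans (hM 0)
  refine ⟨C + ∑ _j : κ, C + 2 * M + 1, by positivity, fun x hx v => ?_⟩
  have hsum : 0 ≤ ∑ _j : κ, C := by positivity
  rcases le_total ‖v‖ 1 with hv | hv
  · have h0 := hT x hx 0
    rw [norm_zero, zero_pow hr.ne', mul_zero, add_zero] at h0
    have h0 := abs_nonpos_iff.1 h0
    have hmon : ∀ j, |monomial (m j) v - monomial (m j) 0| ≤ ‖v‖ := by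
      intro j
      have hz : monomial (m j) (0 : E d) = 0 ^ (∑ k, m j k) * monomial (m j) v := by
        rw [← monomial_smul, zero_smul]
      rcases Nat.eq_zero_or_pos (∑ k, m j k) with h | h
      · rw [hz, h]; simp
      · rw [hz, zero_pow h.ne', zero_mul, sub_zero]
        exact (abs_monomial_le _ _).trans (pow_le_of_le_one (norm_nonneg _) hv h.ne')
    have e : f (x + v) - f x = (f (x + v) - ∑ j, b j x * monomial (m j) v) +
        ∑ j, b j x * (monomial (m j) v - monomial (m j) 0) := by
      simp_rw [mul_sub, Finset.sum_sub_distrib]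
      linarith
    rw [e]
    calc _ ≤ |f (x + v) - ∑ j, b j x * monomial (m j) v| +
          ∑ j, |b j x * (monomial (m j) v - monomial (m j) 0)| :=
          (abs_add_le _ _).trans (by gcongr; exact Finset.abs_sum_le_sum_abs _ _)
      _ ≤ C * ‖v‖ + ∑ _j : κ, C * ‖v‖ := by
          gcongr with j _
          · exact (hT x hx v).trans (by
              gcongr; exact pow_le_of_le_one (norm_nonneg _) hv hr.ne')
          · rw [abs_mul]; exact mul_le_mul (hbC j x) (hmon j) (abs_nonneg _) hC
      _ = (C + ∑ _j : κ, C) * ‖v‖ := by rw [add_mul, Finset.sum_mul]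
      _ ≤ _ := mul_le_mul_of_nonneg_right (by linarith) (norm_nonneg v)
  · calc |f (x + v) - f x| ≤ |f (x + v)| + |f x| := abs_sub _ _
      _ ≤ 2 * M * 1 := by linarith [hM (x + v), hM x]
      _ ≤ (C + ∑ _j : κ, C + 2 * M + 1) * ‖v‖ := by gcongr; linarith

theorem Nikolskii.exists_increment_bound {d : ℕ} {s : ℝ} {φ : E d → ℝ} (hφ : φ ∈ Nikolskii s) :
    Measurable φ ∧ ∃ (k : ℕ) (α C : ℝ), s = k + α ∧ 0 < α ∧ 0 ≤ C ∧ TimesDifferentiable k φ ∧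
    ∀ m : ℕ, m ≤ k → ∀ (I : Fin m → Fin d) (u : E d),
      ∫⁻ x, ENNReal.ofReal ((partialDeriv I φ (x + u) - partialDeriv I φ x) ^ 2)
        ≤ ENNReal.ofReal (C * ‖u‖ ^ (2 * α)) := by
  obtain ⟨hm, k, α, C, hs, hα, -, hd, h⟩ := hφ
  refine ⟨hm, k, α, |C|, hs, hα, abs_nonneg _, hd, fun m hmk I u => (h m hmk I u).trans ?_⟩
  refine ENNReal.ofReal_le_ofReal ?_
  gcongr
  exact le_abs_self C

theorem Nikolskii.lintegral_sq_partialDeriv_lt_top {d : ℕ} (hd : 1 ≤ d) {φ : E d → ℝ}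
    {m : ℕ} {I : Fin m → Fin d} {α C : ℝ}
    (hφc : HasCompactSupport φ)
    (h : ∀ u : E d, ∫⁻ x, ENNReal.ofReal ((partialDeriv I φ (x + u) - partialDeriv I φ x) ^ 2)
        ≤ ENNReal.ofReal (C * ‖u‖ ^ (2 * α))) :
    (∀ x ∉ tsupport φ, partialDeriv I φ x = 0) ∧
      ∫⁻ x, ENNReal.ofReal (partialDeriv I φ x ^ 2) < ⊤ := by
  have h0 : ∀ x ∉ tsupport φ, partialDeriv I φ x = 0 := by
    intro x hx
    have : iteratedFDeriv ℝ m φ x = 0 := by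
      by_contra hne
      exact hx (support_iteratedFDeriv_subset (𝕜 := ℝ) m (Function.mem_support.2 hne))
    rw [partialDeriv, this]
    rfl
  exact ⟨h0, lintegral_sq_lt_top_of_increments hd hφc.isCompact.isBounded h0
    fun u => (h u).trans_lt ENNReal.ofReal_lt_top⟩

theorem Nikolskii.lintegral_sq_lt_top {d : ℕ} (hd : 1 ≤ d) {s : ℝ} {φ : E d → ℝ}
    (hφ : φ ∈ Nikolskii s) (hφc : HasCompactSupport φ) :
    ∫⁻ x, ENNReal.ofReal (φ x ^ 2) < ⊤ := by
  obtain ⟨hm, k, α, C, hs, hα, hC, hdk, h⟩ := Nikolskii.exists_increment_bound hφ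
  simpa [partialDeriv] using (Nikolskii.lintegral_sq_partialDeriv_lt_top hd hφc
    (h 0 (Nat.zero_le _) (Fin.elim0))).2

/-- In Taylor's formula in mean square, the increments of the derivatives of order `k` give `‖v‖ ^
α` and the `k` directions give `‖v‖ ^ k`, which together make `‖v‖ ^ s`. The degrees are at most
`k`, and `k < s ≤ r` because `α > 0`. -/
theorem Nikolskii.l2Expandable {d : ℕ} (hd : 1 ≤ d) {s : ℝ} {φ : E d → ℝ}
    (hφ : φ ∈ Nikolskii s) (hφc : HasCompactSupport φ) {r : ℕ} (hsr : s ≤ r) :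
    L2Expandable (tsupport φ) r s (fun x v => φ (x + v)) := by
  obtain ⟨hm, k, α, C, hs, hα, hC, hdk, h⟩ := Nikolskii.exists_increment_bound hφ
  have hkr : k < r := by
    have : (k : ℝ) < r := by linarith
    exact_mod_cast this
  have hI : ∀ p : (m : Fin (k + 1)) × (Fin m → Fin d),
      Measurable (partialDeriv p.2 φ) ∧ (∀ x ∉ tsupport φ, partialDeriv p.2 φ x = 0) ∧
      ∫⁻ x, ENNReal.ofReal (partialDeriv p.2 φ x ^ 2) < ⊤ := fun p =>
    have hp : (p.1 : ℕ) ≤ k := Nat.lt_succ_iff.1 p.1.2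
    ⟨hdk.measurable_partialDeriv hm hp p.2,
      Nikolskii.lintegral_sq_partialDeriv_lt_top hd hφc (h _ hp p.2)⟩
  refine ⟨_, inferInstance, fun p : (m : Fin (k + 1)) × (Fin m → Fin d) => exponents p.2,
    fun p x => partialDeriv p.2 φ x / (p.1 : ℕ).factorial, fun p => ?_, fun p => ?_,
    fun p x hx => ?_, fun p => ?_, ?_, (((d : ℝ) ^ k) ^ 2 * C), 0, fun v => ?_⟩
  · rw [sum_exponents]; exact lt_of_lt_of_le p.1.2 hkr
  · exact (hI p).1.div_const _
  · simp only [(hI p).2.1 x hx, zero_div]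
  · refine (lintegral_sq_const_mul_le (c := ((p.1 : ℕ).factorial : ℝ)⁻¹)
      (G := partialDeriv p.2 φ) fun x => ?_).trans_lt
      (ENNReal.mul_lt_top ENNReal.ofReal_lt_top (hI p).2.2)
    rw [abs_div, Nat.abs_cast, div_eq_inv_mul]
  · refine (hm.comp (measurable_fst.add measurable_snd)).sub ?_
    exact Finset.measurable_fun_sum _ fun p _ =>
      measurable_mul_monomial ((hI p).1.div_const _) _
  · simp_rw [sum_partialDeriv_eq]
    have hF : ∀ m ≤ k, Measurable fun x => iteratedFDeriv ℝ m φ x (fun _ => v) := by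
      intro m hmk
      simp_rw [iteratedFDeriv_apply_const]
      exact Finset.measurable_fun_sum _ fun I _ =>
        (hdk.measurable_partialDeriv hm hmk I).const_mul _
    have key := lintegral_sq_sub_taylor_le (k := k) (v := v)
      (F := fun m x => iteratedFDeriv ℝ m φ x (fun _ => v))
      (fun m hmk x t => hasDerivAt_iteratedFDeriv_line hdk hmk x v t) hF
      (B := ENNReal.ofReal (((d : ℝ) ^ k) ^ 2 * C * (‖v‖ ^ s * (1 + ‖v‖) ^ 0) ^ 2))
      (fun t ht => ?_) (t := 1) (by simp)
    · simpa using key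
    · simp_rw [iteratedFDeriv_apply_const, ← Finset.sum_sub_distrib, ← mul_sub]
      have hcard : (Finset.univ : Finset (Fin k → Fin d)).card = d ^ k := by simp
      calc ∫⁻ x, ENNReal.ofReal ((∑ I : Fin k → Fin d, monomial (exponents I) v *
              (partialDeriv I φ (x + t • v) - partialDeriv I φ x)) ^ 2)
          ≤ ∫⁻ x, ∑ I : Fin k → Fin d, ENNReal.ofReal ((d : ℝ) ^ k * (‖v‖ ^ k) ^ 2) *
              ENNReal.ofReal ((partialDeriv I φ (x + t • v) - partialDeriv I φ x) ^ 2) := by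
            refine lintegral_mono fun x => ?_
            simp_rw [← ENNReal.ofReal_mul (show 0 ≤ (d : ℝ) ^ k * (‖v‖ ^ k) ^ 2 by positivity)]
            rw [← ENNReal.ofReal_sum_of_nonneg fun _ _ => by positivity]
            refine ENNReal.ofReal_le_ofReal (sq_sum_le_card_mul_sum_sq.trans ?_)
            rw [hcard, Finset.mul_sum]
            refine Finset.sum_le_sum fun I _ => ?_
            rw [mul_pow, Nat.cast_pow, mul_assoc]
            gcongr _ * (?_ * _)
            rw [← sq_abs]
            gcongr
            exact (abs_monomial_le _ _).trans (by rw [sum_exponents])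
        _ = ∑ I : Fin k → Fin d, ENNReal.ofReal ((d : ℝ) ^ k * (‖v‖ ^ k) ^ 2) *
              ∫⁻ x, ENNReal.ofReal ((partialDeriv I φ (x + t • v) - partialDeriv I φ x) ^ 2) := by
            rw [lintegral_finsetSum _ fun I _ => ?_]
            · refine Finset.sum_congr rfl fun I _ => ?_
              rw [lintegral_const_mul' _ _ ENNReal.ofReal_ne_top]
            · have hI := hdk.measurable_partialDeriv hm le_rfl I
              exact (((hI.comp (measurable_add_const _)).sub
                hI).pow_const 2).ennreal_ofReal.const_mul _
        _ ≤ ∑ I : Fin k → Fin d, ENNReal.ofReal ((d : ℝ) ^ k * (‖v‖ ^ k) ^ 2) *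
              ENNReal.ofReal (C * ‖v‖ ^ (2 * α)) := by
            refine Finset.sum_le_sum fun I _ => ?_
            gcongr
            refine (h k le_rfl I (t • v)).trans (ENNReal.ofReal_le_ofReal ?_)
            gcongr
            rw [norm_smul, Real.norm_eq_abs, abs_of_nonneg ht.1]
            exact mul_le_of_le_one_left (norm_nonneg _) ht.2
        _ = _ := by
            rw [Finset.sum_const, hcard, nsmul_eq_mul, ← ENNReal.ofReal_mul (by positivity),
              ← ENNReal.ofReal_natCast, ← ENNReal.ofReal_mul (by positivity)]
            congr 1
            rw [hs, Real.rpow_add_of_nonneg (norm_nonneg _) (by positivity) hα.le,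
              Real.rpow_natCast, mul_comm 2 α, Real.rpow_mul (norm_nonneg _)]
            push_cast
            norm_num
            ring

/-! ### The quotient of the integrand by the density -/

/-- The quotient `φ / f` is expandable when `f` is bounded below on the support of `φ`. -/
theorem L2Expandable.div {d : ℕ} {s : ℝ} (hs : 0 < s) {r : ℕ} (hsr : s ≤ r) {φ f : E d → ℝ}
    (hφ2 : ∫⁻ x, ENNReal.ofReal (φ x ^ 2) < ⊤)
    (hφm : Measurable φ)
    (hφ : L2Expandable (tsupport φ) r s (fun x v => φ (x + v)))
    (hfm : Measurable f) {M : ℝ} (hM : ∀ x, |f x| ≤ M) (hf : TaylorOn (tsupport φ) r f)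
    {b : ℝ} (hb : 0 < b) (hfb : ∀ x ∈ tsupport φ, b ≤ f x) :
    L2Expandable (tsupport φ) r s (fun x v => φ (x + v) / f (x + v)) := by
  have hr : 0 < r := by
    rcases Nat.eq_zero_or_pos r with rfl | h
    · simp at hsr; linarith
    · exact h
  obtain ⟨L, hL, hLip⟩ := hf.exists_lipschitz hr hM
  -- Multiplication by `f x - f (x + v)` preserves expandability: `f x` is a bounded coefficient and
  -- `f (x + v)` is covered by `mul_taylor`.
  have hpow : ∀ j : ℕ, L2Expandable (tsupport φ) r s
      (fun x v => φ (x + v) * (f x - f (x + v)) ^ j) := by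
    intro j
    induction j with
    | zero => simpa using hφ
    | succ j ih =>
      have h1 := ih.const_mul hfm hM
      have h2 := (ih.mul_taylor hs hsr hfm hM hf).const_mul (c := fun _ => -1)
        measurable_const (B := 1) (by simp)
      convert! h1.add h2 using 3
      ring
  -- Coefficients of the geometric series of `1 / f (x + v)` in powers of `(f x - f (x + v)) / f x`.
  -- The cutoff keeps them bounded at points `x` off the support, where `f x` can be small although
  -- `φ (x + v) ≠ 0`.
  set c : ℕ → E d → ℝ := fun j x => if b / 2 ≤ f x then (f x ^ (j + 1))⁻¹ else 0 with hc
  have hcm : ∀ j, Measurable (c j) := fun j =>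
    Measurable.ite (measurableSet_le measurable_const hfm) (hfm.pow_const _).inv measurable_const
  have hcB : ∀ j x, |c j x| ≤ ((b / 2) ^ (j + 1))⁻¹ := by
    intro j x
    simp only [hc]
    split_ifs with h
    · have : 0 < f x := by linarith
      rw [abs_of_pos (by positivity)]
      gcongr
    · rw [abs_zero]; positivity
  have hsum := L2Expandable.sum (Finset.range r) fun j _ => (hpow j).const_mul (hcm j) (hcB j)
  have hφv : Measurable fun p : E d × E d => φ (p.1 + p.2) :=
    hφm.comp (measurable_fst.add measurable_snd)
  have hfv : Measurable fun p : E d × E d => f (p.1 + p.2) :=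
    hfm.comp (measurable_fst.add measurable_snd)
  have hrem : L2Small s (fun x v => φ (x + v) / f (x + v) -
      ∑ j ∈ Finset.range r, c j x * (φ (x + v) * (f x - f (x + v)) ^ j)) := by
    refine L2Small.of_le_mul_norm_pow (N := r) (q := 0) hsr
      (C := ((2 * L / b) ^ r / b) ^ 2 * (∫⁻ x, ENNReal.ofReal (φ x ^ 2)).toReal) ?_
      (fun v => ?_) hs
    · refine (hφv.div hfv).sub (Finset.measurable_fun_sum _ fun j _ => ?_)
      exact ((hcm j).comp measurable_fst).mul
        (hφv.mul (((hfm.comp measurable_fst).sub hfv).pow_const _))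
    · refine (lintegral_sq_const_mul_le (c := (2 * L / b) ^ r / b * ‖v‖ ^ r)
        (G := fun x => φ (x + v)) fun x => ?_).trans ?_
      · by_cases hz : φ (x + v) = 0
        · simp [hz]
        have hy : x + v ∈ tsupport φ := subset_tsupport _ hz
        have hfy := hfb _ hy
        have hfy0 : 0 < f (x + v) := hb.trans_le hfy
        -- The Lipschitz bound is available from points of the support, so it is used at `x + v`
        -- with displacement `-v`.
        have hlip : |f x - f (x + v)| ≤ L * ‖v‖ := by
          have := hLip _ hy (-v)
          simpa using this
        have h2Lb : (2 * L / b) ^ r / b * ‖v‖ ^ r = (2 * (L * ‖v‖) / b) ^ r / b := by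
          rw [← mul_div_right_comm, ← mul_pow]; congr 2; ring
        rw [h2Lb]
        by_cases hx : b / 2 ≤ f x
        · have hfx0 : 0 < f x := by linarith
          set q : ℝ := (f x - f (x + v)) / f x with hq
          have hq1 : 1 - q = f (x + v) / f x := by rw [hq]; field_simp; ring
          have hgeo : ∑ j ∈ Finset.range r, c j x * (φ (x + v) * (f x - f (x + v)) ^ j) =
              φ (x + v) / f (x + v) * (1 - q ^ r) := by
            have h1 : ∀ j, c j x * (φ (x + v) * (f x - f (x + v)) ^ j) =
                φ (x + v) / f x * q ^ j := by
              intro j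
              simp only [hc, hx, if_true, hq, div_pow]
              field_simp
              ring
            simp_rw [h1]
            rw [← Finset.mul_sum]
            have h2 := mul_neg_geom_sum q r
            rw [hq1] at h2
            rw [← h2]
            field_simp
          rw [hgeo, ← mul_one_sub, sub_sub_cancel, abs_mul, abs_div, abs_of_pos hfy0, abs_pow]
          have hqle : |q| ≤ 2 * (L * ‖v‖) / b := by
            rw [hq, abs_div, abs_of_pos hfx0]
            calc |f x - f (x + v)| / f x ≤ L * ‖v‖ / (b / 2) := by gcongr
              _ = _ := by field_simp
          calc |φ (x + v)| / f (x + v) * |q| ^ r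
              ≤ |φ (x + v)| / b * (2 * (L * ‖v‖) / b) ^ r := by gcongr
            _ = _ := by ring
        -- Here the series is cut to zero, but `f x < b / 2` and `b ≤ f (x + v)` force `b / 2 ≤ L *
        -- ‖v‖`: the displacement is so large that the claimed bound exceeds `|φ (x + v)| / b`.
        · have hz0 : ∑ j ∈ Finset.range r, c j x * (φ (x + v) * (f x - f (x + v)) ^ j) = 0 :=
            Finset.sum_eq_zero fun j _ => by simp [hc, hx]
          rw [hz0, sub_zero, abs_div, abs_of_pos hfy0]
          have h1 : 1 ≤ 2 * (L * ‖v‖) / b := by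
            rw [le_div_iff₀ hb]
            have := neg_abs_le (f x - f (x + v))
            push Not at hx
            linarith
          calc |φ (x + v)| / f (x + v) ≤ 1 ^ r / b * |φ (x + v)| := by
                rw [one_pow, one_div, inv_mul_eq_div]; gcongr
            _ ≤ _ := by gcongr
      · have e : ∫⁻ x, ENNReal.ofReal (φ (x + v) ^ 2) = ∫⁻ x, ENNReal.ofReal (φ x ^ 2) :=
          lintegral_add_right_eq_self (fun x => ENNReal.ofReal (φ x ^ 2)) v
        rw [e, mul_pow, pow_zero, mul_one, mul_right_comm (((2 * L / b) ^ r / b) ^ 2),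
          ENNReal.ofReal_mul (p := _ * _) (by positivity), ENNReal.ofReal_toReal hφ2.ne]
  convert! hsum.add_small hrem using 3
  ring

/-! ### Moments of the kernel and smoothing -/

/-- One term of the exponential series bounds `(1 + ‖u‖) ^ N` by a multiple of `exp (C₂ ‖u‖)`;
taking `N = p + d + 1` leaves the integrable weight `(1 + ‖u‖) ^ (-(d + 1))`. -/
theorem HasExpTails.integrable_mul {d : ℕ} {K : E d → ℝ} (hK : HasExpTails K)
    (hKm : Measurable K) (p : ℕ) : Integrable (fun u => (1 + ‖u‖) ^ p * |K u|) := by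
  obtain ⟨C₁, C₂, h1, h2, hK⟩ := hK
  set N := p + d + 1 with hN
  have hint : Integrable (fun u : E d => (1 + ‖u‖) ^ (-((d : ℝ) + 1))) :=
    integrable_one_add_norm (by simp)
  set A : ℝ := C₁ * (N.factorial * Real.exp C₂ / C₂ ^ N) with hA
  refine (hint.const_mul A).mono' ?_ (ae_of_all _ fun u => ?_)
  · exact (((measurable_norm.const_add 1).pow_const p).mul hKm.abs).aestronglyMeasurable
  · have h0 : 0 < 1 + ‖u‖ := by positivity
    rw [Real.norm_eq_abs, abs_of_nonneg (by positivity)]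
    have hexp : (1 + ‖u‖) ^ N * Real.exp (-(C₂ * ‖u‖)) ≤ N.factorial * Real.exp C₂ / C₂ ^ N := by
      have h3 := Real.pow_div_factorial_le_exp (C₂ * (1 + ‖u‖)) (by positivity) N
      rw [div_le_iff₀ (by positivity), mul_add, mul_one, Real.exp_add, ← mul_one_add,
        mul_pow] at h3
      rw [le_div_iff₀ (by positivity), Real.exp_neg]
      calc (1 + ‖u‖) ^ N * (Real.exp (C₂ * ‖u‖))⁻¹ * C₂ ^ N
          = (C₂ ^ N * (1 + ‖u‖) ^ N) * (Real.exp (C₂ * ‖u‖))⁻¹ := by ring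
        _ ≤ (Real.exp C₂ * Real.exp (C₂ * ‖u‖) * N.factorial) * (Real.exp (C₂ * ‖u‖))⁻¹ := by
            gcongr
        _ = _ := by field_simp
    have e : (1 + ‖u‖) ^ p = (1 + ‖u‖) ^ N * (1 + ‖u‖) ^ (-((d : ℝ) + 1)) := by
      rw [← Real.rpow_natCast, ← Real.rpow_natCast, ← Real.rpow_add h0, hN]
      congr 1
      push_cast
      ring
    calc (1 + ‖u‖) ^ p * |K u| ≤ (1 + ‖u‖) ^ p * (C₁ * Real.exp (-(C₂ * ‖u‖))) := by
          gcongr; exact hK u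
      _ = C₁ * ((1 + ‖u‖) ^ N * Real.exp (-(C₂ * ‖u‖))) * (1 + ‖u‖) ^ (-((d : ℝ) + 1)) := by
          rw [e]; ring
      _ ≤ _ := by rw [hA]; gcongr

theorem HasExpTails.exists_abs_le {d : ℕ} {K : E d → ℝ} (hK : HasExpTails K) :
    ∃ C, 0 < C ∧ ∀ u, |K u| ≤ C := by
  obtain ⟨C₁, C₂, h1, h2, hK⟩ := hK
  refine ⟨C₁, h1, fun u => (hK u).trans ?_⟩
  have : Real.exp (-(C₂ * ‖u‖)) ≤ 1 := Real.exp_le_one_iff.2 (by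
    have := norm_nonneg u; simp only [Left.neg_nonpos_iff]; positivity)
  nlinarith

theorem HasExpTails.integrable {d : ℕ} {K : E d → ℝ} (hK : HasExpTails K)
    (hKm : Measurable K) : Integrable K := by
  have := hK.integrable_mul hKm 0
  simp only [pow_zero, one_mul] at this
  exact (integrable_norm_iff hKm.aestronglyMeasurable).1 this

theorem HasExpTails.integrable_monomial_mul {d : ℕ} {K : E d → ℝ} (hK : HasExpTails K)
    (hKm : Measurable K) (l : Fin d → ℕ) : Integrable (fun u => monomial l u * K u) := by
  refine (hK.integrable_mul hKm (∑ i, l i)).mono'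
    ((measurable_monomial l).mul hKm).aestronglyMeasurable (ae_of_all _ fun u => ?_)
  rw [Real.norm_eq_abs, abs_mul]
  gcongr
  exact (abs_monomial_le l u).trans (by gcongr; linarith [norm_nonneg u])

/-- Integration against a kernel of order `r` evaluates polynomials of degree less than `r` at the
origin, at every scale. -/
theorem IsKernelOfOrder.integral_monomial_smul_mul {d r : ℕ} {K : E d → ℝ}
    (hK : IsKernelOfOrder r K) {l : Fin d → ℕ} (hl : ∑ i, l i < r) (h : ℝ) :
    ∫ u, monomial l (h • u) * K u = monomial l 0 := by
  simp_rw [monomial_smul, mul_assoc]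
  rw [integral_const_mul]
  rcases Nat.eq_zero_or_pos (∑ i, l i) with h0 | h0
  · have : l = 0 := by
      funext i
      exact (Finset.sum_eq_zero_iff.1 h0) i (Finset.mem_univ i)
    subst this
    simp [monomial_zero, hK.2.1]
  · have h1 := hK.2.2 l h0 hl
    have h2 : monomial l (0 : E d) = 0 := by
      have := monomial_smul l 0 (0 : E d)
      rwa [zero_smul, zero_pow h0.ne', zero_mul] at this
    simp only [monomial] at h1 h2 ⊢
    rw [h1, h2, mul_zero]

theorem norm_smul_rpow_mul_le {d : ℕ} {s : ℝ} (hs : 0 < s) (p : ℕ) {h : ℝ} (h0 : 0 < h)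
    (h1 : h ≤ 1) (u : E d) :
    ‖h • u‖ ^ s * (1 + ‖h • u‖) ^ p ≤ h ^ s * (1 + ‖u‖) ^ (⌈s⌉₊ + p) := by
  have hu : (1 : ℝ) ≤ 1 + ‖u‖ := by linarith [norm_nonneg u]
  rw [norm_smul, Real.norm_eq_abs, abs_of_pos h0, Real.mul_rpow h0.le (norm_nonneg _), pow_add,
    mul_assoc]
  gcongr
  · calc ‖u‖ ^ s ≤ (1 + ‖u‖) ^ s := by gcongr; linarith
      _ ≤ (1 + ‖u‖) ^ (⌈s⌉₊ : ℝ) := Real.rpow_le_rpow_of_exponent_le hu (Nat.le_ceil s)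
      _ = _ := Real.rpow_natCast _ _
  · exact mul_le_of_le_one_left (norm_nonneg _) h1

theorem sq_integral_mul_le {α : Type*} [MeasurableSpace α] {μ : Measure α} {K R : α → ℝ}
    (hK : Measurable K) (hR : Measurable R) :
    ENNReal.ofReal ((∫ a, K a * R a ∂μ) ^ 2) ≤ (∫⁻ a, ENNReal.ofReal |K a| ∂μ) *
      ∫⁻ a, ENNReal.ofReal |K a| * ENNReal.ofReal (R a ^ 2) ∂μ := by
  have h := lintegral_mul_sq_le (μ := μ) hK.abs.ennreal_ofReal hR.abs.ennreal_ofReal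
  have e : ∀ a, ENNReal.ofReal |R a| ^ 2 = ENNReal.ofReal (R a ^ 2) := by
    intro a; rw [← ENNReal.ofReal_pow (abs_nonneg _), sq_abs]
  simp_rw [e] at h
  refine le_trans ?_ h
  rw [← sq_abs, ENNReal.ofReal_pow (abs_nonneg _)]
  gcongr
  simpa [Real.enorm_eq_ofReal_abs, abs_mul, ENNReal.ofReal_mul] using
    enorm_integral_le_lintegral_enorm (μ := μ) (fun a => K a * R a)

/-- Smoothing an expandable function by a kernel of high order. -/
theorem L2Expandable.lintegral_sq_smooth_sub_le {d r : ℕ} {s : ℝ} (hs : 0 < s) {Q : Set (E d)}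
    {G : E d → E d → ℝ} (hG : L2Expandable Q r s G) {K : E d → ℝ} (hKr : IsKernelOfOrder r K)
    (hKe : HasExpTails K) :
    ∃ C : ℝ, 0 ≤ C ∧ ∀ h : ℝ, 0 < h → h ≤ 1 →
      ∫⁻ x, ENNReal.ofReal (((∫ u, K u * G x (h • u)) - G x 0) ^ 2) ≤
        ENNReal.ofReal (C * (h ^ s) ^ 2) := by
  have hKm := hKr.1
  obtain ⟨ι, _, l, a, hl, ham, haQ, ha2, hRm, C, p, hR⟩ := hG
  set R : E d → E d → ℝ := fun x v => G x v - ∑ i, a i x * monomial (l i) v with hRdef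
  set N := 2 * (⌈s⌉₊ + p) with hN
  have hI := hKe.integrable_mul hKm N
  set D : ℝ := ∫ u, (1 + ‖u‖) ^ N * |K u| with hD
  have hD0 : 0 ≤ D := integral_nonneg fun u => by positivity
  have hKD : ∫⁻ u, ENNReal.ofReal |K u| ≤ ENNReal.ofReal D := by
    rw [hD, ofReal_integral_eq_lintegral_ofReal hI (ae_of_all _ fun u => by positivity)]
    refine lintegral_mono fun u => ENNReal.ofReal_le_ofReal ?_
    exact le_mul_of_one_le_left (abs_nonneg _)
      (one_le_pow₀ (by linarith [norm_nonneg u]))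
  refine ⟨D * (|C| * D), by positivity, fun h h0 h1 => ?_⟩
  have hRh : Measurable fun q : E d × E d => R q.1 (h • q.2) :=
    hRm.comp (measurable_fst.prodMk (measurable_snd.const_smul h))
  have htot : ∫⁻ x, ∫⁻ u, ENNReal.ofReal |K u| * ENNReal.ofReal (R x (h • u) ^ 2) ≤
      ENNReal.ofReal (|C| * D * (h ^ s) ^ 2) := by
    have hKu : Measurable fun q : E d × E d => K q.2 := hKm.comp measurable_snd
    rw [lintegral_lintegral_swap
      (hKu.abs.ennreal_ofReal.mul (hRh.pow_const 2).ennreal_ofReal).aemeasurable]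
    calc ∫⁻ u, ∫⁻ x, ENNReal.ofReal |K u| * ENNReal.ofReal (R x (h • u) ^ 2)
        ≤ ∫⁻ u, ENNReal.ofReal (|C| * (h ^ s) ^ 2) *
            ENNReal.ofReal ((1 + ‖u‖) ^ N * |K u|) := by
          refine lintegral_mono fun u => ?_
          dsimp only
          rw [lintegral_const_mul' _ _ ENNReal.ofReal_ne_top,
            ← ENNReal.ofReal_mul (by positivity)]
          refine (mul_le_mul_right (hR (h • u)) _).trans ?_
          rw [← ENNReal.ofReal_mul (abs_nonneg _)]
          refine ENNReal.ofReal_le_ofReal ?_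
          have e1 : (‖h • u‖ ^ s * (1 + ‖h • u‖) ^ p) ^ 2 ≤
              (h ^ s * (1 + ‖u‖) ^ (⌈s⌉₊ + p)) ^ 2 :=
            pow_le_pow_left₀ (by positivity) (norm_smul_rpow_mul_le hs p h0 h1 u) 2
          calc |K u| * (C * (‖h • u‖ ^ s * (1 + ‖h • u‖) ^ p) ^ 2)
              ≤ |K u| * (|C| * (h ^ s * (1 + ‖u‖) ^ (⌈s⌉₊ + p)) ^ 2) := by
                gcongr
                exact le_abs_self C
            _ = _ := by rw [hN, mul_comm 2, pow_mul]; ring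
      _ = _ := by
          rw [lintegral_const_mul' _ _ ENNReal.ofReal_ne_top,
            ← ofReal_integral_eq_lintegral_ofReal hI (ae_of_all _ fun u => by positivity),
            ← ENNReal.ofReal_mul (by positivity)]
          congr 1
          rw [← hD]
          ring
  -- Because `s > 0`, the mean square bound vanishes at displacement `0`; so almost everywhere `G x
  -- 0` is the value of the polynomial part at `0`.
  have hzero : ∀ᵐ x, R x 0 = 0 := by
    have h2 : ∫⁻ x, ENNReal.ofReal (R x 0 ^ 2) = 0 := by
      have := hR 0
      rw [norm_zero, Real.zero_rpow hs.ne'] at this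
      simpa using this
    have h3 := (lintegral_eq_zero_iff
      ((hRm.of_uncurry_right (y := 0)).pow_const 2).ennreal_ofReal).1 h2
    filter_upwards [h3] with x hx
    simpa using hx
  -- Almost everywhere the remainder is square integrable against `|K|`, which allows the integral
  -- to be split.
  have hfin : ∀ᵐ x, ∫⁻ u, ENNReal.ofReal |K u| * ENNReal.ofReal (R x (h • u) ^ 2) < ⊤ := by
    refine ae_lt_top' ?_ (lt_of_le_of_lt htot ENNReal.ofReal_lt_top).ne
    exact (Measurable.lintegral_prod_right'
      (f := fun q : E d × E d => ENNReal.ofReal |K q.2| * ENNReal.ofReal (R q.1 (h • q.2) ^ 2))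
      ((hKm.comp measurable_snd).abs.ennreal_ofReal.mul
        (hRh.pow_const 2).ennreal_ofReal)).aemeasurable
  calc ∫⁻ x, ENNReal.ofReal (((∫ u, K u * G x (h • u)) - G x 0) ^ 2)
      ≤ ∫⁻ x, ENNReal.ofReal D *
          ∫⁻ u, ENNReal.ofReal |K u| * ENNReal.ofReal (R x (h • u) ^ 2) := by
        refine lintegral_mono_ae ?_
        filter_upwards [hzero, hfin] with x hx0 hxf
        have hRx : Measurable fun u => R x (h • u) :=
          hRh.of_uncurry_left (f := fun x u => R x (h • u))
        have hint2 : Integrable fun u => |K u| * R x (h • u) ^ 2 := by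
          refine ⟨(hKm.abs.mul (hRx.pow_const 2)).aestronglyMeasurable, ?_⟩
          rw [hasFiniteIntegral_iff_ofReal (ae_of_all _ fun u => by positivity)]
          simp_rw [ENNReal.ofReal_mul (abs_nonneg _)]
          exact hxf
        have hint1 : Integrable fun u => K u * R x (h • u) := by
          refine ((hKe.integrable hKm).abs.add hint2).mono'
            (hKm.mul hRx).aestronglyMeasurable (ae_of_all _ fun u => ?_)
          rw [Real.norm_eq_abs, abs_mul]
          have h4 : |R x (h • u)| ≤ 1 + R x (h • u) ^ 2 := by
            rw [← sq_abs]; nlinarith [sq_nonneg (|R x (h • u)| - 1)]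
          calc |K u| * |R x (h • u)| ≤ |K u| * (1 + R x (h • u) ^ 2) := by gcongr
            _ = _ := by simp only [Pi.add_apply]; ring
        have hmon : ∀ i, Integrable fun u => a i x * (monomial (l i) (h • u) * K u) := by
          intro i
          simp_rw [monomial_smul, mul_assoc]
          exact ((hKe.integrable_monomial_mul hKm (l i)).const_mul _).const_mul _
        have hsplit : ∀ u, K u * G x (h • u) = K u * R x (h • u) +
            ∑ i, a i x * (monomial (l i) (h • u) * K u) := by
          intro u
          rw [hRdef]
          simp only [mul_sub, Finset.mul_sum]
          rw [sub_add, ← Finset.sum_sub_distrib]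
          rw [Finset.sum_eq_zero fun i _ => by ring]
          ring
        have hGx : (∫ u, K u * G x (h • u)) - G x 0 = ∫ u, K u * R x (h • u) := by
          simp_rw [hsplit]
          rw [integral_add hint1 (integrable_finsetSum _ fun i _ => hmon i),
            integral_finsetSum _ fun i _ => hmon i]
          simp_rw [integral_const_mul, hKr.integral_monomial_smul_mul (hl _)]
          simp only [hRdef] at hx0
          linarith
        rw [hGx]
        refine (sq_integral_mul_le hKm hRx).trans ?_
        gcongr
    _ ≤ ENNReal.ofReal D * ENNReal.ofReal (|C| * D * (h ^ s) ^ 2) := by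
        rw [lintegral_const_mul' _ _ ENNReal.ofReal_ne_top]
        gcongr
    _ = _ := by
        rw [← ENNReal.ofReal_mul hD0]
        congr 1
        ring

/-- Smoothing a function with Taylor expansions by a kernel of high order. -/
theorem TaylorOn.exists_abs_smooth_sub_le {d r : ℕ} {Q : Set (E d)} {f : E d → ℝ}
    (hf : TaylorOn Q r f) (hr : 0 < r) (hfm : Measurable f)
    {K : E d → ℝ} (hKr : IsKernelOfOrder r K) (hKe : HasExpTails K) :
    ∃ C : ℝ, 0 ≤ C ∧ ∀ h : ℝ, 0 < h → ∀ x ∈ Q, |(∫ u, K u * f (x + h • u)) - f x| ≤ C * h ^ r := by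
  have hKm := hKr.1
  obtain ⟨κ, _, m, b, C, hC, hm, hbm, hbC, hT⟩ := hf
  have hI := hKe.integrable_mul hKm r
  have hD0 : 0 ≤ ∫ u, (1 + ‖u‖) ^ r * |K u| := integral_nonneg fun u => by positivity
  refine ⟨C * ∫ u, (1 + ‖u‖) ^ r * |K u|, by positivity, fun h h0 x hx => ?_⟩
  set R : E d → ℝ := fun v => f (x + v) - ∑ j, b j x * monomial (m j) v with hR
  have hRle : ∀ u, |K u * R (h • u)| ≤ C * h ^ r * ((1 + ‖u‖) ^ r * |K u|) := by
    intro u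
    rw [abs_mul]
    calc |K u| * |R (h • u)| ≤ |K u| * (C * ‖h • u‖ ^ r) := by gcongr; exact hT x hx _
      _ = C * h ^ r * (‖u‖ ^ r * |K u|) := by
          rw [norm_smul, Real.norm_eq_abs, abs_of_pos h0, mul_pow]; ring
      _ ≤ _ := by gcongr; linarith
  have hRm : Measurable fun u => R (h • u) := by
    refine (hfm.comp (by fun_prop)).sub (Finset.measurable_fun_sum _ fun j _ => ?_)
    exact ((measurable_monomial (m j)).comp (by fun_prop)).const_mul _
  have hint1 : Integrable fun u => K u * R (h • u) :=
    (hI.const_mul (C * h ^ r)).mono' (hKm.mul hRm).aestronglyMeasurable (ae_of_all _ hRle)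
  have hmon : ∀ j, Integrable fun u => b j x * (monomial (m j) (h • u) * K u) := by
    intro j
    simp_rw [monomial_smul, mul_assoc]
    exact ((hKe.integrable_monomial_mul hKm (m j)).const_mul _).const_mul _
  have hsplit : ∀ u, K u * f (x + h • u) = K u * R (h • u) +
      ∑ j, b j x * (monomial (m j) (h • u) * K u) := by
    intro u
    rw [hR]
    simp only [mul_sub, Finset.mul_sum]
    rw [sub_add, ← Finset.sum_sub_distrib]
    rw [Finset.sum_eq_zero fun i _ => by ring]
    ring
  have h00 := hT x hx 0
  rw [norm_zero, zero_pow hr.ne', mul_zero, add_zero] at h00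
  have h00 := abs_nonpos_iff.1 h00
  have hfx : (∫ u, K u * f (x + h • u)) - f x = ∫ u, K u * R (h • u) := by
    simp_rw [hsplit]
    rw [integral_add hint1 (integrable_finsetSum _ fun j _ => hmon j),
      integral_finsetSum _ fun j _ => hmon j]
    simp_rw [integral_const_mul, hKr.integral_monomial_smul_mul (hm _)]
    linarith
  rw [hfx]
  calc |∫ u, K u * R (h • u)| ≤ ∫ u, |K u * R (h • u)| := abs_integral_le_integral_abs
    _ ≤ ∫ u, C * h ^ r * ((1 + ‖u‖) ^ r * |K u|) :=
        integral_mono hint1.abs (hI.const_mul _) hRle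
    _ = _ := by rw [integral_const_mul]; ring

/-! ### Sums over a resampling invariant sequence -/

/-- A kernel `ξ` centered in its second variable, of size `C * D` and with `L¹` norms of order `C`
in each variable. -/
structure CenteredKernel {S : Type*} [MeasurableSpace S] (μ : Measure S) (ξ : S → S → ℝ)
    (C D : ℝ) : Prop where
  nonneg_C : 0 ≤ C
  nonneg_D : 0 ≤ D
  meas : Measurable (Function.uncurry ξ)
  abs_le : ∀ x y, |ξ x y| ≤ C * D
  integral_eq_zero : ∀ x, ∫ y, ξ x y ∂μ = 0
  lintegral_sq : ∀ x, ∫⁻ y, ENNReal.ofReal (ξ x y ^ 2) ∂μ ≤ ENNReal.ofReal (C * D)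
  lintegral_abs : ∀ x, ∫⁻ y, ENNReal.ofReal |ξ x y| ∂μ ≤ ENNReal.ofReal C
  lintegral_abs_left : ∀ y, ∫⁻ x, ENNReal.ofReal |ξ x y| ∂μ ≤ ENNReal.ofReal C

/-- The square is put in the exponent so that one exponential moment controls both the sum and the
sum of squares. In `(1 + z + z²)(1 + 2z²)` the quadratic coefficient is `3`, and `2z³ + 2z⁴ ≤ 4z²`.
-/
theorem exp_add_sq_le {z : ℝ} (hz : |z| ≤ 1) : Real.exp (z + z ^ 2) ≤ 1 + z + 7 * z ^ 2 := by
  have h1 := (abs_le.1 (Real.abs_exp_sub_one_sub_id_le hz)).2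
  have hz2 : z ^ 2 ≤ 1 := by rw [← sq_abs]; exact pow_le_one₀ (abs_nonneg _) hz
  have h2 := (abs_le.1 (Real.abs_exp_sub_one_sub_id_le (x := z ^ 2)
    (by rwa [abs_of_nonneg (sq_nonneg _)]))).2
  have hz0 := sq_nonneg z
  have hzle := abs_le.1 hz
  rw [Real.exp_add]
  calc Real.exp z * Real.exp (z ^ 2) ≤ (1 + z + z ^ 2) * (1 + 2 * z ^ 2) := by
        have := Real.exp_pos z
        have h3 : Real.exp (z ^ 2) ≤ 1 + 2 * z ^ 2 := by nlinarith
        exact mul_le_mul (by linarith) h3 (Real.exp_pos _).le (by nlinarith)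
    _ ≤ _ := by nlinarith [mul_nonneg hz0 (sub_nonneg.2 hzle.2), mul_nonneg hz0 (sub_nonneg.2 hz2)]

theorem memLp_two_comp_eval {S : Type*} [MeasurableSpace S] {μ : Measure S} {ν : Measure (ℕ → S)}
    [IsProbabilityMeasure μ] [IsProbabilityMeasure ν] (hν : ResampleInvariant ν μ) {g : S → ℝ}
    (hg : Measurable g) (hg2 : ∫⁻ y, ENNReal.ofReal (g y ^ 2) ∂μ < ⊤) (i : ℕ) :
    MemLp (fun x : ℕ → S => g (x i)) 2 ν := by
  refine memLp_two_of_lintegral_sq (hg.comp (measurable_pi_apply i)) ?_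
  rwa [hν.lintegral_eval i (w := fun y => ENNReal.ofReal (g y ^ 2)) (hg.pow_const 2).ennreal_ofReal]

theorem integral_mul_le_of_sq {Ω : Type*} [MeasurableSpace Ω] {P : Measure Ω} {F G : Ω → ℝ}
    (hF : Measurable F) (hG : Measurable G) {B : ℝ} (hB : 0 ≤ B)
    (hF2 : ∫⁻ ω, ENNReal.ofReal (F ω ^ 2) ∂P ≤ ENNReal.ofReal B)
    (hG2 : ∫⁻ ω, ENNReal.ofReal (G ω ^ 2) ∂P ≤ ENNReal.ofReal B) :
    ∫ ω, F ω * G ω ∂P ≤ B := by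
  refine integral_le_of_lintegral hB (hF.mul hG) (G := fun ω => F ω ^ 2 / 2 + G ω ^ 2 / 2)
    (fun ω => ?_) ?_
  · rw [abs_mul, ← sq_abs (F ω), ← sq_abs (G ω)]
    nlinarith [sq_nonneg (|F ω| - |G ω|)]
  · have h1 : ∀ a : ℝ, ENNReal.ofReal (a ^ 2 / 2) = ENNReal.ofReal (a ^ 2) * ENNReal.ofReal 2⁻¹ :=
      fun a => by rw [div_eq_mul_inv, ENNReal.ofReal_mul (sq_nonneg a)]
    simp_rw [ENNReal.ofReal_add (div_nonneg (sq_nonneg _) zero_le_two)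
      (div_nonneg (sq_nonneg _) zero_le_two), h1]
    rw [lintegral_add_left ((hF.pow_const 2).ennreal_ofReal.mul_const _),
      lintegral_mul_const' _ _ ENNReal.ofReal_ne_top,
      lintegral_mul_const' _ _ ENNReal.ofReal_ne_top]
    calc _ ≤ ENNReal.ofReal B * ENNReal.ofReal 2⁻¹ + ENNReal.ofReal B * ENNReal.ofReal 2⁻¹ := by
          gcongr
      _ = ENNReal.ofReal B := by
          rw [← ENNReal.ofReal_mul hB, ← ENNReal.ofReal_add (by positivity) (by positivity)]
          congr 1; ring

namespace ResampleInvariant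

variable {S : Type*} [MeasurableSpace S] {ν : Measure (ℕ → S)} {μ : Measure S}
  [IsProbabilityMeasure μ] [IsProbabilityMeasure ν]

/-- The second moment of a sum of independent centered terms. -/
theorem lintegral_sq_sum_centered_le (hν : ResampleInvariant ν μ) {g : S → ℝ} (hg : Measurable g)
    {B : ℝ} (hB : 0 ≤ B) (hg2 : ∫⁻ y, ENNReal.ofReal (g y ^ 2) ∂μ ≤ ENNReal.ofReal B)
    (hg0 : ∫ y, g y ∂μ = 0) (n : ℕ) :
    ∫⁻ x, ENNReal.ofReal ((∑ i ∈ Finset.range n, g (x i)) ^ 2) ∂ν ≤ ENNReal.ofReal (n * B) := by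
  have hL2 := fun i => memLp_two_comp_eval hν hg (hg2.trans_lt ENNReal.ofReal_lt_top) i
  have hgi : ∀ i, Measurable fun x : ℕ → S => g (x i) := fun i => hg.comp (measurable_pi_apply i)
  have hsq : ∀ i, ∫⁻ x, ENNReal.ofReal (g (x i) ^ 2) ∂ν ≤ ENNReal.ofReal B := fun i => by
    rwa [hν.lintegral_eval i (w := fun y => ENNReal.ofReal (g y ^ 2))
      (hg.pow_const 2).ennreal_ofReal]
  refine (lintegral_sq_sum_le (Finset.range n) (H := fun i (x : ℕ → S) => g (x i))
    (fun i _ => hL2 i)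
    (β := fun i j => if i = j then B else 0) fun i _ j _ => ?_).trans ?_
  · by_cases hij : i = j
    · rw [if_pos hij]
      exact integral_mul_le_of_sq (hgi i) (hgi j) hB (hsq i) (hsq j)
    · rw [if_neg hij]
      refine le_of_eq (hν.integral_eq_zero j ((hL2 i).integrable_mul (hL2 j)) fun x => ?_)
      simp only [ne_eq, hij, not_false_eq_true, Function.update_of_ne, Function.update_self]
      rw [integral_const_mul, hg0, mul_zero]
  · refine ENNReal.ofReal_le_ofReal (le_of_eq ?_)
    simp only [Finset.sum_ite_eq, Finset.mem_range]
    rw [Finset.sum_congr rfl fun i hi => if_pos (Finset.mem_range.1 hi)]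
    simp

end ResampleInvariant

namespace CenteredKernel

variable {S : Type*} [MeasurableSpace S] {ν : Measure (ℕ → S)} {μ : Measure S}
  {ξ : S → S → ℝ} {C D : ℝ}

theorem measurable_eval (hξ : CenteredKernel μ ξ C D) (i j : ℕ) :
    Measurable fun x : ℕ → S => ξ (x i) (x j) := by
  have : Measurable fun x : ℕ → S => (x i, x j) :=
    (measurable_pi_apply i).prodMk (measurable_pi_apply j)
  exact hξ.meas.comp this

variable [IsProbabilityMeasure μ]

theorem integrable_right (hξ : CenteredKernel μ ξ C D) (x : S) : Integrable (ξ x) μ :=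
  Integrable.of_bound hξ.meas.of_uncurry_left.aestronglyMeasurable (C * D)
    (ae_of_all _ fun y => hξ.abs_le x y)

/-- Centering removes the linear term and the second moment is at most `C * D`. The bound is kept in
exponential form because it will be raised to the number of coordinates. -/
theorem lintegral_exp_le (hξ : CenteredKernel μ ξ C D) {lam : ℝ} (hlam : |lam| * (C * D) ≤ 1)
    (x : S) : ∫⁻ y, ENNReal.ofReal (Real.exp (lam * ξ x y + lam ^ 2 * ξ x y ^ 2)) ∂μ ≤
      ENNReal.ofReal (Real.exp (7 * lam ^ 2 * (C * D))) := by
  have hz : ∀ y, |lam * ξ x y| ≤ 1 := fun y => by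
    rw [abs_mul]
    exact (mul_le_mul_of_nonneg_left (hξ.abs_le x y) (abs_nonneg _)).trans hlam
  have hm : Measurable (ξ x) := hξ.meas.of_uncurry_left
  have hi1 : Integrable (fun y => lam * ξ x y) μ := (hξ.integrable_right x).const_mul lam
  have hi2 : Integrable (fun y => ξ x y ^ 2) μ := by
    refine ⟨(hm.pow_const 2).aestronglyMeasurable, ?_⟩
    rw [hasFiniteIntegral_iff_ofReal (ae_of_all _ fun y => sq_nonneg _)]
    exact (hξ.lintegral_sq x).trans_lt ENNReal.ofReal_lt_top
  have hint : Integrable (fun y => 1 + lam * ξ x y + 7 * lam ^ 2 * ξ x y ^ 2) μ :=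
    ((integrable_const 1).add hi1).add (hi2.const_mul _)
  have hsq : ∫ y, ξ x y ^ 2 ∂μ ≤ C * D := by
    rw [integral_eq_lintegral_of_nonneg_ae (ae_of_all _ fun y => sq_nonneg _)
      (hm.pow_const 2).aestronglyMeasurable]
    exact ENNReal.toReal_le_of_le_ofReal (mul_nonneg hξ.nonneg_C hξ.nonneg_D) (hξ.lintegral_sq x)
  have hle : ∀ y, Real.exp (lam * ξ x y + lam ^ 2 * ξ x y ^ 2) ≤
      1 + lam * ξ x y + 7 * lam ^ 2 * ξ x y ^ 2 := fun y => by
    have := exp_add_sq_le (hz y)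
    rw [mul_pow] at this
    linarith
  calc _ ≤ ∫⁻ y, ENNReal.ofReal (1 + lam * ξ x y + 7 * lam ^ 2 * ξ x y ^ 2) ∂μ :=
        lintegral_mono fun y => ENNReal.ofReal_le_ofReal (hle y)
    _ = ENNReal.ofReal (∫ y, 1 + lam * ξ x y + 7 * lam ^ 2 * ξ x y ^ 2 ∂μ) :=
        (ofReal_integral_eq_lintegral_ofReal hint
          (ae_of_all _ fun y => (Real.exp_pos _).le.trans (hle y))).symm
    _ ≤ _ := by
        refine ENNReal.ofReal_le_ofReal ?_
        have hi3 : Integrable (fun y => 1 + lam * ξ x y) μ := (integrable_const 1).add hi1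
        rw [integral_add hi3 (hi2.const_mul _),
          integral_add (integrable_const 1) hi1, integral_const_mul, integral_const_mul,
          hξ.integral_eq_zero]
        simp only [integral_const, probReal_univ, smul_eq_mul, mul_one, mul_zero, add_zero]
        have h1 := Real.add_one_le_exp (7 * lam ^ 2 * (C * D))
        have h2 : 7 * lam ^ 2 * ∫ y, ξ x y ^ 2 ∂μ ≤ 7 * lam ^ 2 * (C * D) := by gcongr
        linarith

/-- The exponential moment of the normalized sum and sum of squares, conditionally on one
coordinate. -/
theorem lintegral_mul_exp_le [IsProbabilityMeasure ν] (hν : ResampleInvariant ν μ)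
    (hξ : CenteredKernel μ ξ C D) {n : ℕ}
    {lam : ℝ} (hlam0 : 0 ≤ lam) (hlam : lam * (C * D) ≤ 1) {B : ℝ}
    (hn : n * (7 * lam ^ 2 * (C * D)) ≤ B) {w : S → ENNReal} (hw : Measurable w) (i : ℕ) :
    ∫⁻ x, w (x i) * ENNReal.ofReal (Real.exp
      (lam * |∑ j ∈ (Finset.range n).erase i, ξ (x i) (x j)| +
        lam ^ 2 * ∑ j ∈ (Finset.range n).erase i, ξ (x i) (x j) ^ 2)) ∂ν ≤
      ENNReal.ofReal (2 * Real.exp B) * ∫⁻ y, w y ∂μ := by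
  set A := (Finset.range n).erase i with hA
  have hCD := mul_nonneg hξ.nonneg_C hξ.nonneg_D
  have hone : ∀ t : ℝ, |t| = lam → ∫⁻ x, w (x i) * ∏ j ∈ A, ENNReal.ofReal (Real.exp
      (t * ξ (x i) (x j) + t ^ 2 * ξ (x i) (x j) ^ 2)) ∂ν ≤
      ENNReal.ofReal (Real.exp B) * ∫⁻ y, w y ∂μ := by
    intro t ht
    have hm : Measurable (Function.uncurry fun x y => ENNReal.ofReal (Real.exp
        (t * ξ x y + t ^ 2 * ξ x y ^ 2))) :=
      ((hξ.meas.const_mul t).add ((hξ.meas.pow_const 2).const_mul _)).exp.ennreal_ofReal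
    refine (hν.lintegral_prod_le hw hm (fun x _ => hξ.lintegral_exp_le (by rwa [ht]) x) i A
      (by simp [hA])).trans ?_
    gcongr
    rw [← ENNReal.ofReal_pow (Real.exp_pos _).le, ← Real.exp_nat_mul]
    refine ENNReal.ofReal_le_ofReal (Real.exp_le_exp.2 (le_trans ?_ hn))
    rw [← sq_abs t, ht]
    have : A.card ≤ n := (Finset.card_le_card (Finset.erase_subset _ _)).trans (by simp)
    gcongr
  have hprod : ∀ (t : ℝ) (x : ℕ → S), ∏ j ∈ A, ENNReal.ofReal (Real.exp
      (t * ξ (x i) (x j) + t ^ 2 * ξ (x i) (x j) ^ 2)) = ENNReal.ofReal (Real.exp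
      (t * ∑ j ∈ A, ξ (x i) (x j) + t ^ 2 * ∑ j ∈ A, ξ (x i) (x j) ^ 2)) := by
    intro t x
    rw [← ENNReal.ofReal_prod_of_nonneg fun _ _ => (Real.exp_pos _).le, ← Real.exp_sum,
      Finset.sum_add_distrib, Finset.mul_sum, Finset.mul_sum]
  have h1 := hone lam (abs_of_nonneg hlam0)
  have h2 := hone (-lam) (by rw [abs_neg, abs_of_nonneg hlam0])
  simp_rw [hprod] at h1 h2
  have hm1 : Measurable fun x : ℕ → S => w (x i) * ENNReal.ofReal (Real.exp
      (lam * ∑ j ∈ A, ξ (x i) (x j) + lam ^ 2 * ∑ j ∈ A, ξ (x i) (x j) ^ 2)) := by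
    refine (hw.comp (measurable_pi_apply i)).mul (Measurable.ennreal_ofReal (Measurable.exp ?_))
    exact ((Finset.measurable_fun_sum _ fun j _ => hξ.measurable_eval i j).const_mul _).add
      ((Finset.measurable_fun_sum _ fun j _ => (hξ.measurable_eval i j).pow_const 2).const_mul _)
  -- The absolute value is removed by adding the bounds for both signs of `lam`, which costs the
  -- factor `2`.
  calc _ ≤ ∫⁻ x, (w (x i) * ENNReal.ofReal (Real.exp
        (lam * ∑ j ∈ A, ξ (x i) (x j) + lam ^ 2 * ∑ j ∈ A, ξ (x i) (x j) ^ 2)) +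
        w (x i) * ENNReal.ofReal (Real.exp
        (-lam * ∑ j ∈ A, ξ (x i) (x j) + (-lam) ^ 2 * ∑ j ∈ A, ξ (x i) (x j) ^ 2))) ∂ν := by
        refine lintegral_mono fun x => ?_
        rw [← mul_add]
        gcongr
        rcases abs_cases (∑ j ∈ A, ξ (x i) (x j)) with h | h <;> rw [h.1]
        · exact le_self_add
        · rw [neg_sq, mul_neg, ← neg_mul]
          exact le_add_self
    _ ≤ ENNReal.ofReal (Real.exp B) * ∫⁻ y, w y ∂μ +
        ENNReal.ofReal (Real.exp B) * ∫⁻ y, w y ∂μ := by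
        rw [lintegral_add_left hm1]
        exact add_le_add h1 h2
    _ = _ := by
        rw [← add_mul, ← ENNReal.ofReal_add (Real.exp_pos _).le (Real.exp_pos _).le, two_mul]

/-- The second moment of the degenerate part of a double sum. -/
theorem lintegral_sq_double_sum_le [IsProbabilityMeasure ν] (hν : ResampleInvariant ν μ)
    (hξ : CenteredKernel μ ξ C D)
    {w : S → ℝ} (hw : Measurable w) {W : ℝ} (hW : 0 ≤ W)
    (hw2 : ∫⁻ y, ENNReal.ofReal (w y ^ 2) ∂μ ≤ ENNReal.ofReal W) (n : ℕ) :
    ∫⁻ x, ENNReal.ofReal ((∑ i ∈ Finset.range n, ∑ j ∈ (Finset.range n).erase i,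
      (w (x i) * ξ (x i) (x j) - ∫ z, w z * ξ z (x j) ∂μ)) ^ 2) ∂ν ≤
      ENNReal.ofReal (8 * n ^ 2 * (W * (C * D))) := by
  have hCD := mul_nonneg hξ.nonneg_C hξ.nonneg_D
  set g : S → ℝ := fun y => ∫ z, w z * ξ z y ∂μ with hg
  have hwξ : Measurable (Function.uncurry fun z y => w z * ξ z y) :=
    (hw.comp measurable_fst).mul hξ.meas
  have hgm : Measurable g := by
    have : StronglyMeasurable g :=
      StronglyMeasurable.integral_prod_left hwξ.stronglyMeasurable
    exact this.measurable
  have hg2 : ∫⁻ y, ENNReal.ofReal (g y ^ 2) ∂μ ≤ ENNReal.ofReal (W * (C * D)) := by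
    calc ∫⁻ y, ENNReal.ofReal (g y ^ 2) ∂μ
        ≤ ∫⁻ y, ∫⁻ z, ENNReal.ofReal ((w z * ξ z y) ^ 2) ∂μ ∂μ :=
          lintegral_mono fun y => sq_integral_le_lintegral
            (F := fun z => w z * ξ z y) hwξ.of_uncurry_right
      _ = ∫⁻ z, ∫⁻ y, ENNReal.ofReal ((w z * ξ z y) ^ 2) ∂μ ∂μ :=
          lintegral_lintegral_swap
            ((hwξ.comp measurable_swap).pow_const 2).ennreal_ofReal.aemeasurable
      _ ≤ ∫⁻ z, ENNReal.ofReal (w z ^ 2) * ENNReal.ofReal (C * D) ∂μ := by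
          refine lintegral_mono fun z => ?_
          simp_rw [mul_pow, ENNReal.ofReal_mul (sq_nonneg _)]
          rw [lintegral_const_mul' _ _ ENNReal.ofReal_ne_top]
          gcongr
          exact hξ.lintegral_sq z
      _ ≤ _ := by
          rw [lintegral_mul_const' _ _ ENNReal.ofReal_ne_top, ENNReal.ofReal_mul hW]
          gcongr
  have hwi : Integrable w μ := (memLp_two_of_lintegral_sq hw
    (hw2.trans_lt ENNReal.ofReal_lt_top)).integrable (by norm_num)
  have hwξi : Integrable (Function.uncurry fun z y => w z * ξ z y) (μ.prod μ) := by
    have h1 : Integrable (fun p : S × S => w p.1 * (C * D)) (μ.prod μ) :=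
      (hwi.comp_fst μ).mul_const _
    refine h1.mono hwξ.aestronglyMeasurable (ae_of_all _ fun p => ?_)
    simp only [Function.uncurry, norm_mul, Real.norm_eq_abs]
    gcongr
    rw [← abs_mul, abs_of_nonneg hCD]
    exact hξ.abs_le _ _
  have hwy : ∀ y, Integrable (fun z => w z * ξ z y) μ := fun y => by
    refine (hwi.mul_const (C * D)).mono (Measurable.aestronglyMeasurable
      (hwξ.of_uncurry_right (y := y))) (ae_of_all _ fun z => ?_)
    simp only [norm_mul, Real.norm_eq_abs]
    gcongr
    rw [← abs_mul, abs_of_nonneg hCD]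
    exact hξ.abs_le _ _
  have hgi : Integrable g μ := (memLp_two_of_lintegral_sq hgm
    (hg2.trans_lt ENNReal.ofReal_lt_top)).integrable (by norm_num)
  have hg0 : ∫ y, g y ∂μ = 0 := by
    have h1 : ∫ y, ∫ z, w z * ξ z y ∂μ ∂μ = ∫ z, ∫ y, w z * ξ z y ∂μ ∂μ :=
      (integral_integral_swap hwξi).symm
    simp only [hg]
    rw [h1]
    simp_rw [integral_const_mul, hξ.integral_eq_zero, mul_zero, integral_zero]
  -- Subtracting the projection `g` makes each term centered in either of its coordinates with the
  -- other one frozen.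
  set H : ℕ × ℕ → (ℕ → S) → ℝ := fun a x => w (x a.1) * ξ (x a.1) (x a.2) - g (x a.2) with hH
  have hHm : ∀ a, Measurable (H a) := fun a =>
    ((hw.comp (measurable_pi_apply _)).mul (hξ.measurable_eval _ _)).sub
      (hgm.comp (measurable_pi_apply _))
  set A : Finset (ℕ × ℕ) := (Finset.range n ×ˢ Finset.range n).filter fun a => a.2 ≠ a.1 with hA
  have hne : ∀ a ∈ A, a.2 ≠ a.1 := fun a ha => (Finset.mem_filter.1 ha).2
  have hH2 : ∀ a ∈ A, ∫⁻ x, ENNReal.ofReal (H a x ^ 2) ∂ν ≤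
      ENNReal.ofReal (4 * (W * (C * D))) := by
    intro a ha
    have h1 := lintegral_sq_add_le (μ := ν) (F := fun x => w (x a.1) * ξ (x a.1) (x a.2))
      (G := fun x => - g (x a.2))
      ((hw.comp (measurable_pi_apply _)).mul (hξ.measurable_eval _ _))
    simp_rw [neg_sq, ← sub_eq_add_neg] at h1
    refine h1.trans ?_
    have h2 : ∫⁻ x, ENNReal.ofReal (g (x a.2) ^ 2) ∂ν ≤ ENNReal.ofReal (W * (C * D)) := by
      rwa [hν.lintegral_eval a.2 (w := fun y => ENNReal.ofReal (g y ^ 2))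
        (hgm.pow_const 2).ennreal_ofReal]
    have h3 : ∫⁻ x, ENNReal.ofReal ((w (x a.1) * ξ (x a.1) (x a.2)) ^ 2) ∂ν ≤
        ENNReal.ofReal (W * (C * D)) := by
      have h4 := hν.lintegral_prod_le (w := fun y => ENNReal.ofReal (w y ^ 2))
        (hw.pow_const 2).ennreal_ofReal (g := fun x y => ENNReal.ofReal (ξ x y ^ 2))
        (hξ.meas.pow_const 2).ennreal_ofReal (fun x _ => hξ.lintegral_sq x) a.1 {a.2}
        (by simpa using (hne a ha).symm)
      simp only [Finset.prod_singleton, Finset.card_singleton, pow_one] at h4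
      simp_rw [mul_pow, ENNReal.ofReal_mul (sq_nonneg _)]
      refine h4.trans ?_
      rw [ENNReal.ofReal_mul hW, mul_comm]
      gcongr
    calc _ ≤ 2 * ENNReal.ofReal (W * (C * D)) + 2 * ENNReal.ofReal (W * (C * D)) := by gcongr
      _ = _ := by
          rw [two_mul_ofReal_add (by positivity) (by positivity)]; congr 1; ring
  have hHL : ∀ a ∈ A, MemLp (H a) 2 ν := fun a ha =>
    memLp_two_of_lintegral_sq (hHm a) ((hH2 a ha).trans_lt ENNReal.ofReal_lt_top)
  have hzero : ∀ a ∈ A, ∀ b ∈ A, ∀ j, (j = a.1 ∨ j = a.2) → j ≠ b.1 → j ≠ b.2 →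
      ∫ x, H a x * H b x ∂ν = 0 := by
    intro a ha b hb j hj h1 h2
    have hab := hne a ha
    refine hν.integral_eq_zero j ((hHL a ha).integrable_mul (hHL b hb)) fun x => ?_
    have e : ∀ y, H b (Function.update x j y) = H b x := fun y => by
      simp [hH, Function.update_of_ne h1.symm, Function.update_of_ne h2.symm]
    simp_rw [e]
    rw [integral_mul_const]
    have e2 : ∫ y, H a (Function.update x j y) ∂μ = 0 := by
      rcases hj with rfl | rfl
      · simp only [hH, Function.update_self, Function.update_of_ne hab]
        rw [integral_sub (hwy _) (integrable_const _)]
        simp [hg]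
      · simp only [hH, Function.update_self, Function.update_of_ne hab.symm]
        rw [integral_sub ((hξ.integrable_right _).const_mul _) hgi, hg0, integral_const_mul,
          hξ.integral_eq_zero]
        simp
    rw [e2, zero_mul]
  have hsum : ∀ x : ℕ → S, ∑ i ∈ Finset.range n, ∑ j ∈ (Finset.range n).erase i,
      (w (x i) * ξ (x i) (x j) - ∫ z, w z * ξ z (x j) ∂μ) = ∑ a ∈ A, H a x := by
    intro x
    rw [hA, Finset.sum_filter, Finset.sum_product]
    refine Finset.sum_congr rfl fun i _ => ?_
    rw [← Finset.sum_filter, Finset.filter_ne']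
  simp_rw [hsum]
  -- Two pairs which are not equal up to order differ by an index occurring in only one of them, so
  -- their product has mean zero. This leaves at most two partners for each pair.
  refine (lintegral_sq_sum_le A hHL (β := fun a b => if b = a ∨ b = a.swap then
    4 * (W * (C * D)) else 0) fun a ha b hb => ?_).trans (ENNReal.ofReal_le_ofReal ?_)
  · split_ifs with h
    · exact integral_mul_le_of_sq (hHm a) (hHm b) (by positivity) (hH2 a ha) (hH2 b hb)
    · have ha' := hne a ha
      have hb' := hne b hb
      obtain ⟨i, j⟩ := a
      obtain ⟨i', j'⟩ := b
      simp only [Prod.mk.injEq, Prod.swap_prod_mk, not_or] at h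
      change j ≠ i at ha'
      change j' ≠ i' at hb'
      by_cases h1 : i ≠ i' ∧ i ≠ j'
      · exact (hzero _ ha _ hb i (Or.inl rfl) h1.1 h1.2).le
      · have h2 : j ≠ i' ∧ j ≠ j' := by omega
        exact (hzero _ ha _ hb j (Or.inr rfl) h2.1 h2.2).le
  · calc ∑ a ∈ A, ∑ b ∈ A, (if b = a ∨ b = a.swap then 4 * (W * (C * D)) else 0)
        ≤ ∑ a ∈ A, 2 * (4 * (W * (C * D))) := by
          refine Finset.sum_le_sum fun a _ => ?_
          rw [← Finset.sum_filter, Finset.sum_const, nsmul_eq_mul]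
          gcongr
          have : A.filter (fun b => b = a ∨ b = a.swap) ⊆ {a, a.swap} := fun b hb => by
            simpa using (Finset.mem_filter.1 hb).2
          exact_mod_cast (Finset.card_le_card this).trans Finset.card_le_two
      _ = A.card * (2 * (4 * (W * (C * D)))) := by rw [Finset.sum_const, nsmul_eq_mul]
      _ ≤ (n ^ 2 : ℕ) * (2 * (4 * (W * (C * D)))) := by
          gcongr
          refine (Finset.card_filter_le _ _).trans (le_of_eq ?_)
          simp [sq]
      _ = _ := by push_cast; ring

end CenteredKernel

/-! ### The weighted sum of products over distinct indices. -/

namespace CenteredKernel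

variable {S : Type*} [MeasurableSpace S] {ν : Measure (ℕ → S)} {μ : Measure S}
  [IsProbabilityMeasure μ] [IsProbabilityMeasure ν] {ξ : S → S → ℝ} {C D : ℝ}

theorem lintegral_sq_triple_le (hν : ResampleInvariant ν μ) (hξ : CenteredKernel μ ξ C D)
    {w : S → ℝ} (hw : Measurable w) {W : ℝ} (hW : 0 ≤ W)
    (hw2 : ∫⁻ y, ENNReal.ofReal (w y ^ 2) ∂μ ≤ ENNReal.ofReal W) {i j k : ℕ}
    (hji : j ≠ i) (hki : k ≠ i) (hkj : k ≠ j) :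
    ∫⁻ x, ENNReal.ofReal ((w (x i) * ξ (x i) (x j) * ξ (x i) (x k)) ^ 2) ∂ν ≤
      ENNReal.ofReal (W * (C * D) ^ 2) := by
  have h4 := hν.lintegral_prod_le (w := fun y => ENNReal.ofReal (w y ^ 2))
    (hw.pow_const 2).ennreal_ofReal (g := fun x y => ENNReal.ofReal (ξ x y ^ 2))
    (hξ.meas.pow_const 2).ennreal_ofReal (fun x _ => hξ.lintegral_sq x) i {j, k}
    (by simp [hji.symm, hki.symm])
  rw [Finset.card_pair hkj.symm] at h4
  simp_rw [Finset.prod_pair hkj.symm] at h4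
  simp_rw [mul_pow, mul_assoc, ENNReal.ofReal_mul (sq_nonneg _)]
  refine h4.trans ?_
  rw [ENNReal.ofReal_mul hW, mul_comm, ← ENNReal.ofReal_pow
    (mul_nonneg hξ.nonneg_C hξ.nonneg_D), mul_pow]
  gcongr

/-- One factor is bounded by `C * D`; the coordinate `i'` is then integrated with the `L¹` bound in
the first variable, and `j`, `k` with the one in the second. Using `L¹` norms costs a single power
of `D`, which matters because there are of order `n⁴` such pairs of terms. -/
theorem lintegral_quadruple_le (hν : ResampleInvariant ν μ) (hξ : CenteredKernel μ ξ C D)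
    {w : S → ℝ} (hw : Measurable w) {W : ℝ} (hW : 0 ≤ W)
    (hw2 : ∫⁻ y, ENNReal.ofReal (w y ^ 2) ∂μ ≤ ENNReal.ofReal W) {i i' j k : ℕ}
    (hii : i' ≠ i) (hji : j ≠ i) (hki : k ≠ i) (hji' : j ≠ i') (hki' : k ≠ i') (hkj : k ≠ j) :
    ∫⁻ x, ENNReal.ofReal (w (x i) ^ 2 *
      (|ξ (x i) (x j)| * |ξ (x i) (x k)| * (|ξ (x i') (x j)| * |ξ (x i') (x k)|))) ∂ν ≤
      ENNReal.ofReal (W * C ^ 4 * D) := by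
  have hC := hξ.nonneg_C
  have hD := hξ.nonneg_D
  have h4 := hν.lintegral_prod_le (w := fun y => ENNReal.ofReal (w y ^ 2))
    (hw.pow_const 2).ennreal_ofReal (g := fun x y => ENNReal.ofReal |ξ x y|)
    hξ.meas.abs.ennreal_ofReal (fun x _ => hξ.lintegral_abs x) i {j, k}
    (by simp [hji.symm, hki.symm])
  rw [Finset.card_pair hkj.symm] at h4
  simp_rw [Finset.prod_pair hkj.symm] at h4
  have hm : ∀ a b, Measurable fun x : ℕ → S => ENNReal.ofReal |ξ (x a) (x b)| := fun a b =>
    (hξ.measurable_eval a b).abs.ennreal_ofReal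
  have hwm : Measurable fun x : ℕ → S => ENNReal.ofReal (w (x i) ^ 2) :=
    ((hw.comp (measurable_pi_apply i)).pow_const 2).ennreal_ofReal
  calc _ ≤ ∫⁻ x, (ENNReal.ofReal (w (x i) ^ 2) * (ENNReal.ofReal |ξ (x i) (x j)| *
          ENNReal.ofReal |ξ (x i) (x k)|)) * ENNReal.ofReal (C * D) *
          ENNReal.ofReal |ξ (x i') (x k)| ∂ν := by
        refine lintegral_mono fun x => ?_
        rw [← ENNReal.ofReal_mul (abs_nonneg _), ← ENNReal.ofReal_mul (sq_nonneg _),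
          ← ENNReal.ofReal_mul (by positivity), ← ENNReal.ofReal_mul (by positivity)]
        refine ENNReal.ofReal_le_ofReal ?_
        rw [← mul_assoc, ← mul_assoc, ← mul_assoc (w (x i) ^ 2)]
        gcongr
        exact hξ.abs_le _ _
    _ ≤ ∫⁻ x, (ENNReal.ofReal (w (x i) ^ 2) * (ENNReal.ofReal |ξ (x i) (x j)| *
          ENNReal.ofReal |ξ (x i) (x k)|)) * ENNReal.ofReal (C * D) * ENNReal.ofReal C ∂ν := by
        refine hν.lintegral_le i' (((hwm.mul ((hm i j).mul (hm i k))).mul_const _).mul (hm i' k))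
          fun x => ?_
        simp only [Function.update_self, Function.update_of_ne hii.symm,
          Function.update_of_ne hji', Function.update_of_ne hki']
        rw [lintegral_const_mul' _ _ (by
          exact ENNReal.mul_ne_top (ENNReal.mul_ne_top ENNReal.ofReal_ne_top
            (ENNReal.mul_ne_top ENNReal.ofReal_ne_top ENNReal.ofReal_ne_top))
            ENNReal.ofReal_ne_top)]
        gcongr
        exact hξ.lintegral_abs_left _
    _ ≤ (ENNReal.ofReal C ^ 2 * ENNReal.ofReal W) * ENNReal.ofReal (C * D) * ENNReal.ofReal C := by
        rw [lintegral_mul_const' _ _ ENNReal.ofReal_ne_top,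
          lintegral_mul_const' _ _ ENNReal.ofReal_ne_top]
        gcongr
        exact h4.trans (by gcongr)
    _ = _ := by
        rw [← ENNReal.ofReal_pow hC, ← ENNReal.ofReal_mul (by positivity),
          ← ENNReal.ofReal_mul (by positivity), ← ENNReal.ofReal_mul (by positivity)]
        congr 1
        ring

/-- The arithmetic-geometric mean inequality separates the two weights; both halves are the
quadruple bound, with `i` and `i'` exchanged. -/
theorem integral_triple_mul_triple_le (hν : ResampleInvariant ν μ) (hξ : CenteredKernel μ ξ C D)
    {w : S → ℝ} (hw : Measurable w) {W : ℝ} (hW : 0 ≤ W)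
    (hw2 : ∫⁻ y, ENNReal.ofReal (w y ^ 2) ∂μ ≤ ENNReal.ofReal W) {i i' j k : ℕ}
    (hii : i' ≠ i) (hji : j ≠ i) (hki : k ≠ i) (hji' : j ≠ i') (hki' : k ≠ i') (hkj : k ≠ j) :
    ∫ x, (w (x i) * ξ (x i) (x j) * ξ (x i) (x k)) *
      (w (x i') * ξ (x i') (x j) * ξ (x i') (x k)) ∂ν ≤ W * C ^ 4 * D := by
  have hC := hξ.nonneg_C
  have hD := hξ.nonneg_D
  have hwm : ∀ i, Measurable fun x : ℕ → S => w (x i) := fun i => hw.comp (measurable_pi_apply i)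
  have hm := hξ.measurable_eval
  refine integral_le_of_lintegral (by positivity)
    ((((hwm i).mul (hm i j)).mul (hm i k)).mul (((hwm i').mul (hm i' j)).mul (hm i' k)))
    (G := fun x => (w (x i) ^ 2 * (|ξ (x i) (x j)| * |ξ (x i) (x k)| *
      (|ξ (x i') (x j)| * |ξ (x i') (x k)|))) * 2⁻¹ +
      (w (x i') ^ 2 * (|ξ (x i') (x j)| * |ξ (x i') (x k)| *
      (|ξ (x i) (x j)| * |ξ (x i) (x k)|))) * 2⁻¹) (fun x => ?_) ?_
  · simp only [abs_mul]
    rw [← sq_abs (w (x i)), ← sq_abs (w (x i'))]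
    have h1 : 0 ≤ |ξ (x i) (x j)| * |ξ (x i) (x k)| * (|ξ (x i') (x j)| * |ξ (x i') (x k)|) := by
      positivity
    nlinarith [mul_nonneg h1 (sq_nonneg (|w (x i)| - |w (x i')|))]
  · have h1 := lintegral_quadruple_le hν hξ hw hW hw2 hii hji hki hji' hki' hkj
    have h2 := lintegral_quadruple_le hν hξ hw hW hw2 hii.symm hji' hki' hji hki hkj
    have e : ∀ a b : ℝ, 0 ≤ a → 0 ≤ b → ENNReal.ofReal (a * 2⁻¹ + b * 2⁻¹) =
        ENNReal.ofReal a * ENNReal.ofReal 2⁻¹ + ENNReal.ofReal b * ENNReal.ofReal 2⁻¹ := by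
      intro a b ha hb
      rw [ENNReal.ofReal_add (by positivity) (by positivity), ENNReal.ofReal_mul ha,
        ENNReal.ofReal_mul hb]
    simp_rw [fun x : ℕ → S => e (w (x i) ^ 2 * (|ξ (x i) (x j)| * |ξ (x i) (x k)| *
      (|ξ (x i') (x j)| * |ξ (x i') (x k)|))) (w (x i') ^ 2 * (|ξ (x i') (x j)| *
      |ξ (x i') (x k)| * (|ξ (x i) (x j)| * |ξ (x i) (x k)|))) (by positivity) (by positivity)]
    rw [lintegral_add_left, lintegral_mul_const' _ _ ENNReal.ofReal_ne_top,
      lintegral_mul_const' _ _ ENNReal.ofReal_ne_top]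
    · calc _ ≤ ENNReal.ofReal (W * C ^ 4 * D) * ENNReal.ofReal 2⁻¹ +
            ENNReal.ofReal (W * C ^ 4 * D) * ENNReal.ofReal 2⁻¹ := by gcongr
        _ = _ := by
          rw [← e _ _ (by positivity) (by positivity)]
          congr 1
          ring
    · exact (((hwm i).pow_const 2).mul (((hm i j).abs.mul (hm i k).abs).mul
        ((hm i' j).abs.mul (hm i' k).abs))).ennreal_ofReal.mul_const _

/-- The second moment of the weighted sum of the off-diagonal products. -/
theorem lintegral_sq_triple_sum_le (hν : ResampleInvariant ν μ) (hξ : CenteredKernel μ ξ C D)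
    {w : S → ℝ} (hw : Measurable w) {W : ℝ} (hW : 0 ≤ W)
    (hw2 : ∫⁻ y, ENNReal.ofReal (w y ^ 2) ∂μ ≤ ENNReal.ofReal W) (n : ℕ) :
    ∫⁻ x, ENNReal.ofReal ((∑ i ∈ Finset.range n, w (x i) *
      ((∑ j ∈ (Finset.range n).erase i, ξ (x i) (x j)) ^ 2 -
        ∑ j ∈ (Finset.range n).erase i, ξ (x i) (x j) ^ 2)) ^ 2) ∂ν ≤
      ENNReal.ofReal (n ^ 3 * (27 * (W * (C * D) ^ 2)) + n ^ 4 * (2 * (W * C ^ 4 * D))) := by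
  have hC := hξ.nonneg_C
  have hD := hξ.nonneg_D
  set B₁ := W * (C * D) ^ 2 with hB₁
  set B₂ := W * C ^ 4 * D with hB₂
  have hB10 : 0 ≤ B₁ := by positivity
  have hB20 : 0 ≤ B₂ := by positivity
  set R := Finset.range n with hR
  set A : Finset (ℕ × ℕ × ℕ) := (R ×ˢ R ×ˢ R).filter fun a =>
    (a.2.1 ≠ a.1 ∧ a.2.2 ≠ a.1) ∧ a.2.2 ≠ a.2.1 with hA
  have hne : ∀ a ∈ A, (a.2.1 ≠ a.1 ∧ a.2.2 ≠ a.1) ∧ a.2.2 ≠ a.2.1 := fun a ha =>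
    (Finset.mem_filter.1 ha).2
  set H : ℕ × ℕ × ℕ → (ℕ → S) → ℝ := fun a x =>
    w (x a.1) * ξ (x a.1) (x a.2.1) * ξ (x a.1) (x a.2.2) with hH
  have hwm : ∀ i, Measurable fun x : ℕ → S => w (x i) := fun i => hw.comp (measurable_pi_apply i)
  have hHm : ∀ a, Measurable (H a) := fun a =>
    ((hwm _).mul (hξ.measurable_eval _ _)).mul (hξ.measurable_eval _ _)
  have hsum : ∀ x : ℕ → S, ∑ i ∈ R, w (x i) *
      ((∑ j ∈ R.erase i, ξ (x i) (x j)) ^ 2 - ∑ j ∈ R.erase i, ξ (x i) (x j) ^ 2) =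
      ∑ a ∈ A, H a x := by
    intro x
    rw [hA, Finset.sum_filter, Finset.sum_product]
    refine Finset.sum_congr rfl fun i _ => ?_
    have h1 : (∑ j ∈ R.erase i, ξ (x i) (x j)) ^ 2 - ∑ j ∈ R.erase i, ξ (x i) (x j) ^ 2 =
        ∑ j ∈ R.erase i, ∑ k ∈ R.erase i,
          (if k ≠ j then ξ (x i) (x j) * ξ (x i) (x k) else 0) := by
      rw [sq, Finset.sum_mul_sum, ← Finset.sum_sub_distrib]
      refine Finset.sum_congr rfl fun j hj => ?_
      have h2 : ξ (x i) (x j) ^ 2 = ∑ k ∈ R.erase i,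
          if k = j then ξ (x i) (x j) * ξ (x i) (x k) else 0 := by
        rw [Finset.sum_ite_eq' , if_pos hj, sq]
      rw [h2, ← Finset.sum_sub_distrib]
      refine Finset.sum_congr rfl fun k _ => ?_
      by_cases hkj : k = j <;> simp [hkj]
    rw [h1, Finset.mul_sum, Finset.sum_product, ← Finset.filter_ne', Finset.sum_filter]
    refine Finset.sum_congr rfl fun j _ => ?_
    by_cases hji : j = i
    · simp [hji]
    · simp only [ne_eq, hji, not_false_eq_true, if_true, true_and]
      rw [Finset.mul_sum, Finset.sum_filter]
      refine Finset.sum_congr rfl fun k _ => ?_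
      by_cases hki : k = i
      · simp [hki]
      · by_cases hkj : k = j
        · simp [hkj]
        · simp [hki, hkj, hH, mul_assoc]
  simp_rw [hsum]
  have hH2 : ∀ a ∈ A, ∫⁻ x, ENNReal.ofReal (H a x ^ 2) ∂ν ≤ ENNReal.ofReal B₁ := fun a ha =>
    have h := hne a ha
    lintegral_sq_triple_le hν hξ hw hW hw2 h.1.1 h.1.2 h.2
  have hHL : ∀ a ∈ A, MemLp (H a) 2 ν := fun a ha =>
    memLp_two_of_lintegral_sq (hHm a) ((hH2 a ha).trans_lt ENNReal.ofReal_lt_top)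
  -- The terms are centered in their two outer indices but not in the root `a.1`, so only an outer
  -- index missing from the other triple forces mean zero.
  have hzero : ∀ a ∈ A, ∀ b ∈ A, ∀ j, (j = a.2.1 ∨ j = a.2.2) → j ≠ b.1 → j ≠ b.2.1 → j ≠ b.2.2 →
      ∫ x, H a x * H b x ∂ν = 0 := by
    intro a ha b hb j hj h1 h2 h3
    obtain ⟨⟨hab, hac⟩, hbc⟩ := hne a ha
    refine hν.integral_eq_zero j ((hHL a ha).integrable_mul (hHL b hb)) fun x => ?_
    have e : ∀ y, H b (Function.update x j y) = H b x := fun y => by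
      simp [hH, Function.update_of_ne h1.symm, Function.update_of_ne h2.symm,
        Function.update_of_ne h3.symm]
    simp_rw [e]
    rw [integral_mul_const]
    have e2 : ∫ y, H a (Function.update x j y) ∂μ = 0 := by
      rcases hj with rfl | rfl
      · simp only [hH, Function.update_self, Function.update_of_ne hab.symm,
          Function.update_of_ne hbc]
        rw [integral_mul_const, integral_const_mul, hξ.integral_eq_zero]
        simp
      · simp only [hH, Function.update_self, Function.update_of_ne hac.symm,
          Function.update_of_ne hbc.symm]
        rw [integral_const_mul, hξ.integral_eq_zero]
        simp
    rw [e2, zero_mul]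
  set T : ℕ × ℕ × ℕ → Finset ℕ := fun a => {a.1, a.2.1, a.2.2} with hT
  -- The surviving partners of `a` are the at most `27` triples built from its indices, bounded
  -- through the second moments, and the at most `2n` triples with the same outer pair and any root.
  set β : ℕ × ℕ × ℕ → ℕ × ℕ × ℕ → ℝ := fun a b =>
    (if b ∈ T a ×ˢ T a ×ˢ T a then B₁ else 0) +
      (if b.2 = a.2 ∨ b.2 = a.2.swap then B₂ else 0) with hβ
  refine (lintegral_sq_sum_le A hHL (β := β) fun a ha b hb => ?_).trans
    (ENNReal.ofReal_le_ofReal ?_)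
  · have hβ1 : b ∈ T a ×ˢ T a ×ˢ T a → B₁ ≤ β a b := fun h => by
      simp only [hβ, if_pos h]
      split_ifs <;> linarith
    have hβ2 : b.2 = a.2 ∨ b.2 = a.2.swap → B₂ ≤ β a b := fun h => by
      simp only [hβ, if_pos h]
      split_ifs <;> linarith
    have hβ0 : 0 ≤ β a b := by
      simp only [hβ]
      split_ifs <;> linarith
    by_cases hbT : b ∈ T a ×ˢ T a ×ˢ T a
    · exact (integral_mul_le_of_sq (hHm a) (hHm b) hB10 (hH2 a ha) (hH2 b hb)).trans (hβ1 hbT)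
    · obtain ⟨⟨ha1, ha2⟩, ha3⟩ := hne a ha
      obtain ⟨⟨hb1, hb2⟩, hb3⟩ := hne b hb
      have zab : ∀ j, (j = a.2.1 ∨ j = a.2.2) → j ≠ b.1 → j ≠ b.2.1 → j ≠ b.2.2 →
          ∫ x, H a x * H b x ∂ν ≤ β a b := fun j h1 h2 h3 h4 => by
        rw [hzero a ha b hb j h1 h2 h3 h4]; exact hβ0
      have zba : ∀ j, (j = b.2.1 ∨ j = b.2.2) → j ≠ a.1 → j ≠ a.2.1 → j ≠ a.2.2 →
          ∫ x, H a x * H b x ∂ν ≤ β a b := fun j h1 h2 h3 h4 => by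
        simp_rw [mul_comm (H a _)]
        rw [hzero b hb a ha j h1 h2 h3 h4]; exact hβ0
      obtain ⟨i, j, k⟩ := a
      obtain ⟨i', j', k'⟩ := b
      simp only at ha1 ha2 ha3 hb1 hb2 hb3 zab zba
      simp only [hT, Finset.mem_product, Finset.mem_insert, Finset.mem_singleton] at hbT
      by_cases c1 : j ≠ i' ∧ j ≠ j' ∧ j ≠ k'
      · exact zab j (Or.inl rfl) c1.1 c1.2.1 c1.2.2
      by_cases c2 : k ≠ i' ∧ k ≠ j' ∧ k ≠ k'
      · exact zab k (Or.inr rfl) c2.1 c2.2.1 c2.2.2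
      by_cases c3 : j' ≠ i ∧ j' ≠ j ∧ j' ≠ k
      · exact zba j' (Or.inl rfl) c3.1 c3.2.1 c3.2.2
      by_cases c4 : k' ≠ i ∧ k' ≠ j ∧ k' ≠ k
      · exact zba k' (Or.inr rfl) c4.1 c4.2.1 c4.2.2
      -- The outer indices of `b` lie among those of `a`, so the index of `b` foreign to `a` is its
      -- root. The outer indices of `a` must then be the outer indices of `b` in some order.
      have hi1 : i' ≠ i := by omega
      have hi2 : j ≠ i' := by omega
      have hi3 : k ≠ i' := by omega
      have hcase : (j' = j ∧ k' = k) ∨ (j' = k ∧ k' = j) := by omega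
      rcases hcase with ⟨rfl, rfl⟩ | ⟨rfl, rfl⟩
      · exact (integral_triple_mul_triple_le hν hξ hw hW hw2 hi1 ha1 ha2 hi2 hi3 ha3).trans
          (hβ2 (Or.inl rfl))
      · refine le_trans (le_of_eq ?_) ((integral_triple_mul_triple_le hν hξ hw hW hw2 hi1 ha1 ha2
          hi2 hi3 ha3).trans (hβ2 (Or.inr rfl)))
        refine integral_congr_ae (ae_of_all _ fun x => ?_)
        simp only [hH]
        ring
  · have hcardT : ∀ a, ((T a ×ˢ T a ×ˢ T a).card : ℝ) ≤ 27 := fun a => by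
      have h3 : (T a).card ≤ 3 := Finset.card_le_three
      have : (T a ×ˢ T a ×ˢ T a).card ≤ 3 * (3 * 3) := by
        rw [Finset.card_product, Finset.card_product]
        gcongr
      exact_mod_cast this
    have hrow : ∀ a ∈ A, ∑ b ∈ A, β a b ≤ 27 * B₁ + n * 2 * B₂ := by
      intro a _
      simp only [hβ]
      rw [Finset.sum_add_distrib, ← Finset.sum_filter, ← Finset.sum_filter, Finset.sum_const,
        Finset.sum_const, nsmul_eq_mul, nsmul_eq_mul]
      gcongr
      · refine le_trans ?_ (hcardT a)
        exact_mod_cast Finset.card_le_card fun b hb => (Finset.mem_filter.1 hb).2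
      · have hsub : A.filter (fun b => b.2 = a.2 ∨ b.2 = a.2.swap) ⊆ R ×ˢ {a.2, a.2.swap} := by
          intro b hb
          obtain ⟨hbA, hb2⟩ := Finset.mem_filter.1 hb
          rw [Finset.mem_product]
          exact ⟨(Finset.mem_product.1 (Finset.mem_filter.1 hbA).1).1, by simpa using hb2⟩
        have := Finset.card_le_card hsub
        rw [Finset.card_product, hR, Finset.card_range] at this
        have h2 : ({a.2, a.2.swap} : Finset (ℕ × ℕ)).card ≤ 2 := Finset.card_le_two
        exact_mod_cast this.trans (Nat.mul_le_mul_left n h2)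
    have hcardA : (A.card : ℝ) ≤ n ^ 3 := by
      have : A.card ≤ n * (n * n) := by
        refine (Finset.card_filter_le _ _).trans (le_of_eq ?_)
        simp [hR]
      calc (A.card : ℝ) ≤ ((n * (n * n) : ℕ) : ℝ) := by exact_mod_cast this
        _ = _ := by push_cast; ring
    calc ∑ a ∈ A, ∑ b ∈ A, β a b ≤ ∑ a ∈ A, (27 * B₁ + n * 2 * B₂) := Finset.sum_le_sum hrow
      _ = A.card * (27 * B₁ + n * 2 * B₂) := by rw [Finset.sum_const, nsmul_eq_mul]
      _ ≤ n ^ 3 * (27 * B₁ + n * 2 * B₂) := by gcongr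
      _ = _ := by ring

end CenteredKernel

/-! ### The rescaled kernel and the smoothed density -/

/-- The rescaled kernel `h^(-d) K (y / h)`. -/
def scaledKernel {d : ℕ} (K : E d → ℝ) (h : ℝ) (y : E d) : ℝ := (h ^ d)⁻¹ * K (h⁻¹ • y)

/-- The mean of the kernel density estimator at `x`. -/
def smoothed {d : ℕ} (K : E d → ℝ) (h : ℝ) (μ : Measure (E d)) (x : E d) : ℝ :=
  ∫ y, scaledKernel K h (y - x) ∂μ

/-- The centered rescaled kernel. -/
def centeredKernel {d : ℕ} (K : E d → ℝ) (h : ℝ) (μ : Measure (E d)) (x y : E d) : ℝ :=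
  scaledKernel K h (y - x) - smoothed K h μ x

theorem measurable_scaledKernel {d : ℕ} {K : E d → ℝ} (hK : Measurable K) (h : ℝ) :
    Measurable (scaledKernel K h) := (hK.comp (by fun_prop)).const_mul _

theorem scaledKernel_neg {d : ℕ} {K : E d → ℝ} (hK : ∀ x, K (-x) = K x) (h : ℝ) (y : E d) :
    scaledKernel K h (-y) = scaledKernel K h y := by
  rw [scaledKernel, smul_neg, hK, scaledKernel]

theorem abs_scaledKernel {d : ℕ} (K : E d → ℝ) {h : ℝ} (h0 : 0 < h) (y : E d) :
    |scaledKernel K h y| = scaledKernel (fun u => |K u|) h y := by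
  rw [scaledKernel, scaledKernel, abs_mul, abs_of_pos (by positivity)]

theorem integral_scaledKernel_mul {d : ℕ} (K : E d → ℝ) {h : ℝ} (h0 : 0 < h) (g : E d → ℝ)
    (x : E d) : ∫ y, scaledKernel K h (y - x) * g y = ∫ u, K u * g (x + h • u) := by
  have h1 := integral_add_left_eq_self (μ := (volume : Measure (E d)))
    (fun y => scaledKernel K h (y - x) * g y) x
  rw [← h1]
  simp only [add_sub_cancel_left]
  have h2 := Measure.integral_comp_smul (volume : Measure (E d))
    (fun v => scaledKernel K h v * g (x + v)) h
  have h3 : ∀ u, scaledKernel K h (h • u) * g (x + h • u) =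
      (h ^ d)⁻¹ * (K u * g (x + h • u)) := fun u => by
    rw [scaledKernel, inv_smul_smul₀ h0.ne', mul_assoc]
  simp_rw [h3] at h2
  rw [integral_const_mul, finrank_euclideanSpace_fin, abs_of_pos (by positivity), smul_eq_mul] at h2
  exact (mul_left_cancel₀ (by positivity) h2).symm

theorem integrable_scaledKernel {d : ℕ} {K : E d → ℝ} (hK : Integrable K) {h : ℝ} (h0 : 0 < h)
    (x : E d) : Integrable fun y => scaledKernel K h (y - x) := by
  have h1 : Integrable (scaledKernel K h) :=
    (hK.comp_smul (R := h⁻¹) (by positivity)).const_mul _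
  exact h1.comp_sub_right x

theorem lintegral_abs_scaledKernel {d : ℕ} {K : E d → ℝ} (hK : Integrable K) {h : ℝ}
    (h0 : 0 < h) (x : E d) :
    ∫⁻ y, ENNReal.ofReal |scaledKernel K h (y - x)| = ENNReal.ofReal (∫ u, |K u|) := by
  rw [← ofReal_integral_eq_lintegral_ofReal (integrable_scaledKernel hK h0 x).abs
    (ae_of_all _ fun _ => abs_nonneg _)]
  congr 1
  have := integral_scaledKernel_mul (fun u => |K u|) h0 (fun _ => 1) x
  simp only [mul_one] at this
  rw [← this]
  simp_rw [abs_scaledKernel K h0]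

/-- The mean square of a smoothed function. -/
theorem lintegral_sq_smooth_le {d : ℕ} {K e : E d → ℝ} (hK : Measurable K) (he : Measurable e)
    (h : ℝ) :
    ∫⁻ y, ENNReal.ofReal ((∫ u, K u * e (y + h • u)) ^ 2) ≤
      (∫⁻ u, ENNReal.ofReal |K u|) ^ 2 * ∫⁻ y, ENNReal.ofReal (e y ^ 2) := by
  have hm : Measurable fun q : E d × E d =>
      ENNReal.ofReal |K q.2| * ENNReal.ofReal (e (q.1 + h • q.2) ^ 2) := by
    have h1 : Measurable fun q : E d × E d => e (q.1 + h • q.2) := he.comp (by fun_prop)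
    have h2 : Measurable fun q : E d × E d => K q.2 := hK.comp measurable_snd
    exact h2.abs.ennreal_ofReal.mul (h1.pow_const 2).ennreal_ofReal
  calc _ ≤ ∫⁻ y, (∫⁻ u, ENNReal.ofReal |K u|) *
        ∫⁻ u, ENNReal.ofReal |K u| * ENNReal.ofReal (e (y + h • u) ^ 2) :=
        lintegral_mono fun y => sq_integral_mul_le hK (he.comp (by fun_prop))
    _ = (∫⁻ u, ENNReal.ofReal |K u|) *
        ∫⁻ y, ∫⁻ u, ENNReal.ofReal |K u| * ENNReal.ofReal (e (y + h • u) ^ 2) :=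
        lintegral_const_mul _ hm.lintegral_prod_right'
    _ = (∫⁻ u, ENNReal.ofReal |K u|) *
        ∫⁻ u, ENNReal.ofReal |K u| * ∫⁻ y, ENNReal.ofReal (e y ^ 2) := by
        rw [lintegral_lintegral_swap hm.aemeasurable]
        congr 1
        refine lintegral_congr fun u => ?_
        rw [lintegral_const_mul' _ _ ENNReal.ofReal_ne_top,
          lintegral_add_right_eq_self (fun y => ENNReal.ofReal (e y ^ 2)) (h • u)]
    _ = _ := by
        rw [lintegral_mul_const _ hK.abs.ennreal_ofReal, ← mul_assoc, sq]

section Density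

variable {d : ℕ} {f : E d → ℝ} {M : ℝ}

/-- The measure with density `f`. -/
def densityMeasure {d : ℕ} (f : E d → ℝ) : Measure (E d) :=
  volume.withDensity fun x => ENNReal.ofReal (f x)

theorem lintegral_densityMeasure_le (hM : ∀ x, f x ≤ M) (g : E d → ENNReal) :
    ∫⁻ x, g x ∂(densityMeasure f) ≤ ENNReal.ofReal M * ∫⁻ x, g x := by
  have h : densityMeasure f ≤ ENNReal.ofReal M • volume := by
    rw [densityMeasure, ← withDensity_const]
    exact withDensity_mono (ae_of_all _ fun x => ENNReal.ofReal_le_ofReal (hM x))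
  refine (lintegral_mono' h le_rfl).trans ?_
  rw [lintegral_smul_measure, smul_eq_mul]

theorem integral_densityMeasure (hf : Measurable f) (hf0 : ∀ x, 0 ≤ f x) (g : E d → ℝ) :
    ∫ x, g x ∂(densityMeasure f) = ∫ x, g x * f x := by
  rw [densityMeasure, integral_withDensity_eq_integral_toReal_smul hf.ennreal_ofReal
    (ae_of_all _ fun x => ENNReal.ofReal_lt_top)]
  refine integral_congr_ae (ae_of_all _ fun x => ?_)
  simp only [ENNReal.toReal_ofReal (hf0 x), smul_eq_mul]
  ring

theorem smoothed_eq (hf : Measurable f) (hf0 : ∀ x, 0 ≤ f x) (K : E d → ℝ) {h : ℝ} (h0 : 0 < h)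
    (x : E d) : smoothed K h (densityMeasure f) x = ∫ u, K u * f (x + h • u) := by
  rw [smoothed, integral_densityMeasure hf hf0, integral_scaledKernel_mul K h0]

theorem measurable_smoothed {K : E d → ℝ} (hK : Measurable K) (h : ℝ) (μ : Measure (E d))
    [SFinite μ] : Measurable (smoothed K h μ) := by
  have h1 : Measurable (Function.uncurry fun x y : E d => scaledKernel K h (y - x)) :=
    (measurable_scaledKernel hK h).comp (measurable_snd.sub measurable_fst)
  have : StronglyMeasurable (smoothed K h μ) :=
    h1.stronglyMeasurable.integral_prod_right
  exact this.measurable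

theorem abs_integral_le_of_lintegral {α : Type*} [MeasurableSpace α] {μ : Measure α} {g : α → ℝ}
    {B : ℝ} (hB : 0 ≤ B) (h : ∫⁻ x, ENNReal.ofReal |g x| ∂μ ≤ ENNReal.ofReal B) :
    |∫ x, g x ∂μ| ≤ B := by
  have h1 : ENNReal.ofReal |∫ x, g x ∂μ| ≤ ENNReal.ofReal B := by
    refine le_trans ?_ h
    simpa [Real.enorm_eq_ofReal_abs] using enorm_integral_le_lintegral_enorm (μ := μ) g
  exact (ENNReal.ofReal_le_ofReal_iff hB).1 h1

/-- The density bound `M` makes the `L¹` norms at most `A = M ∫ |K|` at every scale, and the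
supremum is at most `C₁ D`; second moments come from their product. Symmetry of `K` handles the
first variable, and `D ≥ 1` absorbs the contribution of the mean. -/
theorem exists_centeredKernel [IsProbabilityMeasure (densityMeasure f)]
    (hM : ∀ x, f x ≤ M) (hM0 : 0 ≤ M) {K : E d → ℝ}
    (hKs : ∀ x, K (-x) = K x) (hKm : Measurable K) (hKe : HasExpTails K) :
    ∃ C : ℝ, 1 ≤ C ∧ ∀ h : ℝ, 0 < h → h ≤ 1 →
      (∀ x, |smoothed K h (densityMeasure f) x| ≤ C) ∧
      CenteredKernel (densityMeasure f) (centeredKernel K h (densityMeasure f)) C (h ^ d)⁻¹ := by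
  obtain ⟨C₁, hC₁, hKC⟩ := hKe.exists_abs_le
  have hKi := hKe.integrable hKm
  set A : ℝ := M * ∫ u, |K u| with hA
  have hA0 : 0 ≤ A := mul_nonneg hM0 (integral_nonneg fun _ => abs_nonneg _)
  refine ⟨1 + C₁ + 2 * A + 2 * C₁ * A + 2 * A ^ 2, by
    linarith [show 0 ≤ C₁ + 2 * A + 2 * C₁ * A + 2 * A ^ 2 by positivity], fun h h0 h1 => ?_⟩
  set C := 1 + C₁ + 2 * A + 2 * C₁ * A + 2 * A ^ 2 with hC
  set D := (h ^ d)⁻¹ with hD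
  set μ := densityMeasure f with hμ
  have hD1 : 1 ≤ D := (one_le_inv₀ (by positivity)).2 (pow_le_one₀ h0.le h1)
  have hAC : A ≤ C := by
    rw [hC]; linarith [show 0 ≤ 1 + C₁ + A + 2 * C₁ * A + 2 * A ^ 2 by positivity]
  have hL1 : ∀ x, ∫⁻ y, ENNReal.ofReal |scaledKernel K h (y - x)| ∂μ ≤ ENNReal.ofReal A :=
    fun x => by
      refine (lintegral_densityMeasure_le hM _).trans ?_
      rw [lintegral_abs_scaledKernel hKi h0, hA, ENNReal.ofReal_mul hM0]
  have hs : ∀ x, |smoothed K h μ x| ≤ A := fun x =>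
    abs_integral_le_of_lintegral hA0 (hL1 x)
  have hsk : ∀ y, |scaledKernel K h y| ≤ C₁ * D := fun y => by
    rw [scaledKernel, abs_mul, abs_of_pos (by positivity), mul_comm]
    gcongr
    exact hKC _
  have hskm := measurable_scaledKernel hKm h
  have hsm := measurable_smoothed hKm h μ
  have hski : ∀ x, Integrable (fun y => scaledKernel K h (y - x)) μ := fun x =>
    Integrable.of_bound (hskm.comp (measurable_sub_const x)).aestronglyMeasurable (C₁ * D)
      (ae_of_all _ fun y => hsk _)
  have habs : ∀ (x : E d) (y : E d), ENNReal.ofReal |centeredKernel K h μ x y| ≤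
      ENNReal.ofReal |scaledKernel K h (y - x)| + ENNReal.ofReal A := fun x y => by
    rw [← ENNReal.ofReal_add (abs_nonneg _) hA0]
    refine ENNReal.ofReal_le_ofReal ((abs_sub _ _).trans ?_)
    gcongr
    exact hs x
  have h2A : ENNReal.ofReal A + ENNReal.ofReal A ≤ ENNReal.ofReal C := by
    rw [← ENNReal.ofReal_add hA0 hA0]
    refine ENNReal.ofReal_le_ofReal ?_
    rw [hC]; linarith [show 0 ≤ 1 + C₁ + 2 * C₁ * A + 2 * A ^ 2 by positivity]
  refine ⟨fun x => (hs x).trans hAC, ⟨by positivity, by positivity, ?_, fun x y => ?_, fun x => ?_,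
    fun x => ?_, fun x => ?_, fun y => ?_⟩⟩
  · exact (hskm.comp (measurable_snd.sub measurable_fst)).sub (hsm.comp measurable_fst)
  · calc |centeredKernel K h μ x y| ≤ |scaledKernel K h (y - x)| + |smoothed K h μ x| := abs_sub _ _
      _ ≤ C₁ * D + A * D := by
          gcongr
          · exact hsk _
          · exact (hs x).trans (le_mul_of_one_le_right hA0 hD1)
      _ ≤ C * D := by
          rw [← add_mul]
          gcongr
          rw [hC]; linarith [show 0 ≤ 1 + A + 2 * C₁ * A + 2 * A ^ 2 by positivity]
  · simp only [centeredKernel]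
    rw [integral_sub (hski x) (integrable_const _)]
    simp [smoothed]
  · have h3 := lintegral_sq_add_le (μ := μ) (F := fun y => scaledKernel K h (y - x))
      (G := fun _ => - smoothed K h μ x) (hskm.comp (measurable_sub_const x))
    simp_rw [← sub_eq_add_neg] at h3
    refine h3.trans ?_
    have h4 : ∫⁻ y, ENNReal.ofReal (scaledKernel K h (y - x) ^ 2) ∂μ ≤
        ENNReal.ofReal (C₁ * D * A) := by
      rw [ENNReal.ofReal_mul (by positivity)]
      calc _ ≤ ∫⁻ y, ENNReal.ofReal (C₁ * D) * ENNReal.ofReal |scaledKernel K h (y - x)| ∂μ := by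
            refine lintegral_mono fun y => ?_
            rw [← ENNReal.ofReal_mul (by positivity)]
            refine ENNReal.ofReal_le_ofReal ?_
            rw [← sq_abs, sq]
            gcongr
            exact hsk _
        _ ≤ _ := by
            rw [lintegral_const_mul' _ _ ENNReal.ofReal_ne_top]
            gcongr
            exact hL1 x
    have h5 : ∫⁻ _y, ENNReal.ofReal ((- smoothed K h μ x) ^ 2) ∂μ ≤ ENNReal.ofReal (A ^ 2) := by
      rw [lintegral_const, measure_univ, mul_one, neg_sq, ← sq_abs]
      exact ENNReal.ofReal_le_ofReal (pow_le_pow_left₀ (abs_nonneg _) (hs x) 2)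
    calc _ ≤ 2 * ENNReal.ofReal (C₁ * D * A) + 2 * ENNReal.ofReal (A ^ 2) := by gcongr
      _ = ENNReal.ofReal (2 * (C₁ * D * A) + 2 * A ^ 2) :=
          two_mul_ofReal_add (by positivity) (by positivity)
      _ ≤ ENNReal.ofReal (C * D) := by
          refine ENNReal.ofReal_le_ofReal ?_
          rw [hC]
          have h6 : 2 * A ^ 2 ≤ 2 * A ^ 2 * D := le_mul_of_one_le_right (by positivity) hD1
          have h7 : 0 ≤ (1 + C₁ + 2 * A) * D := by positivity
          linarith
  · refine (lintegral_mono (habs x)).trans ?_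
    rw [lintegral_add_right _ measurable_const, lintegral_const, measure_univ, mul_one]
    exact (by gcongr; exact hL1 x : _ ≤ ENNReal.ofReal A + ENNReal.ofReal A).trans h2A
  · refine (lintegral_mono fun x => habs x y).trans ?_
    rw [lintegral_add_right _ measurable_const, lintegral_const, measure_univ, mul_one]
    have e : ∀ x, scaledKernel K h (y - x) = scaledKernel K h (x - y) := fun x => by
      rw [← scaledKernel_neg hKs, neg_sub]
    simp_rw [e]
    exact (by gcongr; exact hL1 y : _ ≤ ENNReal.ofReal A + ENNReal.ofReal A).trans h2A

end Density

/-! ### Bounds uniform over small bandwidths. -/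

/-- The bounds on the integrand and on the smoothed density used at the bandwidth `h`. -/
structure KernelBounds {d : ℕ} (φ K : E d → ℝ) (μ : Measure (E d)) (s : ℝ) (r : ℕ)
    (b C h : ℝ) : Prop where
  h_pos : 0 < h
  h_le_one : h ≤ 1
  b_pos : 0 < b
  one_le_C : 1 ≤ C
  meas_phi : Measurable φ
  meas_K : Measurable K
  kernel : CenteredKernel μ (centeredKernel K h μ) C (h ^ d)⁻¹
  upper : ∀ x, |smoothed K h μ x| ≤ C
  lower : ∀ x, φ x ≠ 0 → b ≤ smoothed K h μ x
  phi_abs : ∫⁻ x, ENNReal.ofReal |φ x| ∂μ ≤ ENNReal.ofReal C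
  phi_sq : ∫⁻ x, ENNReal.ofReal (φ x ^ 2) ∂μ ≤ ENNReal.ofReal C
  bias_proj : ∫⁻ x, ENNReal.ofReal ((φ x / smoothed K h μ x -
    ∫ z, φ z / smoothed K h μ z ^ 2 * scaledKernel K h (x - z) ∂μ) ^ 2) ∂μ ≤
      ENNReal.ofReal (C * (h ^ s) ^ 2)
  bias_mean : |(∫ x, φ x / smoothed K h μ x ∂μ) - ∫ x, φ x| ≤ C * h ^ r

theorem CenteredKernel.mono {S : Type*} [MeasurableSpace S] {μ : Measure S} {ξ : S → S → ℝ}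
    {C C' D : ℝ} (hξ : CenteredKernel μ ξ C D) (hC : C ≤ C') : CenteredKernel μ ξ C' D :=
  have hD := hξ.nonneg_D
  { nonneg_C := hξ.nonneg_C.trans hC
    nonneg_D := hD
    meas := hξ.meas
    abs_le := fun x y => (hξ.abs_le x y).trans (by gcongr)
    integral_eq_zero := hξ.integral_eq_zero
    lintegral_sq := fun x => (hξ.lintegral_sq x).trans (ENNReal.ofReal_le_ofReal (by gcongr))
    lintegral_abs := fun x => (hξ.lintegral_abs x).trans (ENNReal.ofReal_le_ofReal hC)
    lintegral_abs_left := fun x =>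
      (hξ.lintegral_abs_left x).trans (ENNReal.ofReal_le_ofReal hC) }

theorem integrable_of_lintegral_sq_of_compactSupport {d : ℕ} {φ : E d → ℝ} (hm : Measurable φ)
    (h2 : ∫⁻ x, ENNReal.ofReal (φ x ^ 2) < ⊤) (hφc : HasCompactSupport φ) : Integrable φ := by
  have h1 : Integrable ((tsupport φ).indicator fun _ => (1 : ℝ)) :=
    (integrable_indicator_iff hφc.isCompact.measurableSet).2
      (integrableOn_const hφc.isCompact.measure_lt_top.ne)
  have h3 : Integrable fun x => φ x ^ 2 :=
    ⟨(hm.pow_const 2).aestronglyMeasurable, by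
      rwa [hasFiniteIntegral_iff_ofReal (ae_of_all _ fun _ => sq_nonneg _)]⟩
  refine (h1.add h3).mono' hm.aestronglyMeasurable (ae_of_all _ fun x => ?_)
  rw [Real.norm_eq_abs, Pi.add_apply]
  by_cases hx : φ x = 0
  · rw [hx, abs_zero]
    exact add_nonneg (Set.indicator_nonneg (fun _ _ => zero_le_one) _) (sq_nonneg _)
  · rw [Set.indicator_of_mem (subset_tsupport _ hx), ← sq_abs]
    nlinarith [sq_nonneg (|φ x| - 1)]

section

variable {d : ℕ} {f φ K : E d → ℝ} {s : ℝ} {r : ℕ} {M b : ℝ}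

/-- The mean of the reweighted integrand. -/
theorem abs_integral_div_smoothed_sub_le (hfm : Measurable f) (hf0 : ∀ x, 0 ≤ f x)
    (hM : ∀ x, f x ≤ M) (hφm : Measurable φ) (hφi : Integrable φ) (hb : 0 < b) {fh : E d → ℝ}
    (hfhm : Measurable fh) (hlow : ∀ x, φ x ≠ 0 → b ≤ fh x) {δ : ℝ}
    (hδ : ∀ x, φ x ≠ 0 → |fh x - f x| ≤ δ) :
    |(∫ x, φ x / fh x ∂(densityMeasure f)) - ∫ x, φ x| ≤ (∫ x, |φ x|) / b * δ := by
  rw [integral_densityMeasure hfm hf0]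
  have hi : Integrable fun x => φ x / fh x * f x := by
    refine (hφi.abs.mul_const (M / b)).mono' ((hφm.div hfhm).mul hfm).aestronglyMeasurable
      (ae_of_all _ fun x => ?_)
    rw [Real.norm_eq_abs, abs_mul, abs_div, abs_of_nonneg (hf0 x)]
    by_cases hx : φ x = 0
    · simp [hx]
    · have h1 := hlow x hx
      rw [abs_of_pos (hb.trans_le h1), div_mul_eq_mul_div, ← mul_div_assoc]
      have h3 := hM x
      have h4 := hf0 x
      have h5 := h4.trans h3
      gcongr
  rw [← integral_sub hi hφi]
  refine abs_integral_le_integral_abs.trans ?_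
  rw [div_mul_eq_mul_div, mul_div_assoc, ← integral_mul_const]
  refine integral_mono (hi.sub hφi).abs (hφi.abs.mul_const _) fun x => ?_
  dsimp only
  by_cases hx : φ x = 0
  · simp [hx]
  · have h1 := hlow x hx
    have h2 : 0 < fh x := hb.trans_le h1
    have e : φ x / fh x * f x - φ x = -(φ x * ((fh x - f x) / fh x)) := by field_simp; ring
    rw [e, abs_neg, abs_mul, abs_div, abs_of_pos h2]
    gcongr
    · exact (abs_nonneg _).trans (hδ x hx)
    · exact hδ x hx

/-- The projection bias of the reweighted integrand in mean square. -/
theorem lintegral_sq_proj_sub_le (hfm : Measurable f) (hf0 : ∀ x, 0 ≤ f x)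
    (hM : ∀ x, f x ≤ M) (hφm : Measurable φ) (hφi : Integrable φ)
    (hKs : ∀ x, K (-x) = K x) (hKm : Measurable K) (hKe : HasExpTails K) (hb : 0 < b)
    {fh : E d → ℝ} (hfhm : Measurable fh) (hlow : ∀ x, φ x ≠ 0 → b ≤ fh x)
    (hflow : ∀ x, φ x ≠ 0 → b ≤ f x) {C : ℝ} (hup : ∀ x, |fh x| ≤ C) {δ : ℝ}
    (hδ : ∀ x, φ x ≠ 0 → |fh x - f x| ≤ δ) {h : ℝ} (h0 : 0 < h) :
    ∫⁻ x, ENNReal.ofReal ((φ x / fh x -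
      ∫ z, φ z / fh z ^ 2 * scaledKernel K h (x - z) ∂(densityMeasure f)) ^ 2) ≤
      4 * ENNReal.ofReal ((δ / b ^ 2) ^ 2) * (∫⁻ x, ENNReal.ofReal (φ x ^ 2)) +
      4 * ENNReal.ofReal (((M + C) * δ / b ^ 3) ^ 2) * ((∫⁻ u, ENNReal.ofReal |K u|) ^ 2 *
        ∫⁻ x, ENNReal.ofReal (φ x ^ 2)) +
      2 * ∫⁻ x, ENNReal.ofReal ((φ x / f x - ∫ u, K u * (φ (x + h • u) / f (x + h • u))) ^ 2) := by
  -- Both terms are compared with `q = φ / f`: the errors `φ / fh - q` and the smoothing of `e` come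
  -- from replacing `fh` by `f` and are of order `δ`, and only the smoothing error of `q` is left.
  set q : E d → ℝ := fun x => φ x / f x with hq
  set e : E d → ℝ := fun x => φ x / fh x ^ 2 * f x - q x with he
  have hqm : Measurable q := hφm.div hfm
  have hem : Measurable e := ((hφm.div (hfhm.pow_const 2)).mul hfm).sub hqm
  have heb : ∀ x, |e x| ≤ (M + C) * δ / b ^ 3 * |φ x| := by
    intro x
    by_cases hx : φ x = 0
    · simp [he, hq, hx]
    · have h1 := hlow x hx
      have h2 := hflow x hx
      have h1' := hb.trans_le h1
      have h2' := hb.trans_le h2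
      have h3 := hδ x hx
      have h4 := (abs_nonneg _).trans h3
      have h5 := hup x
      have h6 := hM x
      rw [abs_of_pos h1'] at h5
      have e1 : e x = -(φ x * ((f x + fh x) * (fh x - f x) / (fh x ^ 2 * f x))) := by
        simp only [he, hq]; field_simp; ring
      rw [e1, abs_neg, abs_mul, abs_div, abs_mul, abs_of_pos (by positivity : 0 < f x + fh x),
        abs_of_pos (by positivity : 0 < fh x ^ 2 * f x), mul_comm]
      have h7 : b ^ 3 ≤ fh x ^ 2 * f x := by
        calc b ^ 3 = b ^ 2 * b := by ring
          _ ≤ _ := by gcongr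
      have h8 : 0 ≤ M + C := by linarith
      gcongr
  have hqb : ∀ x, |q x| ≤ b⁻¹ * |φ x| := by
    intro x
    by_cases hx : φ x = 0
    · simp [hq, hx]
    · have h2 := hflow x hx
      simp only [hq]
      rw [abs_div, abs_of_pos (hb.trans_le h2), inv_mul_eq_div]
      gcongr
  have hqi : Integrable q := (hφi.abs.const_mul b⁻¹).mono' hqm.aestronglyMeasurable
    (ae_of_all _ hqb)
  have hei : Integrable e := (hφi.abs.const_mul _).mono' hem.aestronglyMeasurable
    (ae_of_all _ heb)
  obtain ⟨C₁, -, hKC⟩ := hKe.exists_abs_le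
  have hconv : ∀ (g : E d → ℝ), Integrable g → ∀ x, Integrable fun u => K u * g (x + h • u) :=
    fun g hg x => by
      have h1 : Integrable fun u => g (x + h • u) :=
        Integrable.comp_smul (f := fun v => g (x + v)) (hg.comp_add_left x) h0.ne'
      exact h1.bdd_mul hKm.aestronglyMeasurable (ae_of_all _ hKC)
  have hproj : ∀ x, ∫ z, φ z / fh z ^ 2 * scaledKernel K h (x - z) ∂(densityMeasure f) =
      (∫ u, K u * q (x + h • u)) + ∫ u, K u * e (x + h • u) := by
    intro x
    rw [integral_densityMeasure hfm hf0, ← integral_add (hconv q hqi x) (hconv e hei x)]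
    have h1 := integral_scaledKernel_mul K h0 (fun z => φ z / fh z ^ 2 * f z) x
    have h2 : ∀ z, φ z / fh z ^ 2 * scaledKernel K h (x - z) * f z =
        scaledKernel K h (z - x) * (φ z / fh z ^ 2 * f z) := fun z => by
      rw [← scaledKernel_neg hKs, neg_sub]; ring
    simp_rw [h2]
    rw [h1]
    refine integral_congr_ae (ae_of_all _ fun u => ?_)
    simp only [he]
    ring
  have hKe' : Measurable fun x => ∫ u, K u * e (x + h • u) := by
    have h1 : Measurable (Function.uncurry fun x u : E d => K u * e (x + h • u)) :=
      (hKm.comp measurable_snd).mul (hem.comp (by fun_prop))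
    exact (h1.stronglyMeasurable.integral_prod_right).measurable
  have hfirst : Measurable fun x => φ x / fh x - q x := (hφm.div hfhm).sub hqm
  have hfb : ∀ x, |φ x / fh x - q x| ≤ δ / b ^ 2 * |φ x| := by
    intro x
    by_cases hx : φ x = 0
    · simp [hq, hx]
    · have h1 := hlow x hx
      have h2 := hflow x hx
      have h1' := hb.trans_le h1
      have h2' := hb.trans_le h2
      have h3 := hδ x hx
      have h4 := (abs_nonneg _).trans h3
      have e1 : φ x / fh x - q x = -(φ x * ((fh x - f x) / (fh x * f x))) := by
        simp only [hq]; field_simp; ring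
      rw [e1, abs_neg, abs_mul, abs_div, abs_of_pos (by positivity : 0 < fh x * f x), mul_comm, sq]
      gcongr
  have hdecomp : ∀ x, φ x / fh x -
      ∫ z, φ z / fh z ^ 2 * scaledKernel K h (x - z) ∂(densityMeasure f) =
      ((φ x / fh x - q x) + -∫ u, K u * e (x + h • u)) + (q x - ∫ u, K u * q (x + h • u)) := by
    intro x; rw [hproj]; ring
  simp_rw [hdecomp]
  refine (lintegral_sq_add_le (hfirst.add hKe'.neg)).trans ?_
  gcongr
  have h1 := lintegral_sq_add_le (μ := (volume : Measure (E d)))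
    (F := fun x => φ x / fh x - q x) (G := fun x => -∫ u, K u * e (x + h • u)) hfirst
  simp_rw [neg_sq] at h1
  calc _ ≤ 2 * (2 * (ENNReal.ofReal ((δ / b ^ 2) ^ 2) * ∫⁻ x, ENNReal.ofReal (φ x ^ 2)) +
        2 * ((∫⁻ u, ENNReal.ofReal |K u|) ^ 2 * (ENNReal.ofReal (((M + C) * δ / b ^ 3) ^ 2) *
          ∫⁻ x, ENNReal.ofReal (φ x ^ 2)))) := by
        gcongr
        refine h1.trans ?_
        gcongr
        · exact lintegral_sq_const_mul_le hfb
        · refine (lintegral_sq_smooth_le hKm hem h).trans ?_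
          gcongr
          exact lintegral_sq_const_mul_le heb
    _ = _ := by ring

theorem exists_kernelBounds (hd : 1 ≤ d) (hs : 0 < s) (hrs : s ≤ r)
    [IsProbabilityMeasure (densityMeasure f)]
    (hf0 : ∀ x, 0 ≤ f x) (hφ : φ ∈ Nikolskii s) (hφc : HasCompactSupport φ)
    (hM : ∀ x, f x ≤ M) (hfr : HasBoundedDerivs r f) (hb : 0 < b)
    (hfQ : ∀ x ∈ tsupport φ, b ≤ f x) (hKs : ∀ x, K (-x) = K x) (hKr : IsKernelOfOrder r K)
    (hKe : HasExpTails K) :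
    ∃ b' C h₀ : ℝ, 0 < h₀ ∧ ∀ h, 0 < h → h ≤ h₀ →
      KernelBounds φ K (densityMeasure f) s r b' C h := by
  have hKm := hKr.1
  have hφm := hφ.1
  have hr : 0 < r := by
    rcases Nat.eq_zero_or_pos r with rfl | h
    · simp at hrs; linarith
    · exact h
  have hfm : Measurable f := by
    have := (hfr.1.continuous_partialDeriv hr (Fin.elim0)).measurable
    convert this using 1
    funext x
    simp [partialDeriv]
  have hM0 : 0 ≤ M := (hf0 0).trans (hM 0)
  have hMabs : ∀ x, |f x| ≤ M := fun x => by rw [abs_of_nonneg (hf0 x)]; exact hM x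
  have hT := hfr.taylorOn hφc.isCompact
  have hφ2 := Nikolskii.lintegral_sq_lt_top hd hφ hφc
  have hφi := integrable_of_lintegral_sq_of_compactSupport hφm hφ2 hφc
  obtain ⟨C₁, hC₁, hbias⟩ := hT.exists_abs_smooth_sub_le hr hfm hKr hKe
  obtain ⟨C₂, hC₂, hker⟩ := exists_centeredKernel hM hM0 hKs hKm hKe
  obtain ⟨C₃, hC₃, hquot⟩ := (L2Expandable.div hs hrs hφ2 hφm
    (Nikolskii.l2Expandable hd hφ hφc hrs) hfm hMabs hT hb hfQ).lintegral_sq_smooth_sub_le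
    hs hKr hKe
  set A : ℝ := ∫ u, |K u| with hA
  have hA0 : 0 ≤ A := integral_nonneg fun _ => abs_nonneg _
  have hAl : ∫⁻ u, ENNReal.ofReal |K u| = ENNReal.ofReal A :=
    (ofReal_integral_eq_lintegral_ofReal (hKe.integrable hKm).abs
      (ae_of_all _ fun _ => abs_nonneg _)).symm
  set F : ℝ := (∫⁻ x, ENNReal.ofReal (φ x ^ 2)).toReal with hF
  have hF0 : 0 ≤ F := ENNReal.toReal_nonneg
  have hFl : ∫⁻ x, ENNReal.ofReal (φ x ^ 2) = ENNReal.ofReal F :=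
    (ENNReal.ofReal_toReal hφ2.ne).symm
  set I : ℝ := ∫ x, |φ x| with hI
  have hI0 : 0 ≤ I := integral_nonneg fun _ => abs_nonneg _
  have hIl : ∫⁻ x, ENNReal.ofReal |φ x| = ENNReal.ofReal I :=
    (ofReal_integral_eq_lintegral_ofReal hφi.abs (ae_of_all _ fun _ => abs_nonneg _)).symm
  set b' := b / 2 with hb'
  have hb'0 : 0 < b' := by positivity
  set C₄ :=
    M * (4 * (C₁ / b' ^ 2) ^ 2 * F + 4 * ((M + C₂) * C₁ / b' ^ 3) ^ 2 * (A ^ 2 * F) + 2 * C₃)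
    with hC₄
  have hC₂0 : 0 ≤ C₂ := zero_le_one.trans hC₂
  have hC₄0 : 0 ≤ C₄ := by positivity
  set C := C₂ + C₄ + M * I + M * F + I / b' * C₁ with hC
  have hle : C₂ ≤ C ∧ C₄ ≤ C ∧ M * I ≤ C ∧ M * F ≤ C ∧ I / b' * C₁ ≤ C := by
    have h1 : 0 ≤ M * I := by positivity
    have h2 : 0 ≤ M * F := by positivity
    have h3 : 0 ≤ I / b' * C₁ := by positivity
    refine ⟨?_, ?_, ?_, ?_, ?_⟩ <;> rw [hC] <;> linarith
  -- This threshold gives `C₁ h ^ r ≤ b / 2`, so the smoothed density stays above `b / 2` where `φ ≠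
  -- 0`; adding `1` to `C₁` keeps the denominator positive.
  refine ⟨b', C, min 1 (b' / (C₁ + 1)), by positivity, fun h h0 hh => ?_⟩
  have h1 : h ≤ 1 := hh.trans (min_le_left _ _)
  have h2 : h ≤ b' / (C₁ + 1) := hh.trans (min_le_right _ _)
  obtain ⟨hup, hck⟩ := hker h h0 h1
  set μ := densityMeasure f with hμ
  have hδ : ∀ x, φ x ≠ 0 → |smoothed K h μ x - f x| ≤ C₁ * h ^ r := fun x hx => by
    rw [hμ, smoothed_eq hfm hf0 K h0]
    exact hbias h h0 x (subset_tsupport _ hx)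
  have hflow : ∀ x, φ x ≠ 0 → b ≤ f x := fun x hx => hfQ x (subset_tsupport _ hx)
  have hδb : C₁ * h ^ r ≤ b' := by
    calc C₁ * h ^ r ≤ (C₁ + 1) * h := by
          gcongr
          · linarith
          · exact pow_le_of_le_one h0.le h1 hr.ne'
      _ ≤ (C₁ + 1) * (b' / (C₁ + 1)) := by gcongr
      _ = b' := by field_simp
  have hlow : ∀ x, φ x ≠ 0 → b' ≤ smoothed K h μ x := fun x hx => by
    have h3 := (abs_le.1 (hδ x hx)).1
    have h4 := hflow x hx
    rw [hb'] at hδb ⊢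
    linarith
  have hsm := measurable_smoothed hKm h μ
  refine ⟨h0, h1, hb'0, hC₂.trans hle.1, hφm, hKm, hck.mono hle.1, fun x => (hup x).trans hle.1,
    hlow, ?_, ?_, ?_, ?_⟩
  · refine (lintegral_densityMeasure_le hM _).trans ?_
    rw [hIl, ← ENNReal.ofReal_mul hM0]
    exact ENNReal.ofReal_le_ofReal hle.2.2.1
  · refine (lintegral_densityMeasure_le hM _).trans ?_
    rw [hFl, ← ENNReal.ofReal_mul hM0]
    exact ENNReal.ofReal_le_ofReal hle.2.2.2.1
  · refine (lintegral_densityMeasure_le hM _).trans ?_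
    have h3 := lintegral_sq_proj_sub_le hfm hf0 hM hφm hφi hKs hKm hKe hb'0 hsm hlow
      (fun x hx => by have := hflow x hx; rw [hb']; linarith) hup hδ h0
    have h4 : ∫⁻ x, ENNReal.ofReal ((φ x / f x -
        ∫ u, K u * (φ (x + h • u) / f (x + h • u))) ^ 2) ≤ ENNReal.ofReal (C₃ * (h ^ s) ^ 2) := by
      refine le_trans (le_of_eq ?_) (hquot h h0 h1)
      refine lintegral_congr fun x => ?_
      rw [add_zero, ← neg_sq, neg_sub]
    have hrsh : h ^ r ≤ h ^ s := by
      rw [← Real.rpow_natCast]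
      exact Real.rpow_le_rpow_of_exponent_ge h0 h1 hrs
    calc _ ≤ ENNReal.ofReal M * (ENNReal.ofReal (4 * (C₁ * h ^ r / b' ^ 2) ^ 2 * F +
          4 * ((M + C₂) * (C₁ * h ^ r) / b' ^ 3) ^ 2 * (A ^ 2 * F) +
          2 * (C₃ * (h ^ s) ^ 2))) := by
          gcongr
          refine h3.trans ?_
          rw [hFl, hAl]
          refine (add_le_add_right (mul_le_mul_right h4 2) _).trans (le_of_eq ?_)
          rw [ENNReal.ofReal_add (by positivity) (by positivity),
            ENNReal.ofReal_add (by positivity) (by positivity),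
            ENNReal.ofReal_mul (by positivity), ENNReal.ofReal_mul (by positivity),
            ENNReal.ofReal_mul (p := 4 * _) (by positivity),
            ENNReal.ofReal_mul (p := 4) (by positivity), ENNReal.ofReal_mul (p := A ^ 2)
            (by positivity), ENNReal.ofReal_mul (p := 2) (by positivity), ENNReal.ofReal_pow hA0,
            ENNReal.ofReal_ofNat, ENNReal.ofReal_ofNat, ENNReal.ofReal_mul (p := 4)
            (by positivity), ENNReal.ofReal_ofNat, ENNReal.ofReal_mul (p := C₃) hC₃]
      _ = ENNReal.ofReal (M * (4 * (C₁ * h ^ r / b' ^ 2) ^ 2 * F +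
          4 * ((M + C₂) * (C₁ * h ^ r) / b' ^ 3) ^ 2 * (A ^ 2 * F) +
          2 * (C₃ * (h ^ s) ^ 2))) := (ENNReal.ofReal_mul hM0).symm
      _ ≤ ENNReal.ofReal (C₄ * (h ^ s) ^ 2) := by
          refine ENNReal.ofReal_le_ofReal ?_
          calc _ ≤ M * (4 * (C₁ * h ^ s / b' ^ 2) ^ 2 * F +
              4 * ((M + C₂) * (C₁ * h ^ s) / b' ^ 3) ^ 2 * (A ^ 2 * F) +
              2 * (C₃ * (h ^ s) ^ 2)) := by gcongr
            _ = _ := by rw [hC₄]; ring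
      _ ≤ _ := by
          refine ENNReal.ofReal_le_ofReal ?_
          gcongr
          exact hle.2.1
  · refine (abs_integral_div_smoothed_sub_le hfm hf0 hM hφm hφi hb'0 hsm hlow hδ).trans ?_
    rw [← mul_assoc]
    gcongr
    exact hle.2.2.2.2

end

/-! ### The linear part of the estimator -/

/-- Integrate `|Z| ≤ Z² / (2q) + q / 2` with `q` slightly above `√c`; the slack keeps `q` positive
when `√c = 0`. -/
theorem lintegral_abs_le_of_sq {Ω : Type*} [MeasurableSpace Ω] {P : Measure Ω}
    [IsProbabilityMeasure P] {Z : Ω → ℝ} {c : ℝ}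
    (h : ∫⁻ ω, ENNReal.ofReal (Z ω ^ 2) ∂P ≤ ENNReal.ofReal c) :
    ∫⁻ ω, ENNReal.ofReal |Z ω| ∂P ≤ ENNReal.ofReal √c := by
  have key : ∀ e : ℝ, 0 < e → ∫⁻ ω, ENNReal.ofReal |Z ω| ∂P ≤ ENNReal.ofReal (√c + e) := by
    intro e he
    set q := √c + e with hq
    have hq0 : 0 < q := by positivity
    have hcq : c ≤ q ^ 2 := by
      rw [← Real.sqrt_le_sqrt_iff (by positivity), Real.sqrt_sq hq0.le]; linarith
    calc ∫⁻ ω, ENNReal.ofReal |Z ω| ∂P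
        ≤ ∫⁻ ω, (ENNReal.ofReal (1 / (2 * q)) * ENNReal.ofReal (Z ω ^ 2) +
          ENNReal.ofReal (q / 2)) ∂P := by
          refine lintegral_mono fun ω => ?_
          rw [← ENNReal.ofReal_mul (by positivity), ← ENNReal.ofReal_add (by positivity)
            (by positivity)]
          refine ENNReal.ofReal_le_ofReal ?_
          rw [← sq_abs (Z ω), div_mul_eq_mul_div, div_add_div _ _ (by positivity) (by positivity),
            le_div_iff₀ (by positivity)]
          nlinarith [sq_nonneg (|Z ω| - q)]
      _ = ENNReal.ofReal (1 / (2 * q)) * ∫⁻ ω, ENNReal.ofReal (Z ω ^ 2) ∂P +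
          ENNReal.ofReal (q / 2) := by
          rw [lintegral_add_right _ measurable_const, lintegral_const_mul' _ _
            ENNReal.ofReal_ne_top]
          simp
      _ ≤ ENNReal.ofReal (1 / (2 * q)) * ENNReal.ofReal (q ^ 2) + ENNReal.ofReal (q / 2) := by
          gcongr
          exact h.trans (ENNReal.ofReal_le_ofReal hcq)
      _ = _ := by
          rw [← ENNReal.ofReal_mul (by positivity), ← ENNReal.ofReal_add (by positivity)
            (by positivity)]
          congr 1
          field_simp
          ring
  refine ge_of_tendsto (x := 𝓝[>] (0 : ℝ)) (f := fun e => ENNReal.ofReal (√c + e)) ?_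
    (eventually_nhdsWithin_of_forall key)
  have : Continuous fun e : ℝ => ENNReal.ofReal (√c + e) :=
    ENNReal.continuous_ofReal.comp (by fun_prop)
  simpa using this.continuousWithinAt.tendsto (x := 0) (s := Set.Ioi (0 : ℝ))

theorem lintegral_abs_add_le {Ω : Type*} [MeasurableSpace Ω] {P : Measure Ω} {F G : Ω → ℝ}
    (hF : Measurable F) {a b : ℝ} (ha : 0 ≤ a) (hb : 0 ≤ b)
    (h1 : ∫⁻ ω, ENNReal.ofReal |F ω| ∂P ≤ ENNReal.ofReal a)
    (h2 : ∫⁻ ω, ENNReal.ofReal |G ω| ∂P ≤ ENNReal.ofReal b) :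
    ∫⁻ ω, ENNReal.ofReal |F ω + G ω| ∂P ≤ ENNReal.ofReal (a + b) := by
  rw [ENNReal.ofReal_add ha hb]
  refine le_trans ?_ (add_le_add h1 h2)
  rw [← lintegral_add_left hF.abs.ennreal_ofReal]
  refine lintegral_mono fun ω => ?_
  rw [← ENNReal.ofReal_add (abs_nonneg _) (abs_nonneg _)]
  exact ENNReal.ofReal_le_ofReal (abs_add_le _ _)

theorem lintegral_abs_const_mul_le {Ω : Type*} [MeasurableSpace Ω] {P : Measure Ω} {F : Ω → ℝ}
    (k : ℝ) {a : ℝ} (h : ∫⁻ ω, ENNReal.ofReal |F ω| ∂P ≤ ENNReal.ofReal a) :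
    ∫⁻ ω, ENNReal.ofReal |k * F ω| ∂P ≤ ENNReal.ofReal (|k| * a) := by
  rw [ENNReal.ofReal_mul (abs_nonneg _)]
  simp_rw [abs_mul, ENNReal.ofReal_mul (abs_nonneg k)]
  rw [lintegral_const_mul' _ _ ENNReal.ofReal_ne_top]
  gcongr

/-- The integrand divided by a power of the smoothed density. -/
def weight {d : ℕ} (φ K : E d → ℝ) (h : ℝ) (μ : Measure (E d)) (k : ℕ) (x : E d) : ℝ :=
  φ x / smoothed K h μ x ^ k

/-- The centered kernel sum at the point `x i` of the sample. -/
def devSum {d : ℕ} (K : E d → ℝ) (h : ℝ) (μ : Measure (E d)) (n : ℕ) (x : ℕ → E d) (i : ℕ) : ℝ :=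
  ∑ j ∈ (Finset.range n).erase i, centeredKernel K h μ (x i) (x j)

/-- The sum of the squared centered kernels at the point `x i` of the sample. -/
def devSqSum {d : ℕ} (K : E d → ℝ) (h : ℝ) (μ : Measure (E d)) (n : ℕ) (x : ℕ → E d) (i : ℕ) :
    ℝ :=
  ∑ j ∈ (Finset.range n).erase i, centeredKernel K h μ (x i) (x j) ^ 2

/-- The first order expansion of the error of the estimator. -/
def linearPart {d : ℕ} (φ K : E d → ℝ) (h : ℝ) (μ : Measure (E d)) (n : ℕ) (x : ℕ → E d) : ℝ :=
  (n : ℝ)⁻¹ * ∑ i ∈ Finset.range n, (weight φ K h μ 1 (x i) * (1 + (n : ℝ)⁻¹) -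
    weight φ K h μ 2 (x i) * ((n : ℝ)⁻¹ * devSum K h μ n x i)) - ∫ z, φ z

/-- The second order term left by the variance correction. -/
def quadraticPart {d : ℕ} (φ K : E d → ℝ) (h : ℝ) (μ : Measure (E d)) (n : ℕ) (x : ℕ → E d) : ℝ :=
  ((n : ℝ) ^ 3)⁻¹ * ∑ i ∈ Finset.range n, weight φ K h μ 3 (x i) *
    (devSum K h μ n x i ^ 2 - devSqSum K h μ n x i)

theorem sum_range_sum_erase {n : ℕ} (a : ℕ → ℝ) :
    ∑ i ∈ Finset.range n, ∑ j ∈ (Finset.range n).erase i, a j =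
      ((n : ℝ) - 1) * ∑ j ∈ Finset.range n, a j := by
  have h1 : ∀ i ∈ Finset.range n, ∑ j ∈ (Finset.range n).erase i, a j =
      (∑ j ∈ Finset.range n, a j) - a i := fun i hi => by
    rw [← Finset.sum_erase_add _ _ hi]; ring
  rw [Finset.sum_congr rfl h1, Finset.sum_sub_distrib, Finset.sum_const, Finset.card_range,
    nsmul_eq_mul]
  ring

namespace KernelBounds

variable {d : ℕ} {φ K : E d → ℝ} {μ : Measure (E d)} {s : ℝ} {r : ℕ} {b C h : ℝ}

theorem abs_weight_le (hB : KernelBounds φ K μ s r b C h) (k : ℕ) (x : E d) :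
    |weight φ K h μ k x| ≤ (b ^ k)⁻¹ * |φ x| := by
  have hb := hB.b_pos
  by_cases hx : φ x = 0
  · simp [weight, hx]
  · have h1 := hB.lower x hx
    rw [weight, abs_div, abs_of_pos (pow_pos (hb.trans_le h1) k), inv_mul_eq_div]
    gcongr

theorem lintegral_weight_sq (hB : KernelBounds φ K μ s r b C h) (k : ℕ) :
    ∫⁻ x, ENNReal.ofReal (weight φ K h μ k x ^ 2) ∂μ ≤ ENNReal.ofReal (((b ^ k)⁻¹) ^ 2 * C) := by
  refine (lintegral_sq_const_mul_le (hB.abs_weight_le k)).trans ?_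
  rw [ENNReal.ofReal_mul (sq_nonneg _)]
  gcongr
  exact hB.phi_sq

theorem integrable_phi (hB : KernelBounds φ K μ s r b C h) : Integrable φ μ :=
  ⟨hB.meas_phi.aestronglyMeasurable, by
    rw [hasFiniteIntegral_iff_norm]
    exact hB.phi_abs.trans_lt ENNReal.ofReal_lt_top⟩

theorem one_le_inv_pow (hB : KernelBounds φ K μ s r b C h) : 1 ≤ (h ^ d)⁻¹ :=
  (one_le_inv₀ (pow_pos hB.h_pos d)).2 (pow_le_one₀ hB.h_pos.le hB.h_le_one)

variable [IsProbabilityMeasure μ]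

theorem meas_weight (hB : KernelBounds φ K μ s r b C h) (k : ℕ) :
    Measurable (weight φ K h μ k) :=
  hB.meas_phi.div ((measurable_smoothed hB.meas_K h μ).pow_const k)

theorem integrable_weight (hB : KernelBounds φ K μ s r b C h) (k : ℕ) :
    Integrable (weight φ K h μ k) μ :=
  (hB.integrable_phi.abs.const_mul _).mono' (hB.meas_weight k).aestronglyMeasurable
    (ae_of_all _ (hB.abs_weight_le k))

theorem meas_proj (hB : KernelBounds φ K μ s r b C h) :
    Measurable fun y => ∫ z, weight φ K h μ 2 z * centeredKernel K h μ z y ∂μ := by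
  have : StronglyMeasurable fun y => ∫ z, weight φ K h μ 2 z * centeredKernel K h μ z y ∂μ :=
    StronglyMeasurable.integral_prod_left (f := fun z y => weight φ K h μ 2 z *
      centeredKernel K h μ z y)
      (((hB.meas_weight 2).comp measurable_fst).mul hB.kernel.meas).stronglyMeasurable
  exact this.measurable

theorem integral_proj (hB : KernelBounds φ K μ s r b C h) :
    ∫ y, ∫ z, weight φ K h μ 2 z * centeredKernel K h μ z y ∂μ ∂μ = 0 := by
  have hwξ : Measurable (Function.uncurry fun z y => weight φ K h μ 2 z *
      centeredKernel K h μ z y) := ((hB.meas_weight 2).comp measurable_fst).mul hB.kernel.meas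
  have hi : Integrable (Function.uncurry fun z y => weight φ K h μ 2 z *
      centeredKernel K h μ z y) (μ.prod μ) := by
    have h1 : Integrable (fun p : E d × E d => weight φ K h μ 2 p.1) (μ.prod μ) :=
      (hB.integrable_weight 2).comp_fst μ
    refine (h1.abs.mul_const (C * (h ^ d)⁻¹)).mono' hwξ.aestronglyMeasurable
      (ae_of_all _ fun p => ?_)
    rw [Function.uncurry, Real.norm_eq_abs, abs_mul]
    exact mul_le_mul_of_nonneg_left (hB.kernel.abs_le _ _) (abs_nonneg _)
  rw [← integral_integral_swap hi]
  simp_rw [integral_const_mul, hB.kernel.integral_eq_zero, mul_zero, integral_zero]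

/-- The centering of the kernel turns `φ / p²` into `φ / p`, so the projection is a smoothed
integrand minus a constant. This is the term that cancels the fluctuation of `φ / p`. -/
theorem proj_eq (hB : KernelBounds φ K μ s r b C h) (y : E d) :
    ∫ z, weight φ K h μ 2 z * centeredKernel K h μ z y ∂μ =
      (∫ z, φ z / smoothed K h μ z ^ 2 * scaledKernel K h (y - z) ∂μ) -
        ∫ z, φ z / smoothed K h μ z ∂μ := by
  have h1 : ∀ z, weight φ K h μ 2 z * centeredKernel K h μ z y =
      φ z / smoothed K h μ z ^ 2 * scaledKernel K h (y - z) - φ z / smoothed K h μ z := by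
    intro z
    rw [weight, centeredKernel, mul_sub]
    congr 1
    by_cases hz : φ z = 0
    · simp [hz]
    · have := hB.b_pos.trans_le (hB.lower z hz)
      field_simp
  simp_rw [h1]
  have h2 : Integrable (fun z => φ z / smoothed K h μ z) μ := by
    refine (hB.integrable_weight 1).congr (ae_of_all _ fun z => ?_)
    rw [weight, pow_one]
  refine integral_sub ?_ h2
  have h3 : Integrable (fun z => weight φ K h μ 2 z * centeredKernel K h μ z y) μ :=
    (hB.integrable_weight 2).mul_bdd hB.kernel.meas.of_uncurry_right.aestronglyMeasurable
      (ae_of_all _ fun z => hB.kernel.abs_le z y)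
  refine (h3.add h2).congr (ae_of_all _ fun z => ?_)
  rw [Pi.add_apply, h1]
  ring

/-- Hoeffding decomposition. The five pieces are the centered i.i.d. sum, the deterministic bias,
the effect of dividing `n - 1` terms by `n`, the projection left because each `x j` occurs `n - 1`
times instead of `n`, and the degenerate double sum. -/
theorem linearPart_eq (hB : KernelBounds φ K μ s r b C h) {n : ℕ}
    (hn : 1 ≤ n) (x : ℕ → E d) :
    linearPart φ K h μ n x =
      (n : ℝ)⁻¹ * ∑ i ∈ Finset.range n, (φ (x i) / smoothed K h μ (x i) -
        ∫ z, φ z / smoothed K h μ z ^ 2 * scaledKernel K h (x i - z) ∂μ) +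
      (((∫ z, φ z / smoothed K h μ z ∂μ) - ∫ z, φ z) +
      (((n : ℝ) ^ 2)⁻¹ * ∑ i ∈ Finset.range n, weight φ K h μ 1 (x i) +
      (((n : ℝ) ^ 2)⁻¹ * ∑ j ∈ Finset.range n,
        (∫ z, weight φ K h μ 2 z * centeredKernel K h μ z (x j) ∂μ) +
      (-((n : ℝ) ^ 2)⁻¹) * ∑ i ∈ Finset.range n, ∑ j ∈ (Finset.range n).erase i,
        (weight φ K h μ 2 (x i) * centeredKernel K h μ (x i) (x j) -
          ∫ z, weight φ K h μ 2 z * centeredKernel K h μ z (x j) ∂μ)))) := by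
  have hn0 : (n : ℝ) ≠ 0 := by positivity
  have h1 : ∑ i ∈ Finset.range n, ∑ j ∈ (Finset.range n).erase i,
        (weight φ K h μ 2 (x i) * centeredKernel K h μ (x i) (x j) -
          ∫ z, weight φ K h μ 2 z * centeredKernel K h μ z (x j) ∂μ) =
      ∑ i ∈ Finset.range n, weight φ K h μ 2 (x i) * devSum K h μ n x i - ((n : ℝ) - 1) *
        ∑ j ∈ Finset.range n, ∫ z, weight φ K h μ 2 z * centeredKernel K h μ z (x j) ∂μ := by
    rw [← sum_range_sum_erase, ← Finset.sum_sub_distrib]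
    refine Finset.sum_congr rfl fun i _ => ?_
    rw [Finset.sum_sub_distrib, devSum, Finset.mul_sum]
  have h2 : ∑ i ∈ Finset.range n, (φ (x i) / smoothed K h μ (x i) -
        ∫ z, φ z / smoothed K h μ z ^ 2 * scaledKernel K h (x i - z) ∂μ) =
      ∑ i ∈ Finset.range n, weight φ K h μ 1 (x i) -
        ∑ j ∈ Finset.range n, (∫ z, weight φ K h μ 2 z * centeredKernel K h μ z (x j) ∂μ) -
        n * ∫ z, φ z / smoothed K h μ z ∂μ := by
    simp_rw [hB.proj_eq, weight, pow_one]
    rw [Finset.sum_sub_distrib, Finset.sum_sub_distrib, Finset.sum_const, Finset.card_range,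
      nsmul_eq_mul]
    ring
  rw [h1, h2, linearPart, Finset.sum_sub_distrib, ← Finset.sum_mul]
  have h3 : ∑ i ∈ Finset.range n, weight φ K h μ 2 (x i) * ((n : ℝ)⁻¹ * devSum K h μ n x i) =
      (n : ℝ)⁻¹ * ∑ i ∈ Finset.range n, weight φ K h μ 2 (x i) * devSum K h μ n x i := by
    rw [Finset.mul_sum]
    exact Finset.sum_congr rfl fun i _ => by ring
  rw [h3]
  field_simp
  ring

end KernelBounds

theorem lintegral_abs_const_mul_le_of_sq {Ω : Type*} [MeasurableSpace Ω] {P : Measure Ω}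
    [IsProbabilityMeasure P] {Z : Ω → ℝ} {c : ℝ} (k : ℝ) {t : ℝ} (ht : 0 ≤ t)
    (h : ∫⁻ ω, ENNReal.ofReal (Z ω ^ 2) ∂P ≤ ENNReal.ofReal c) (hk : k ^ 2 * c ≤ t ^ 2) :
    ∫⁻ ω, ENNReal.ofReal |k * Z ω| ∂P ≤ ENNReal.ofReal t := by
  rw [← Real.sqrt_sq ht]
  refine lintegral_abs_le_of_sq ?_
  refine le_trans ?_ (ENNReal.ofReal_le_ofReal hk)
  simp_rw [mul_pow, ENNReal.ofReal_mul (sq_nonneg k)]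
  rw [lintegral_const_mul' _ _ ENNReal.ofReal_ne_top]
  gcongr

namespace KernelBounds

variable {d : ℕ} {φ K : E d → ℝ} {μ : Measure (E d)} {ν : Measure (ℕ → E d)} {s : ℝ} {r : ℕ}
  {b C h : ℝ}

theorem meas_devSum (hB : KernelBounds φ K μ s r b C h) (n i : ℕ) :
    Measurable fun x => devSum K h μ n x i :=
  Finset.measurable_fun_sum _ fun j _ => hB.kernel.measurable_eval i j

theorem meas_devSqSum (hB : KernelBounds φ K μ s r b C h) (n i : ℕ) :
    Measurable fun x => devSqSum K h μ n x i :=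
  Finset.measurable_fun_sum _ fun j _ => (hB.kernel.measurable_eval i j).pow_const 2

variable [IsProbabilityMeasure μ] [IsProbabilityMeasure ν]

theorem meas_weight_eval (hB : KernelBounds φ K μ s r b C h) (k i : ℕ) :
    Measurable fun x : ℕ → E d => weight φ K h μ k (x i) :=
  (hB.meas_weight k).comp (measurable_pi_apply i)

theorem meas_linearPart (hB : KernelBounds φ K μ s r b C h) (n : ℕ) :
    Measurable (linearPart φ K h μ n) :=
  ((Finset.measurable_fun_sum _ fun i _ => ((hB.meas_weight_eval 1 i).mul_const _).sub
    ((hB.meas_weight_eval 2 i).mul ((hB.meas_devSum n i).const_mul _))).const_mul _).sub_const _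

theorem meas_quadraticPart (hB : KernelBounds φ K μ s r b C h) (n : ℕ) :
    Measurable (quadraticPart φ K h μ n) :=
  (Finset.measurable_fun_sum _ fun i _ => (hB.meas_weight_eval 3 i).mul
    (((hB.meas_devSum n i).pow_const 2).sub (hB.meas_devSqSum n i))).const_mul _

theorem lintegral_abs_sum_le (hν : ResampleInvariant ν μ) (hB : KernelBounds φ K μ s r b C h)
    (n : ℕ) :
    ∫⁻ x, ENNReal.ofReal |∑ i ∈ Finset.range n, weight φ K h μ 1 (x i)| ∂ν ≤
      ENNReal.ofReal (n * (b⁻¹ * C)) := by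
  have hb := hB.b_pos
  have hC := zero_le_one.trans hB.one_le_C
  have h1 : ∀ i, ∫⁻ x : ℕ → E d, ENNReal.ofReal |weight φ K h μ 1 (x i)| ∂ν ≤
      ENNReal.ofReal (b⁻¹ * C) := fun i => by
    rw [hν.lintegral_eval i (w := fun y => ENNReal.ofReal |weight φ K h μ 1 y|)
      (hB.meas_weight 1).abs.ennreal_ofReal, ENNReal.ofReal_mul (by positivity)]
    refine le_trans ?_ (mul_le_mul_right hB.phi_abs _)
    rw [← lintegral_const_mul' _ _ ENNReal.ofReal_ne_top]
    refine lintegral_mono fun x => ?_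
    rw [← ENNReal.ofReal_mul (by positivity)]
    exact ENNReal.ofReal_le_ofReal (by simpa using hB.abs_weight_le 1 x)
  calc _ ≤ ∫⁻ x : ℕ → E d, ∑ i ∈ Finset.range n, ENNReal.ofReal |weight φ K h μ 1 (x i)| ∂ν := by
        refine lintegral_mono fun x => ?_
        rw [← ENNReal.ofReal_sum_of_nonneg fun _ _ => abs_nonneg _]
        exact ENNReal.ofReal_le_ofReal (Finset.abs_sum_le_sum_abs _ _)
    _ = ∑ i ∈ Finset.range n, ∫⁻ x : ℕ → E d, ENNReal.ofReal |weight φ K h μ 1 (x i)| ∂ν :=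
        lintegral_finsetSum _ fun i _ => (hB.meas_weight_eval 1 i).abs.ennreal_ofReal
    _ ≤ ∑ i ∈ Finset.range n, ENNReal.ofReal (b⁻¹ * C) := Finset.sum_le_sum fun i _ => h1 i
    _ = _ := by
        rw [Finset.sum_const, Finset.card_range, nsmul_eq_mul,
          ENNReal.ofReal_mul (Nat.cast_nonneg n), ENNReal.ofReal_natCast]

theorem lintegral_sq_proj_le (hB : KernelBounds φ K μ s r b C h) :
    ∫⁻ y, ENNReal.ofReal ((∫ z, weight φ K h μ 2 z * centeredKernel K h μ z y ∂μ) ^ 2) ∂μ ≤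
      ENNReal.ofReal ((b ^ 2)⁻¹ ^ 2 * C * (C * (h ^ d)⁻¹)) := by
  have hC := zero_le_one.trans hB.one_le_C
  have hwξ : Measurable (Function.uncurry fun z y => weight φ K h μ 2 z *
      centeredKernel K h μ z y) := ((hB.meas_weight 2).comp measurable_fst).mul hB.kernel.meas
  calc _ ≤ ∫⁻ y, ∫⁻ z, ENNReal.ofReal
          ((weight φ K h μ 2 z * centeredKernel K h μ z y) ^ 2) ∂μ ∂μ :=
        lintegral_mono fun y => sq_integral_le_lintegral
          (F := fun z => weight φ K h μ 2 z * centeredKernel K h μ z y) hwξ.of_uncurry_right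
    _ = ∫⁻ z, ∫⁻ y, ENNReal.ofReal
          ((weight φ K h μ 2 z * centeredKernel K h μ z y) ^ 2) ∂μ ∂μ :=
        lintegral_lintegral_swap
          ((hwξ.comp measurable_swap).pow_const 2).ennreal_ofReal.aemeasurable
    _ ≤ ∫⁻ z, ENNReal.ofReal (weight φ K h μ 2 z ^ 2) * ENNReal.ofReal (C * (h ^ d)⁻¹) ∂μ := by
        refine lintegral_mono fun z => ?_
        simp_rw [mul_pow, ENNReal.ofReal_mul (sq_nonneg (weight φ K h μ 2 z))]
        rw [lintegral_const_mul' _ _ ENNReal.ofReal_ne_top]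
        exact mul_le_mul_right (hB.kernel.lintegral_sq z) _
    _ ≤ _ := by
        rw [lintegral_mul_const' _ _ ENNReal.ofReal_ne_top,
          ENNReal.ofReal_mul (p := (b ^ 2)⁻¹ ^ 2 * C) (by positivity)]
        exact mul_le_mul_left (hB.lintegral_weight_sq 2) _

/-- After multiplication by `√n` the five pieces are of order `h ^ s`, `√n h ^ r`, `1 / √n`, `√D /
n` and `√(D / n)`; the third and fourth are dominated by the last since `D ≥ 1` and `n ≥ 1`. -/
theorem lintegral_abs_linearPart_le (hν : ResampleInvariant ν μ)
    (hB : KernelBounds φ K μ s r b C h) {n : ℕ} (hn : 1 ≤ n) :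
    ∫⁻ x, ENNReal.ofReal |√n * linearPart φ K h μ n x| ∂ν ≤
      ENNReal.ofReal ((C + b⁻¹ * C + 4 * ((b ^ 2)⁻¹ * C)) *
        (h ^ s + √n * h ^ r + √(h ^ d)⁻¹ / √n)) := by
  have hb := hB.b_pos
  have hC1 := hB.one_le_C
  have hC := zero_le_one.trans hC1
  have h0 := hB.h_pos
  have hD1 := hB.one_le_inv_pow
  set D := (h ^ d)⁻¹ with hD
  have hD0 : 0 < D := zero_lt_one.trans_le hD1
  have hn1 : (1 : ℝ) ≤ n := by exact_mod_cast hn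
  have hn0 : (0 : ℝ) < n := zero_lt_one.trans_le hn1
  have hsn : √(n : ℝ) ^ 2 = n := Real.sq_sqrt hn0.le
  have hsn0 : 0 < √(n : ℝ) := Real.sqrt_pos.2 hn0
  have hsD : √D ^ 2 = D := Real.sq_sqrt hD0.le
  have hsD1 : 1 ≤ √D := by rw [Real.one_le_sqrt]; exact hD1
  have hpm := hB.meas_proj
  have hGm : Measurable fun y => φ y / smoothed K h μ y -
      ∫ z, φ z / smoothed K h μ z ^ 2 * scaledKernel K h (y - z) ∂μ := by
    have : Measurable fun y => weight φ K h μ 1 y -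
      ((∫ z, weight φ K h μ 2 z * centeredKernel K h μ z y ∂μ) +
        ∫ z, φ z / smoothed K h μ z ∂μ) := (hB.meas_weight 1).sub (hpm.add_const _)
    convert this using 2 with y
    rw [hB.proj_eq, weight, pow_one, sub_add_cancel]
  have hG0 : ∫ y, (φ y / smoothed K h μ y -
      ∫ z, φ z / smoothed K h μ z ^ 2 * scaledKernel K h (y - z) ∂μ) ∂μ = 0 := by
    have h1 : ∀ y, φ y / smoothed K h μ y -
        ∫ z, φ z / smoothed K h μ z ^ 2 * scaledKernel K h (y - z) ∂μ =
        weight φ K h μ 1 y - ((∫ z, weight φ K h μ 2 z * centeredKernel K h μ z y ∂μ) +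
        ∫ z, φ z / smoothed K h μ z ∂μ) := fun y => by
      rw [hB.proj_eq, weight, pow_one, sub_add_cancel]
    have hpi : Integrable (fun y => ∫ z, weight φ K h μ 2 z * centeredKernel K h μ z y ∂μ) μ :=
      (memLp_two_of_lintegral_sq hpm
        (hB.lintegral_sq_proj_le.trans_lt ENNReal.ofReal_lt_top)).integrable (by norm_num)
    simp_rw [h1]
    rw [integral_sub (g := fun y => (∫ z, weight φ K h μ 2 z * centeredKernel K h μ z y ∂μ) +
        ∫ z, φ z / smoothed K h μ z ∂μ) (hB.integrable_weight 1) (hpi.add (integrable_const _)),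
      integral_add hpi (integrable_const _), hB.integral_proj]
    simp [weight]
  have e1 := hν.lintegral_sq_sum_centered_le hGm (by positivity) hB.bias_proj hG0 n
  have e4 := hν.lintegral_sq_sum_centered_le hpm (by positivity) hB.lintegral_sq_proj_le
    hB.integral_proj n
  have e5 := hB.kernel.lintegral_sq_double_sum_le hν (hB.meas_weight 2) (by positivity)
    (hB.lintegral_weight_sq 2) n
  have hev : ∀ g : E d → ℝ, Measurable g →
      Measurable fun x : ℕ → E d => ∑ i ∈ Finset.range n, g (x i) := fun g hg =>
    Finset.measurable_fun_sum _ fun i _ => hg.comp (measurable_pi_apply i)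
  have t1 := lintegral_abs_const_mul_le_of_sq (√n * (n : ℝ)⁻¹) (t := C * h ^ s) (by positivity)
    e1 (by
      calc (√n * (n : ℝ)⁻¹) ^ 2 * (n * (C * (h ^ s) ^ 2)) = C * (h ^ s) ^ 2 := by
            rw [mul_pow, hsn]; field_simp
        _ ≤ C ^ 2 * (h ^ s) ^ 2 := by gcongr; nlinarith
        _ = _ := by ring)
  have t2 : ∫⁻ _ : ℕ → E d, ENNReal.ofReal |√n * ((∫ z, φ z / smoothed K h μ z ∂μ) -
      ∫ z, φ z)| ∂ν ≤ ENNReal.ofReal (C * (√n * h ^ r)) := by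
    rw [lintegral_const, measure_univ, mul_one]
    refine ENNReal.ofReal_le_ofReal ?_
    rw [abs_mul, abs_of_pos hsn0]
    nlinarith [hB.bias_mean]
  have t3 := lintegral_abs_const_mul_le (√n * ((n : ℝ) ^ 2)⁻¹) (hB.lintegral_abs_sum_le hν n)
  have t4 := lintegral_abs_const_mul_le_of_sq (√n * ((n : ℝ) ^ 2)⁻¹)
    (t := (b ^ 2)⁻¹ * C * (√D / √n)) (by positivity)
    e4 (by
      have : ((n : ℝ) ^ 2)⁻¹ ≤ (n : ℝ)⁻¹ := by gcongr; nlinarith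
      calc (√n * ((n : ℝ) ^ 2)⁻¹) ^ 2 * (n * ((b ^ 2)⁻¹ ^ 2 * C * (C * D))) =
          (b ^ 2)⁻¹ ^ 2 * C ^ 2 * D * ((n : ℝ) ^ 2)⁻¹ := by
            rw [mul_pow, hsn]; field_simp
        _ ≤ (b ^ 2)⁻¹ ^ 2 * C ^ 2 * D * (n : ℝ)⁻¹ := by gcongr
        _ = _ := by rw [mul_pow, div_pow, hsn, hsD]; field_simp)
  have t5 := lintegral_abs_const_mul_le_of_sq (√n * -((n : ℝ) ^ 2)⁻¹)
    (t := 3 * ((b ^ 2)⁻¹ * C) * (√D / √n)) (by positivity)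
    e5 (by
      calc (√n * -((n : ℝ) ^ 2)⁻¹) ^ 2 * (8 * n ^ 2 * ((b ^ 2)⁻¹ ^ 2 * C * (C * D))) =
          8 * ((b ^ 2)⁻¹ ^ 2 * C ^ 2 * (D / n)) := by
            rw [mul_pow, hsn]; field_simp
        _ ≤ 9 * ((b ^ 2)⁻¹ ^ 2 * C ^ 2 * (D / n)) := by gcongr; norm_num
        _ = _ := by rw [mul_pow, div_pow, hsn, hsD]; field_simp; norm_num)
  have hsum : ∀ x, √n * linearPart φ K h μ n x =
      √n * (n : ℝ)⁻¹ * (∑ i ∈ Finset.range n, (φ (x i) / smoothed K h μ (x i) -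
        ∫ z, φ z / smoothed K h μ z ^ 2 * scaledKernel K h (x i - z) ∂μ)) +
      (√n * ((∫ z, φ z / smoothed K h μ z ∂μ) - ∫ z, φ z) +
      (√n * ((n : ℝ) ^ 2)⁻¹ * (∑ i ∈ Finset.range n, weight φ K h μ 1 (x i)) +
      (√n * ((n : ℝ) ^ 2)⁻¹ * (∑ j ∈ Finset.range n,
        (∫ z, weight φ K h μ 2 z * centeredKernel K h μ z (x j) ∂μ)) +
      (√n * -((n : ℝ) ^ 2)⁻¹) * ∑ i ∈ Finset.range n, ∑ j ∈ (Finset.range n).erase i,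
        (weight φ K h μ 2 (x i) * centeredKernel K h μ (x i) (x j) -
          ∫ z, weight φ K h μ 2 z * centeredKernel K h μ z (x j) ∂μ)))) := fun x => by
    rw [hB.linearPart_eq hn]; ring
  simp_rw [hsum]
  have k3 : |√n * ((n : ℝ) ^ 2)⁻¹| * (n * (b⁻¹ * C)) ≤ b⁻¹ * C * (√D / √n) := by
    rw [abs_of_pos (by positivity)]
    have e0 : √n * (n : ℝ)⁻¹ = 1 / √n := by
      rw [← div_eq_mul_inv, div_eq_div_iff hn0.ne' hsn0.ne', ← sq, hsn, one_mul]
    calc √n * ((n : ℝ) ^ 2)⁻¹ * (n * (b⁻¹ * C)) = b⁻¹ * C * (√n * (n : ℝ)⁻¹) := by field_simp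
      _ = b⁻¹ * C * (1 / √n) := by rw [e0]
      _ ≤ _ := by gcongr
  refine (lintegral_abs_add_le ((hev _ hGm).const_mul _) (by positivity) (by positivity) t1
    (lintegral_abs_add_le measurable_const (by positivity) (by positivity) t2
    (lintegral_abs_add_le ((hev _ (hB.meas_weight 1)).const_mul _) (by positivity) (by positivity)
      t3 (lintegral_abs_add_le ((hev _ hpm).const_mul _) (by positivity) (by positivity)
      t4 t5)))).trans ?_
  refine ENNReal.ofReal_le_ofReal ?_
  have p1 : 0 ≤ h ^ s := by positivity
  have p2 : 0 ≤ √n * h ^ r := by positivity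
  have p3 : 0 ≤ √D / √n := by positivity
  have p4 : 0 ≤ b⁻¹ * C := by positivity
  have p5 : 0 ≤ (b ^ 2)⁻¹ * C := by positivity
  nlinarith [mul_nonneg p4 p1, mul_nonneg p4 p2, mul_nonneg p5 p1, mul_nonneg p5 p2,
    mul_nonneg hC p3]

theorem lintegral_abs_quadraticPart_le (hν : ResampleInvariant ν μ)
    (hB : KernelBounds φ K μ s r b C h) {n : ℕ} (hn : 1 ≤ n) :
    ∫⁻ x, ENNReal.ofReal |√n * quadraticPart φ K h μ n x| ∂ν ≤
      ENNReal.ofReal (6 * ((b ^ 3)⁻¹ * C ^ 3) * (√(h ^ d)⁻¹ / √n + (h ^ d)⁻¹ / n)) := by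
  have hb := hB.b_pos
  have hC1 := hB.one_le_C
  have hC := zero_le_one.trans hC1
  have hD1 := hB.one_le_inv_pow
  have e := hB.kernel.lintegral_sq_triple_sum_le hν (hB.meas_weight 3) (by positivity)
    (hB.lintegral_weight_sq 3) n
  set D := (h ^ d)⁻¹ with hD
  have hD0 : 0 < D := zero_lt_one.trans_le hD1
  have hn1 : (1 : ℝ) ≤ n := by exact_mod_cast hn
  have hn0 : (0 : ℝ) < n := zero_lt_one.trans_le hn1
  have hsn : √(n : ℝ) ^ 2 = n := Real.sq_sqrt hn0.le
  have hsn0 : 0 < √(n : ℝ) := Real.sqrt_pos.2 hn0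
  have hsD : √D ^ 2 = D := Real.sq_sqrt hD0.le
  have hsum : ∀ x, √n * quadraticPart φ K h μ n x = (√n * ((n : ℝ) ^ 3)⁻¹) *
      ∑ i ∈ Finset.range n, weight φ K h μ 3 (x i) * ((∑ j ∈ (Finset.range n).erase i,
        centeredKernel K h μ (x i) (x j)) ^ 2 - ∑ j ∈ (Finset.range n).erase i,
        centeredKernel K h μ (x i) (x j) ^ 2) := fun x => by
    rw [quadraticPart, mul_assoc]; rfl
  simp_rw [hsum]
  refine lintegral_abs_const_mul_le_of_sq (√n * ((n : ℝ) ^ 3)⁻¹) (by positivity) e ?_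
  have hCC : C ^ 3 ≤ C ^ 6 := pow_le_pow_right₀ hC1 (by norm_num)
  have hCC' : C ^ 5 ≤ C ^ 6 := pow_le_pow_right₀ hC1 (by norm_num)
  calc (√n * ((n : ℝ) ^ 3)⁻¹) ^ 2 * (n ^ 3 * (27 * ((b ^ 3)⁻¹ ^ 2 * C * (C * D) ^ 2)) +
        n ^ 4 * (2 * ((b ^ 3)⁻¹ ^ 2 * C * C ^ 4 * D)))
      = (b ^ 3)⁻¹ ^ 2 * (27 * C ^ 3 * (D / n) ^ 2 + 2 * C ^ 5 * (D / n)) := by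
        rw [mul_pow, hsn]; field_simp
    _ ≤ (b ^ 3)⁻¹ ^ 2 * (36 * C ^ 6 * (D / n) ^ 2 + 36 * C ^ 6 * (D / n)) := by
        gcongr <;> norm_num
    _ = (6 * ((b ^ 3)⁻¹ * C ^ 3)) ^ 2 * ((√D / √n) ^ 2 + (D / n) ^ 2) := by
        rw [div_pow √D, hsn, hsD]; ring
    _ ≤ (6 * ((b ^ 3)⁻¹ * C ^ 3)) ^ 2 * (√D / √n + D / n) ^ 2 := by
        gcongr
        have : 0 ≤ √D / √n * (D / n) := by positivity
        nlinarith
    _ = _ := by ring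

end KernelBounds

/-! ### The remainder of the expansion -/

section Expansion

variable {n θ a c C p S T δ v b : ℝ}

/-- In this section `a = |S| / (nθ)` and `c = T / (nθ)²` are the normalized deviations, and `1 + a +
c` is the common scale of all bounds. The assumption `1 ≤ n * θ` absorbs the term `p / n`. -/
theorem abs_dev_le (hn : 3 ≤ n) (hθ : 1 ≤ n * θ) (ha : 0 ≤ a) (hc : 0 ≤ c) (hC : 1 ≤ C)
    (hp : |p| ≤ C) (hS : |S| = n * θ * a) (hδ : δ = (S - p) / n) :
    |δ| ≤ C * θ * (1 + a + c) := by
  have hn0 : 0 < n := by linarith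
  have hθ0 : 0 < θ := by
    by_contra h
    have := mul_nonpos_of_nonneg_of_nonpos hn0.le (not_lt.1 h)
    linarith
  rw [hδ, abs_div, abs_of_pos hn0, div_le_iff₀ hn0]
  have h1 : |S - p| ≤ |S| + |p| := abs_sub _ _
  have h2 : C ≤ C * (n * θ) := le_mul_of_one_le_right (by linarith) hθ
  have h3 : n * θ * a ≤ C * (n * θ * a) := le_mul_of_one_le_left (by positivity) hC
  have h4 : 0 ≤ C * (n * θ * c) := by positivity
  calc |S - p| ≤ n * θ * a + C := by linarith
    _ ≤ C * (n * θ) + C * (n * θ * a) + C * (n * θ * c) := by linarith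
    _ = _ := by ring

theorem var_le (hn : 3 ≤ n) (hθ0 : 0 < θ) (ha : 0 ≤ a) (hc : 0 ≤ c) (hC : 1 ≤ C)
    (hS : |S| = n * θ * a) (hT : T = n ^ 2 * θ ^ 2 * c) (hδ : |δ| ≤ C * θ * (1 + a + c))
    (hv : v = ((n - 1) * (n - 2))⁻¹ * (T - 2 * δ * S + (n - 1) * δ ^ 2)) :
    v ≤ 18 * C ^ 2 * θ ^ 2 * (1 + a + c) ^ 2 := by
  have hn0 : 0 < n := by linarith
  set t := 1 + a + c with ht
  have ht1 : 1 ≤ t := by linarith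
  have hat : a ≤ t := by linarith
  have hct : c ≤ t ^ 2 := by nlinarith
  have hC2 : 1 ≤ C ^ 2 := one_le_pow₀ hC
  have hq : 0 < (n - 1) * (n - 2) := mul_pos (by linarith) (by linarith)
  -- Equality holds at `n = 3`. This constant turns the numerator bound `4` into `18`.
  have hqn : 2 / 9 * n ^ 2 ≤ (n - 1) * (n - 2) := by nlinarith
  rw [hv, inv_mul_le_iff₀ hq]
  have h1 : -(2 * δ * S) ≤ 2 * (C * θ * t) * (n * θ * t) := by
    calc -(2 * δ * S) ≤ |2 * δ * S| := neg_le_abs _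
      _ = 2 * |δ| * |S| := by rw [abs_mul, abs_mul]; simp
      _ ≤ _ := by rw [hS]; gcongr
  have h2 : δ ^ 2 ≤ (C * θ * t) ^ 2 := by rw [← sq_abs]; gcongr
  have h3 : (n - 1) * δ ^ 2 ≤ n * (C * θ * t) ^ 2 := by gcongr; linarith
  have h4 : T ≤ n ^ 2 * θ ^ 2 * (C ^ 2 * t ^ 2) := by
    rw [hT]; gcongr; nlinarith [sq_nonneg t]
  have h5 : C * (n * (θ ^ 2 * t ^ 2)) ≤ C ^ 2 * (n * (θ ^ 2 * t ^ 2)) := by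
    gcongr; nlinarith
  have h6 : n * (C ^ 2 * θ ^ 2 * t ^ 2) * 3 ≤ n * (C ^ 2 * θ ^ 2 * t ^ 2) * n := by gcongr
  calc T - 2 * δ * S + (n - 1) * δ ^ 2 ≤ 4 * C ^ 2 * θ ^ 2 * t ^ 2 * n ^ 2 := by nlinarith
    _ = 2 / 9 * n ^ 2 * (18 * C ^ 2 * θ ^ 2 * t ^ 2) := by ring
    _ ≤ _ := by gcongr

/-- To leading order `v` is the diagonal part `T / n²` of `S² / n²`. The errors come from the shift
by `p`, the mismatch between `n²` and `(n - 1)(n - 2)`, and the centering of `v` at the estimator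
instead of its mean; each is of order `θ / n`. -/
theorem abs_quadratic_error_le (hn : 3 ≤ n) (hθ : 1 ≤ n * θ) (hθ1 : θ ≤ 1) (ha : 0 ≤ a)
    (hc : 0 ≤ c) (hC : 1 ≤ C) (hp : |p| ≤ C) (hS : |S| = n * θ * a)
    (hT : T = n ^ 2 * θ ^ 2 * c) (hδ : δ = (S - p) / n)
    (hv : v = ((n - 1) * (n - 2))⁻¹ * (T - 2 * δ * S + (n - 1) * δ ^ 2)) :
    |δ ^ 2 - v - (S ^ 2 - T) / n ^ 2| ≤ 30 * C ^ 2 * (θ / n) * (1 + a + c) ^ 2 := by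
  have hn0 : 0 < n := by linarith
  have hθ0 : 0 < θ := by
    by_contra h
    have := mul_nonpos_of_nonneg_of_nonpos hn0.le (not_lt.1 h)
    linarith
  have hd := abs_dev_le hn hθ ha hc hC hp hS hδ
  set t := 1 + a + c with ht
  have ht1 : 1 ≤ t := by linarith
  have hat : a ≤ t := by linarith
  have htt : t ≤ t ^ 2 := by nlinarith
  have hct : c ≤ t ^ 2 := by nlinarith
  have hat2 : a ≤ t ^ 2 := by nlinarith
  have hC2 : 1 ≤ C ^ 2 := one_le_pow₀ hC
  have hCC : C ≤ C ^ 2 := by nlinarith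
  have hθθ : θ ^ 2 ≤ θ := by nlinarith
  have h1n : 1 ≤ n - 1 := by linarith
  have h2n : 1 ≤ n - 2 := by linarith
  have hq : 0 < (n - 1) * (n - 2) := mul_pos (by linarith) (by linarith)
  have hqn : 2 / 9 * n ^ 2 ≤ (n - 1) * (n - 2) := by nlinarith
  have e : δ ^ 2 - v - (S ^ 2 - T) / n ^ 2 = -(2 * p * S / n ^ 2) + p ^ 2 / n ^ 2 +
      (-(T * (3 * n - 2) / n ^ 2) + 2 * δ * S - (n - 1) * δ ^ 2) / ((n - 1) * (n - 2)) := by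
    have e1 : δ ^ 2 = S ^ 2 / n ^ 2 - 2 * p * S / n ^ 2 + p ^ 2 / n ^ 2 := by
      rw [hδ]; field_simp; ring
    have e2 : T / n ^ 2 - ((n - 1) * (n - 2))⁻¹ * T =
        -(T * (3 * n - 2) / n ^ 2) / ((n - 1) * (n - 2)) := by
      have : n - 1 ≠ 0 := by linarith
      have : n - 2 ≠ 0 := by linarith
      field_simp; ring
    rw [hv]
    calc _ = (δ ^ 2 - S ^ 2 / n ^ 2) + (T / n ^ 2 - ((n - 1) * (n - 2))⁻¹ * T) +
          (2 * δ * S - (n - 1) * δ ^ 2) / ((n - 1) * (n - 2)) := by ring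
      _ = _ := by rw [e2, e1]; ring
  have h1 : |2 * p * S / n ^ 2| ≤ 2 * C ^ 2 * (θ / n) * t ^ 2 := by
    rw [abs_div, abs_mul, abs_mul, hS, abs_of_pos (by positivity : (0 : ℝ) < 2),
      abs_of_pos (by positivity : 0 < n ^ 2)]
    calc 2 * |p| * (n * θ * a) / n ^ 2 = 2 * |p| * (θ / n) * a := by field_simp
      _ ≤ _ := by gcongr; exact hp.trans hCC
  have h2 : |p ^ 2 / n ^ 2| ≤ C ^ 2 * (θ / n) * t ^ 2 := by
    rw [abs_div, abs_of_pos (by positivity : 0 < n ^ 2), abs_pow]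
    calc |p| ^ 2 / n ^ 2 ≤ C ^ 2 * (n * θ) / n ^ 2 * 1 := by
          rw [mul_one]; gcongr
          exact (pow_le_pow_left₀ (abs_nonneg p) hp 2).trans
            (le_mul_of_one_le_right (sq_nonneg C) hθ)
      _ = C ^ 2 * (θ / n) * 1 := by field_simp
      _ ≤ _ := by gcongr; exact one_le_pow₀ ht1
  have h3 : |T * (3 * n - 2) / n ^ 2| ≤ 3 * n * (C ^ 2 * θ * t ^ 2) := by
    have : T * (3 * n - 2) / n ^ 2 = θ ^ 2 * c * (3 * n - 2) := by rw [hT]; field_simp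
    rw [this, abs_of_nonneg (mul_nonneg (by positivity) (by linarith))]
    calc θ ^ 2 * c * (3 * n - 2) ≤ θ * t ^ 2 * (3 * n) := by
          gcongr
          · linarith
          · linarith
      _ = 3 * n * (1 * θ * t ^ 2) := by ring
      _ ≤ _ := by gcongr
  have h4 : |2 * δ * S| ≤ 2 * n * (C ^ 2 * θ * t ^ 2) := by
    rw [abs_mul, abs_mul, hS, abs_of_pos (by positivity : (0 : ℝ) < 2)]
    calc 2 * |δ| * (n * θ * a) ≤ 2 * (C * θ * t) * (n * θ * t) := by gcongr
      _ = 2 * n * (C * θ ^ 2 * t ^ 2) := by ring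
      _ ≤ _ := by gcongr
  have h5 : |(n - 1) * δ ^ 2| ≤ n * (C ^ 2 * θ * t ^ 2) := by
    rw [abs_of_nonneg (mul_nonneg (by linarith) (sq_nonneg _)), ← sq_abs]
    calc (n - 1) * |δ| ^ 2 ≤ n * (C * θ * t) ^ 2 := by gcongr; linarith
      _ = n * (C ^ 2 * θ ^ 2 * t ^ 2) := by ring
      _ ≤ _ := by gcongr
  have h6 : |(-(T * (3 * n - 2) / n ^ 2) + 2 * δ * S - (n - 1) * δ ^ 2) /
      ((n - 1) * (n - 2))| ≤ 27 * C ^ 2 * (θ / n) * t ^ 2 := by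
    rw [abs_div, abs_of_pos hq, div_le_iff₀ hq]
    calc |-(T * (3 * n - 2) / n ^ 2) + 2 * δ * S - (n - 1) * δ ^ 2|
        ≤ |T * (3 * n - 2) / n ^ 2| + |2 * δ * S| + |(n - 1) * δ ^ 2| := by
          refine (abs_sub _ _).trans ?_
          gcongr
          refine (abs_add_le _ _).trans ?_
          rw [abs_neg]
      _ ≤ 6 * n * (C ^ 2 * θ * t ^ 2) := by linarith
      _ = 27 * C ^ 2 * (θ / n) * t ^ 2 * (2 / 9 * n ^ 2) := by field_simp; ring
      _ ≤ _ := by gcongr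
  rw [e]
  refine (abs_add_le _ _).trans ?_
  have h7 := abs_add_le (-(2 * p * S / n ^ 2)) (p ^ 2 / n ^ 2)
  rw [abs_neg] at h7
  linarith

theorem half_le_add (hp : b ≤ p) (hδ : |δ| ≤ b / 2) : b / 2 ≤ p + δ := by
  have := (abs_le.1 hδ).1
  linarith

theorem abs_inv_expansion_le (hb : 0 < b) (hp : b ≤ p) (hδ : |δ| ≤ b / 2) :
    |1 / (p + δ) - (1 / p - δ / p ^ 2)| ≤ 2 * (b ^ 3)⁻¹ * δ ^ 2 := by
  have h1 := half_le_add hp hδ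
  have hp0 : 0 < p := hb.trans_le hp
  have hq0 : 0 < p + δ := (half_pos hb).trans_le h1
  have e : 1 / (p + δ) - (1 / p - δ / p ^ 2) = δ ^ 2 / (p ^ 2 * (p + δ)) := by
    field_simp; ring
  rw [e, abs_of_nonneg (by positivity)]
  calc δ ^ 2 / (p ^ 2 * (p + δ)) ≤ δ ^ 2 / (b ^ 2 * (b / 2)) := by gcongr
    _ = _ := by field_simp

/-- The expansion is an exact identity. Replacing `v / (p + δ)³` by `v / p³` costs `v |δ|`, so the
second order term is `(δ² - v) / p³`, for which `W` is a substitute. The constant `14` is `8 + 4 +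
2`, from lower bounds `b / 2` for `p + δ`. -/
theorem abs_cor_expansion_le (hb : 0 < b) (hp : b ≤ p) (hδ : |δ| ≤ b / 2) (hv : 0 ≤ v) {W : ℝ} :
    |1 / (p + δ) * (1 - v / (p + δ) ^ 2) - (1 / p - δ / p ^ 2 + W / p ^ 3)| ≤
      (b ^ 4)⁻¹ * (2 * |δ| ^ 3 + 14 * (v * |δ|)) + (b ^ 3)⁻¹ * |δ ^ 2 - v - W| := by
  have h1 := half_le_add hp hδ
  have hp0 : 0 < p := hb.trans_le hp
  have hq0 : 0 < p + δ := (half_pos hb).trans_le h1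
  set q := p + δ with hq
  have e : 1 / q * (1 - v / q ^ 2) - (1 / p - δ / p ^ 2 + W / p ^ 3) =
      -(δ ^ 3 / (p ^ 3 * q)) + v * δ * (1 / (q ^ 3 * p) + 1 / (q ^ 2 * p ^ 2) + 1 / (q * p ^ 3)) +
        (δ ^ 2 - v - W) / p ^ 3 := by
    have : δ = q - p := by rw [hq]; ring
    rw [this]
    field_simp
    ring
  have h2 : |δ ^ 3 / (p ^ 3 * q)| ≤ 2 * (b ^ 4)⁻¹ * |δ| ^ 3 := by
    rw [abs_div, abs_pow, abs_of_pos (by positivity : 0 < p ^ 3 * q)]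
    calc |δ| ^ 3 / (p ^ 3 * q) ≤ |δ| ^ 3 / (b ^ 3 * (b / 2)) := by gcongr
      _ = _ := by field_simp
  have h3 : 1 / (q ^ 3 * p) + 1 / (q ^ 2 * p ^ 2) + 1 / (q * p ^ 3) ≤ 14 * (b ^ 4)⁻¹ := by
    calc _ ≤ 1 / ((b / 2) ^ 3 * b) + 1 / ((b / 2) ^ 2 * b ^ 2) + 1 / (b / 2 * b ^ 3) := by gcongr
      _ = _ := by field_simp; norm_num
  have h4 : |v * δ * (1 / (q ^ 3 * p) + 1 / (q ^ 2 * p ^ 2) + 1 / (q * p ^ 3))| ≤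
      v * |δ| * (14 * (b ^ 4)⁻¹) := by
    rw [abs_mul, abs_mul, abs_of_nonneg hv, abs_of_pos (by positivity :
      0 < 1 / (q ^ 3 * p) + 1 / (q ^ 2 * p ^ 2) + 1 / (q * p ^ 3))]
    gcongr
  have h5 : |(δ ^ 2 - v - W) / p ^ 3| ≤ (b ^ 3)⁻¹ * |δ ^ 2 - v - W| := by
    rw [abs_div, abs_of_pos (by positivity : 0 < p ^ 3), inv_mul_eq_div]
    gcongr
  rw [e]
  refine (abs_add_le _ _).trans ?_
  have h6 := abs_add_le (-(δ ^ 3 / (p ^ 3 * q)))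
    (v * δ * (1 / (q ^ 3 * p) + 1 / (q ^ 2 * p ^ 2) + 1 / (q * p ^ 3)))
  rw [abs_neg] at h6
  linarith

theorem one_add_pow_three_le_exp {y : ℝ} (hy : 0 ≤ y) :
    (1 + y) ^ 3 ≤ 6 * Real.exp 1 * Real.exp y := by
  have := Real.pow_div_factorial_le_exp (x := 1 + y) (by linarith) 3
  rw [Real.exp_add] at this
  norm_num [Nat.factorial] at this
  linarith

/-- The remainder of the first order expansion. -/
theorem abs_first_order_le (hn : 3 ≤ n) (hθ : 1 ≤ n * θ) (ha : 0 ≤ a)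
    (hc : 0 ≤ c) (hC : 1 ≤ C) (hp : |p| ≤ C) (hS : |S| = n * θ * a)
    (hδ : δ = (S - p) / n) (hb : 0 < b) (hbp : b ≤ p) (hδb : |δ| ≤ b / 2) :
    |1 / (p + δ) - (1 / p - δ / p ^ 2)| ≤
      12 * Real.exp 1 * C ^ 3 * (b ^ 3)⁻¹ * θ ^ 2 * Real.exp (a + c) := by
  have hd := abs_dev_le hn hθ ha hc hC hp hS hδ
  have he := one_add_pow_three_le_exp (add_nonneg ha hc)
  rw [← add_assoc] at he
  set t := 1 + a + c with ht
  have ht1 : 1 ≤ t := by linarith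
  refine (abs_inv_expansion_le hb hbp hδb).trans ?_
  calc 2 * (b ^ 3)⁻¹ * δ ^ 2 ≤ 2 * (b ^ 3)⁻¹ * (C * θ * t) ^ 2 := by
        rw [← sq_abs δ]; gcongr
    _ = 2 * (b ^ 3)⁻¹ * θ ^ 2 * (C ^ 2 * t ^ 2) := by ring
    _ ≤ 2 * (b ^ 3)⁻¹ * θ ^ 2 * (C ^ 3 * (6 * Real.exp 1 * Real.exp (a + c))) := by
        gcongr
        · norm_num
        · exact (pow_le_pow_right₀ ht1 (by norm_num)).trans he
    _ = _ := by ring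

/-- The remainder of the second order expansion. -/
theorem abs_second_order_le (hn : 3 ≤ n) (hθ : 1 ≤ n * θ) (hθ1 : θ ≤ 1) (ha : 0 ≤ a)
    (hc : 0 ≤ c) (hC : 1 ≤ C) (hp : |p| ≤ C) (hS : |S| = n * θ * a)
    (hT : T = n ^ 2 * θ ^ 2 * c) (hδ : δ = (S - p) / n)
    (hv : v = ((n - 1) * (n - 2))⁻¹ * (T - 2 * δ * S + (n - 1) * δ ^ 2)) (hv0 : 0 ≤ v)
    (hb : 0 < b) (hbp : b ≤ p) (hδb : |δ| ≤ b / 2) :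
    |1 / (p + δ) * (1 - v / (p + δ) ^ 2) -
      (1 / p - δ / p ^ 2 + (S ^ 2 - T) / n ^ 2 / p ^ 3)| ≤
      1800 * Real.exp 1 * C ^ 3 * ((b ^ 4)⁻¹ + (b ^ 3)⁻¹) * (θ ^ 3 + θ / n) * Real.exp (a + c) := by
  have hn0 : 0 < n := by linarith
  have hθ0 : 0 < θ := by
    by_contra h
    have := mul_nonpos_of_nonneg_of_nonpos hn0.le (not_lt.1 h)
    linarith
  have hd := abs_dev_le hn hθ ha hc hC hp hS hδ
  have hvl := var_le hn hθ0 ha hc hC hS hT hd hv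
  have hq := abs_quadratic_error_le hn hθ hθ1 ha hc hC hp hS hT hδ hv
  have he := one_add_pow_three_le_exp (add_nonneg ha hc)
  rw [← add_assoc] at he
  set t := 1 + a + c with ht
  have ht1 : 1 ≤ t := by linarith
  refine (abs_cor_expansion_le hb hbp hδb hv0).trans ?_
  calc _ ≤ (b ^ 4)⁻¹ * (2 * (C * θ * t) ^ 3 + 14 * (18 * C ^ 2 * θ ^ 2 * t ^ 2 * (C * θ * t))) +
        (b ^ 3)⁻¹ * (30 * C ^ 2 * (θ / n) * t ^ 2) := by gcongr
    _ ≤ (b ^ 4)⁻¹ * (300 * C ^ 3 * θ ^ 3 * t ^ 3) +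
        (b ^ 3)⁻¹ * (300 * C ^ 3 * (θ / n) * t ^ 3) := by
        gcongr
        · have : 0 ≤ C ^ 3 * θ ^ 3 * t ^ 3 := by positivity
          nlinarith
        · norm_num
        · norm_num
        · norm_num
    _ ≤ 300 * C ^ 3 * ((b ^ 4)⁻¹ + (b ^ 3)⁻¹) * (θ ^ 3 + θ / n) * t ^ 3 := by
        have h1 : 0 ≤ (b ^ 4)⁻¹ * (300 * C ^ 3 * (θ / n) * t ^ 3) := by positivity
        have h2 : 0 ≤ (b ^ 3)⁻¹ * (300 * C ^ 3 * θ ^ 3 * t ^ 3) := by positivity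
        linarith
    _ ≤ 300 * C ^ 3 * ((b ^ 4)⁻¹ + (b ^ 3)⁻¹) * (θ ^ 3 + θ / n) *
        (6 * Real.exp 1 * Real.exp (a + c)) := by gcongr
    _ = _ := by ring

end Expansion

/-- The estimator divides `n - 1` terms by `n`, which causes the shift by `-p / n`, and hence the
factor `1 + 1 / n` in the linear part. -/
theorem looDensity_eq {d : ℕ} (K : E d → ℝ) (h : ℝ) (μ : Measure (E d)) {n i : ℕ} (hi : i < n)
    (x : ℕ → E d) :
    looDensity K h n x i (x i) - smoothed K h μ (x i) =
      (devSum K h μ n x i - smoothed K h μ (x i)) / n := by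
  have hn0 : (n : ℝ) ≠ 0 := by
    have : 0 < n := by omega
    positivity
  have hcard : ((Finset.range n).erase i).card = n - 1 := by
    rw [Finset.card_erase_of_mem (Finset.mem_range.2 hi), Finset.card_range]
  have h1 : devSum K h μ n x i = (h ^ d)⁻¹ * ∑ j ∈ (Finset.range n).erase i, K (h⁻¹ • (x j - x i)) -
      ((n : ℝ) - 1) * smoothed K h μ (x i) := by
    simp only [devSum, centeredKernel, scaledKernel]
    rw [Finset.sum_sub_distrib, Finset.sum_const, hcard, nsmul_eq_mul, Finset.mul_sum,
      Nat.cast_sub (by omega), Nat.cast_one]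
  rw [h1, looDensity, mul_inv]
  field_simp
  ring

theorem looVar_eq {d : ℕ} {K : E d → ℝ} (hKs : ∀ x, K (-x) = K x) (h : ℝ) (μ : Measure (E d))
    {n i : ℕ} (hi : i < n) (x : ℕ → E d) :
    looVar K h n x i (x i) = (((n : ℝ) - 1) * ((n : ℝ) - 2))⁻¹ * (devSqSum K h μ n x i -
      2 * (looDensity K h n x i (x i) - smoothed K h μ (x i)) * devSum K h μ n x i +
        ((n : ℝ) - 1) * (looDensity K h n x i (x i) - smoothed K h μ (x i)) ^ 2) := by
  have hcard : ((Finset.range n).erase i).card = n - 1 := by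
    rw [Finset.card_erase_of_mem (Finset.mem_range.2 hi), Finset.card_range]
  rw [looVar]
  congr 1
  set q := looDensity K h n x i (x i)
  have h1 : ∀ j, ((h ^ d)⁻¹ * K (h⁻¹ • (x i - x j)) - q) ^ 2 =
      centeredKernel K h μ (x i) (x j) ^ 2 - 2 * (q - smoothed K h μ (x i)) *
        centeredKernel K h μ (x i) (x j) + (q - smoothed K h μ (x i)) ^ 2 := fun j => by
    have : (h ^ d)⁻¹ * K (h⁻¹ • (x i - x j)) =
        centeredKernel K h μ (x i) (x j) + smoothed K h μ (x i) := by
      rw [centeredKernel, sub_add_cancel, ← scaledKernel_neg hKs, neg_sub, scaledKernel]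
    rw [this]
    ring
  simp_rw [h1]
  rw [Finset.sum_add_distrib, Finset.sum_sub_distrib, ← Finset.mul_sum, Finset.sum_const, hcard,
    nsmul_eq_mul, Nat.cast_sub (by omega), Nat.cast_one]
  rfl

theorem looVar_nonneg {d : ℕ} (K : E d → ℝ) (h : ℝ) {n : ℕ} (hn : 3 ≤ n) (x : ℕ → E d) (i : ℕ)
    (y : E d) : 0 ≤ looVar K h n x i y := by
  have : (3 : ℝ) ≤ n := by exact_mod_cast hn
  exact mul_nonneg (inv_nonneg.2 (mul_nonneg (by linarith) (by linarith)))
    (Finset.sum_nonneg fun _ _ => sq_nonneg _)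

/-! ### Exponential control of the deviations and the good samples. -/

/-- The exponent controlling the fluctuations of the density estimator at `x i`. -/
def devExponent {d : ℕ} (K : E d → ℝ) (h : ℝ) (μ : Measure (E d)) (n : ℕ) (x : ℕ → E d) (i : ℕ) :
    ℝ :=
  √(h ^ d / n) * |devSum K h μ n x i| + √(h ^ d / n) ^ 2 * devSqSum K h μ n x i

/-- The weighted average of the exponential moments. -/
def expAvg {d : ℕ} (φ K : E d → ℝ) (h : ℝ) (μ : Measure (E d)) (n : ℕ) (x : ℕ → E d) : ℝ :=
  (n : ℝ)⁻¹ * ∑ i ∈ Finset.range n, |φ (x i)| * Real.exp (devExponent K h μ n x i)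

/-- The samples at which the density estimators are close to their means. -/
def goodSamples {d : ℕ} (φ K : E d → ℝ) (h : ℝ) (μ : Measure (E d)) (b : ℝ) (n : ℕ) :
    Set (ℕ → E d) :=
  {x | ∀ i < n, φ (x i) ≠ 0 →
    |looDensity K h n x i (x i) - smoothed K h μ (x i)| ≤ b / 2}

theorem devSqSum_nonneg {d : ℕ} (K : E d → ℝ) (h : ℝ) (μ : Measure (E d)) (n : ℕ) (x : ℕ → E d)
    (i : ℕ) : 0 ≤ devSqSum K h μ n x i := Finset.sum_nonneg fun _ _ => sq_nonneg _

namespace KernelBounds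

variable {d : ℕ} {φ K : E d → ℝ} {μ : Measure (E d)} {ν : Measure (ℕ → E d)} {s : ℝ} {r : ℕ}
  {b C h : ℝ}

/-- With `θ = √(D / n)`, the multiplier in the exponent is `1 / (nθ)`, and `nθ = √(nD)` is at least
`1`. -/
theorem scale_identities (hB : KernelBounds φ K μ s r b C h) {n : ℕ} (hn : 1 ≤ n) :
    n * √((h ^ d)⁻¹ / n) * √(h ^ d / n) = 1 ∧ 1 ≤ n * √((h ^ d)⁻¹ / n) := by
  have hD1 := hB.one_le_inv_pow
  have hp := pow_pos hB.h_pos d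
  have hn1 : (1 : ℝ) ≤ n := by exact_mod_cast hn
  have hn0 : (0 : ℝ) < n := zero_lt_one.trans_le hn1
  constructor
  · rw [mul_assoc, ← Real.sqrt_mul (by positivity)]
    have : (h ^ d)⁻¹ / n * (h ^ d / n) = (1 / (n : ℝ)) ^ 2 := by field_simp
    rw [this, Real.sqrt_sq (by positivity)]
    field_simp
  · rw [← div_le_iff₀' hn0]
    refine Real.le_sqrt_of_sq_le ?_
    rw [div_pow, one_pow, sq, ← div_div]
    gcongr
    calc 1 / (n : ℝ) ≤ 1 := by rw [div_le_one hn0]; exact hn1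
      _ ≤ _ := hD1

theorem abs_first_order_term_le (hB : KernelBounds φ K μ s r b C h) {n : ℕ} (hn : 3 ≤ n)
    {x : ℕ → E d} (hx : x ∈ goodSamples φ K h μ b n) {i : ℕ} (hi : i < n) :
    |φ (x i) / looDensity K h n x i (x i) - (weight φ K h μ 1 (x i) * (1 + (n : ℝ)⁻¹) -
      weight φ K h μ 2 (x i) * ((n : ℝ)⁻¹ * devSum K h μ n x i))| ≤
      12 * Real.exp 1 * C ^ 3 * (b ^ 3)⁻¹ * √((h ^ d)⁻¹ / n) ^ 2 *
        (|φ (x i)| * Real.exp (devExponent K h μ n x i)) := by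
  by_cases h0 : φ (x i) = 0
  · simp [h0, weight]
  have hn3 : (3 : ℝ) ≤ n := by exact_mod_cast hn
  have hn0 : (0 : ℝ) < n := by linarith
  obtain ⟨hθ, hθ1⟩ := hB.scale_identities (by omega : 1 ≤ n)
  have hlow := hB.lower _ h0
  have hp0 := hB.b_pos.trans_le hlow
  have hdev := looDensity_eq K h μ hi x
  set p := smoothed K h μ (x i) with hp
  set S := devSum K h μ n x i with hS
  set θ := √((h ^ d)⁻¹ / n) with hθd
  set l := √(h ^ d / n) with hl
  obtain ⟨δ, hδ⟩ : ∃ δ, looDensity K h n x i (x i) - p = δ := ⟨_, rfl⟩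
  have hq : looDensity K h n x i (x i) = p + δ := by rw [← hδ]; ring
  have hgood : |δ| ≤ b / 2 := by rw [← hδ]; exact hx i hi h0
  rw [hδ] at hdev
  have key := abs_first_order_le (a := l * |S|) (c := l ^ 2 * devSqSum K h μ n x i) hn3 hθ1
    (by positivity) (mul_nonneg (sq_nonneg _) (devSqSum_nonneg K h μ n x i)) hB.one_le_C
    (hB.upper (x i)) (S := S) (by rw [← mul_assoc, hθ, one_mul]) hdev hB.b_pos hlow hgood
  have e : φ (x i) / looDensity K h n x i (x i) - (weight φ K h μ 1 (x i) * (1 + (n : ℝ)⁻¹) -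
      weight φ K h μ 2 (x i) * ((n : ℝ)⁻¹ * S)) =
      φ (x i) * (1 / (p + δ) - (1 / p - δ / p ^ 2)) := by
    rw [hq, weight, weight, ← hp]
    have : (n : ℝ)⁻¹ * S = δ + (n : ℝ)⁻¹ * p := by rw [hdev]; field_simp; ring
    rw [this]
    field_simp
    ring
  rw [e, abs_mul, devExponent]
  calc _ ≤ |φ (x i)| * _ := mul_le_mul_of_nonneg_left key (abs_nonneg _)
    _ = _ := by ring

theorem abs_second_order_term_le (hB : KernelBounds φ K μ s r b C h) (hKs : ∀ x, K (-x) = K x)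
    {n : ℕ} (hn : 3 ≤ n) (hDn : (h ^ d)⁻¹ ≤ n)
    {x : ℕ → E d} (hx : x ∈ goodSamples φ K h μ b n) {i : ℕ} (hi : i < n) :
    |φ (x i) / looDensity K h n x i (x i) *
      (1 - looVar K h n x i (x i) / looDensity K h n x i (x i) ^ 2) -
      ((weight φ K h μ 1 (x i) * (1 + (n : ℝ)⁻¹) -
      weight φ K h μ 2 (x i) * ((n : ℝ)⁻¹ * devSum K h μ n x i)) +
      ((n : ℝ) ^ 2)⁻¹ * (weight φ K h μ 3 (x i) *
        (devSum K h μ n x i ^ 2 - devSqSum K h μ n x i)))| ≤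
      1800 * Real.exp 1 * C ^ 3 * ((b ^ 4)⁻¹ + (b ^ 3)⁻¹) *
        (√((h ^ d)⁻¹ / n) ^ 3 + √((h ^ d)⁻¹ / n) / n) *
        (|φ (x i)| * Real.exp (devExponent K h μ n x i)) := by
  by_cases h0 : φ (x i) = 0
  · simp [h0, weight]
  have hn3 : (3 : ℝ) ≤ n := by exact_mod_cast hn
  have hn0 : (0 : ℝ) < n := by linarith
  obtain ⟨hθ, hθ1⟩ := hB.scale_identities (by omega : 1 ≤ n)
  have hθle : √((h ^ d)⁻¹ / n) ≤ 1 := Real.sqrt_le_one.2 ((div_le_one hn0).2 hDn)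
  have hlow := hB.lower _ h0
  have hp0 := hB.b_pos.trans_le hlow
  have hdev := looDensity_eq K h μ hi x
  have hvar := looVar_eq hKs h μ hi x
  set p := smoothed K h μ (x i) with hp
  set S := devSum K h μ n x i with hS
  set T := devSqSum K h μ n x i with hT
  set θ := √((h ^ d)⁻¹ / n) with hθd
  set l := √(h ^ d / n) with hl
  obtain ⟨δ, hδ⟩ : ∃ δ, looDensity K h n x i (x i) - p = δ := ⟨_, rfl⟩
  have hq : looDensity K h n x i (x i) = p + δ := by rw [← hδ]; ring
  have hgood : |δ| ≤ b / 2 := by rw [← hδ]; exact hx i hi h0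
  rw [hδ] at hdev hvar
  have key := abs_second_order_le (a := l * |S|) (c := l ^ 2 * T) hn3 hθ1 hθle
    (by positivity) (mul_nonneg (sq_nonneg _) (devSqSum_nonneg K h μ n x i)) hB.one_le_C
    (hB.upper (x i)) (S := S) (by rw [← mul_assoc, hθ, one_mul]) (T := T)
    (by rw [← mul_assoc, ← mul_pow, ← mul_pow, hθ, one_pow, one_mul]) hdev hvar
    (looVar_nonneg K h hn x i _) hB.b_pos hlow hgood
  have e : φ (x i) / looDensity K h n x i (x i) *
      (1 - looVar K h n x i (x i) / looDensity K h n x i (x i) ^ 2) -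
      ((weight φ K h μ 1 (x i) * (1 + (n : ℝ)⁻¹) - weight φ K h μ 2 (x i) * ((n : ℝ)⁻¹ * S)) +
      ((n : ℝ) ^ 2)⁻¹ * (weight φ K h μ 3 (x i) * (S ^ 2 - T))) =
      φ (x i) * (1 / (p + δ) * (1 - looVar K h n x i (x i) / (p + δ) ^ 2) -
      (1 / p - δ / p ^ 2 + (S ^ 2 - T) / n ^ 2 / p ^ 3)) := by
    have : (n : ℝ)⁻¹ * S = δ + (n : ℝ)⁻¹ * p := by rw [hdev]; field_simp; ring
    rw [hq, weight, weight, weight, ← hp, this]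
    have e1 : φ (x i) / p ^ 1 * (1 + (n : ℝ)⁻¹) - φ (x i) / p ^ 2 * (δ + (n : ℝ)⁻¹ * p) =
        φ (x i) * (1 / p - δ / p ^ 2) := by field_simp; ring
    rw [e1]
    ring
  rw [e, abs_mul, devExponent]
  calc _ ≤ |φ (x i)| * _ := mul_le_mul_of_nonneg_left key (abs_nonneg _)
    _ = _ := by ring

theorem abs_estimator_sub_le (hB : KernelBounds φ K μ s r b C h) {n : ℕ} (hn : 3 ≤ n)
    {x : ℕ → E d} (hx : x ∈ goodSamples φ K h μ b n) :
    |√n * (estimator φ K h n x - ∫ z, φ z)| ≤ |√n * linearPart φ K h μ n x| +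
      √n * (12 * Real.exp 1 * C ^ 3 * (b ^ 3)⁻¹ * √((h ^ d)⁻¹ / n) ^ 2) * expAvg φ K h μ n x := by
  have e : estimator φ K h n x - ∫ z, φ z = linearPart φ K h μ n x + (n : ℝ)⁻¹ *
      ∑ i ∈ Finset.range n, (φ (x i) / looDensity K h n x i (x i) -
        (weight φ K h μ 1 (x i) * (1 + (n : ℝ)⁻¹) -
        weight φ K h μ 2 (x i) * ((n : ℝ)⁻¹ * devSum K h μ n x i))) := by
    rw [Finset.sum_sub_distrib, estimator, linearPart]
    ring
  rw [e, mul_add]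
  refine (abs_add_le _ _).trans ?_
  gcongr
  rw [abs_mul, abs_of_nonneg (Real.sqrt_nonneg _), mul_assoc]
  gcongr
  rw [expAvg, abs_mul, abs_of_nonneg (by positivity : 0 ≤ (n : ℝ)⁻¹), mul_left_comm]
  gcongr
  refine (Finset.abs_sum_le_sum_abs _ _).trans ?_
  rw [Finset.mul_sum]
  exact Finset.sum_le_sum fun i hi => hB.abs_first_order_term_le hn hx (Finset.mem_range.1 hi)

theorem abs_corEstimator_sub_le (hB : KernelBounds φ K μ s r b C h) (hKs : ∀ x, K (-x) = K x)
    {n : ℕ} (hn : 3 ≤ n) (hDn : (h ^ d)⁻¹ ≤ n) {x : ℕ → E d}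
    (hx : x ∈ goodSamples φ K h μ b n) :
    |√n * (corEstimator φ K h n x - ∫ z, φ z)| ≤
      |√n * linearPart φ K h μ n x + √n * quadraticPart φ K h μ n x| +
      √n * (1800 * Real.exp 1 * C ^ 3 * ((b ^ 4)⁻¹ + (b ^ 3)⁻¹) *
        (√((h ^ d)⁻¹ / n) ^ 3 + √((h ^ d)⁻¹ / n) / n)) * expAvg φ K h μ n x := by
  have hb := hB.b_pos
  have hC := zero_le_one.trans hB.one_le_C
  have e : corEstimator φ K h n x - ∫ z, φ z =
      linearPart φ K h μ n x + quadraticPart φ K h μ n x + (n : ℝ)⁻¹ *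
      ∑ i ∈ Finset.range n, (φ (x i) / looDensity K h n x i (x i) *
        (1 - looVar K h n x i (x i) / looDensity K h n x i (x i) ^ 2) -
        ((weight φ K h μ 1 (x i) * (1 + (n : ℝ)⁻¹) -
        weight φ K h μ 2 (x i) * ((n : ℝ)⁻¹ * devSum K h μ n x i)) +
        ((n : ℝ) ^ 2)⁻¹ * (weight φ K h μ 3 (x i) *
          (devSum K h μ n x i ^ 2 - devSqSum K h μ n x i)))) := by
    rw [Finset.sum_sub_distrib, Finset.sum_add_distrib, corEstimator, linearPart, quadraticPart,
      ← Finset.mul_sum]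
    have : ((n : ℝ) ^ 3)⁻¹ = (n : ℝ)⁻¹ * ((n : ℝ) ^ 2)⁻¹ := by
      rw [← mul_inv]; congr 1; ring
    rw [this]
    ring
  rw [e, mul_add, mul_add]
  refine (abs_add_le _ _).trans ?_
  gcongr
  rw [abs_mul, abs_of_nonneg (Real.sqrt_nonneg _), mul_assoc]
  gcongr
  rw [expAvg, abs_mul, abs_of_nonneg (by positivity : 0 ≤ (n : ℝ)⁻¹), mul_left_comm]
  gcongr
  refine (Finset.abs_sum_le_sum_abs _ _).trans ?_
  rw [Finset.mul_sum]
  exact Finset.sum_le_sum fun i hi =>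
    hB.abs_second_order_term_le hKs hn hDn hx (Finset.mem_range.1 hi)

theorem meas_exp_devExponent (hB : KernelBounds φ K μ s r b C h) (n i : ℕ) :
    Measurable fun x => Real.exp (devExponent K h μ n x i) :=
  ((((hB.meas_devSum n i).abs.const_mul _).add ((hB.meas_devSqSum n i).const_mul _))).exp

theorem meas_expAvg (hB : KernelBounds φ K μ s r b C h) (n : ℕ) :
    Measurable (expAvg φ K h μ n) :=
  (Finset.measurable_fun_sum _ fun i _ => (hB.meas_phi.comp (measurable_pi_apply i)).abs.mul
    (hB.meas_exp_devExponent n i)).const_mul _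

variable [IsProbabilityMeasure μ] [IsProbabilityMeasure ν]

/-- With `lam ^ 2 = h ^ d / n` the total exponent `7 n lam² C D` equals `7 C`, whatever `n` and `h`;
the smallness condition `lam C D ≤ 1` becomes `C² D ≤ n`. -/
theorem lintegral_mul_exp_devExponent_le (hν : ResampleInvariant ν μ)
    (hB : KernelBounds φ K μ s r b C h) {n : ℕ} (hn : 1 ≤ n) (hDn : C ^ 2 * (h ^ d)⁻¹ ≤ n)
    {w : E d → ENNReal} (hw : Measurable w) (i : ℕ) :
    ∫⁻ x, w (x i) * ENNReal.ofReal (Real.exp (devExponent K h μ n x i)) ∂ν ≤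
      ENNReal.ofReal (2 * Real.exp (7 * C)) * ∫⁻ y, w y ∂μ := by
  have hp := pow_pos hB.h_pos d
  have hC := zero_le_one.trans hB.one_le_C
  have hn0 : (0 : ℝ) < n := by positivity
  refine hB.kernel.lintegral_mul_exp_le hν (Real.sqrt_nonneg _) ?_ ?_ hw i
  · rw [← abs_of_nonneg (by positivity : 0 ≤ √(h ^ d / n) * (C * (h ^ d)⁻¹)),
      ← sq_le_one_iff_abs_le_one, mul_pow, Real.sq_sqrt (by positivity)]
    have : h ^ d / n * (C * (h ^ d)⁻¹) ^ 2 = C ^ 2 * (h ^ d)⁻¹ / n := by field_simp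
    rw [this, div_le_one hn0]
    exact hDn
  · rw [Real.sq_sqrt (by positivity)]
    refine le_of_eq ?_
    field_simp

theorem lintegral_abs_expAvg_le (hν : ResampleInvariant ν μ)
    (hB : KernelBounds φ K μ s r b C h) {n : ℕ} (hn : 1 ≤ n) (hDn : C ^ 2 * (h ^ d)⁻¹ ≤ n) :
    ∫⁻ x, ENNReal.ofReal |expAvg φ K h μ n x| ∂ν ≤ ENNReal.ofReal (2 * Real.exp (7 * C) * C) := by
  have hn0 : (0 : ℝ) < n := by positivity
  have h1 : ∀ i, ∫⁻ x, ENNReal.ofReal |(|φ (x i)| * Real.exp (devExponent K h μ n x i))| ∂ν ≤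
      ENNReal.ofReal (2 * Real.exp (7 * C) * C) := fun i => by
    rw [ENNReal.ofReal_mul (by positivity)]
    refine le_trans ?_ (mul_le_mul_right hB.phi_abs _)
    refine le_trans (le_of_eq ?_) (hB.lintegral_mul_exp_devExponent_le hν hn hDn
      (w := fun y => ENNReal.ofReal |φ y|) hB.meas_phi.abs.ennreal_ofReal i)
    refine lintegral_congr fun x => ?_
    rw [abs_of_nonneg (by positivity), ENNReal.ofReal_mul (abs_nonneg _)]
  have hm : ∀ i, Measurable fun x => |φ (x i)| * Real.exp (devExponent K h μ n x i) := fun i =>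
    (hB.meas_phi.comp (measurable_pi_apply i)).abs.mul (hB.meas_exp_devExponent n i)
  have h2 : ∫⁻ x, ENNReal.ofReal |∑ i ∈ Finset.range n, |φ (x i)| *
      Real.exp (devExponent K h μ n x i)| ∂ν ≤
      ENNReal.ofReal (n * (2 * Real.exp (7 * C) * C)) := by
    calc _ ≤ ∫⁻ x, ∑ i ∈ Finset.range n,
          ENNReal.ofReal |(|φ (x i)| * Real.exp (devExponent K h μ n x i))| ∂ν := by
          refine lintegral_mono fun x => ?_
          rw [← ENNReal.ofReal_sum_of_nonneg fun _ _ => abs_nonneg _]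
          exact ENNReal.ofReal_le_ofReal (Finset.abs_sum_le_sum_abs _ _)
      _ = ∑ i ∈ Finset.range n, ∫⁻ x,
          ENNReal.ofReal |(|φ (x i)| * Real.exp (devExponent K h μ n x i))| ∂ν :=
          lintegral_finsetSum _ fun i _ => (hm i).abs.ennreal_ofReal
      _ ≤ ∑ i ∈ Finset.range n, ENNReal.ofReal (2 * Real.exp (7 * C) * C) :=
          Finset.sum_le_sum fun i _ => h1 i
      _ = _ := by
          rw [Finset.sum_const, Finset.card_range, nsmul_eq_mul,
            ENNReal.ofReal_mul (Nat.cast_nonneg n), ENNReal.ofReal_natCast]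
  refine (lintegral_abs_const_mul_le (n : ℝ)⁻¹ h2).trans (ENNReal.ofReal_le_ofReal (le_of_eq ?_))
  rw [abs_of_pos (by positivity)]
  field_simp

/-- On a bad sample some `i` with `φ (x i) ≠ 0` has an exponent `Y` with `θ (1 + Y) ≥ b / (2C)`, so
`exp Y` is at least a multiple of `n²`. Markov's inequality gives `O(n⁻²)` for each `i`, and the
union bound gives `O(1 / n)`. -/
theorem measure_compl_goodSamples_le (hν : ResampleInvariant ν μ)
    (hB : KernelBounds φ K μ s r b C h) {n : ℕ} (hn : 3 ≤ n) (hDn : C ^ 2 * (h ^ d)⁻¹ ≤ n)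
    (hDn' : (h ^ d)⁻¹ ^ 3 ≤ (n : ℝ) ^ 2) :
    ν (goodSamples φ K h μ b n)ᶜ ≤ ENNReal.ofReal
      (2 * Real.exp (7 * C) * Real.exp 1 * Nat.factorial 12 * (2 * C / b) ^ 12 / n) := by
  have hb := hB.b_pos
  have hC0 : 0 < C := zero_lt_one.trans_le hB.one_le_C
  have hp := pow_pos hB.h_pos d
  have hn3 : (3 : ℝ) ≤ n := by exact_mod_cast hn
  have hn0 : (0 : ℝ) < n := by linarith
  obtain ⟨F, hF⟩ : ∃ F : ℝ, F = (Nat.factorial 12 : ℝ) := ⟨_, rfl⟩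
  have hF0 : 0 < F := by rw [hF]; positivity
  rw [← hF]
  set κ : ℝ := F⁻¹ * (b / (2 * C)) ^ 12 * (Real.exp 1)⁻¹ with hκ
  have hκ0 : 0 < κ := by positivity
  set w : E d → ENNReal := Set.indicator {y | φ y ≠ 0} 1 with hw
  have hws : MeasurableSet {y | φ y ≠ 0} := (hB.meas_phi (measurableSet_singleton 0)).compl
  have hwm : Measurable w := measurable_one.indicator hws
  have hsub : (goodSamples φ K h μ b n)ᶜ ⊆ ⋃ i ∈ Finset.range n,
      {x | ENNReal.ofReal (κ * n ^ 2) ≤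
        w (x i) * ENNReal.ofReal (Real.exp (devExponent K h μ n x i))} := by
    intro x hx
    simp only [goodSamples, Set.mem_compl_iff, Set.mem_ofPred_eq, not_forall, not_le] at hx
    obtain ⟨i, hi, h0, hx⟩ := hx
    simp only [Set.mem_iUnion, Finset.mem_range, Set.mem_ofPred_eq]
    refine ⟨i, hi, ?_⟩
    rw [hw, Set.indicator_of_mem (by exact h0), Pi.one_apply, one_mul]
    refine ENNReal.ofReal_le_ofReal ?_
    obtain ⟨hθ, hθ1⟩ := hB.scale_identities (by omega : 1 ≤ n)
    have hc : 0 ≤ √(h ^ d / n) ^ 2 * devSqSum K h μ n x i :=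
      mul_nonneg (sq_nonneg _) (devSqSum_nonneg K h μ n x i)
    have hd := abs_dev_le hn3 hθ1 (a := √(h ^ d / n) * |devSum K h μ n x i|)
      (c := √(h ^ d / n) ^ 2 * devSqSum K h μ n x i) (by positivity) hc hB.one_le_C
      (hB.upper (x i)) (S := devSum K h μ n x i) (by rw [← mul_assoc, hθ, one_mul])
      (looDensity_eq K h μ hi x)
    rw [add_assoc] at hd
    change _ ≤ _ * (1 + devExponent K h μ n x i) at hd
    have hY : 0 ≤ devExponent K h μ n x i := add_nonneg (by positivity) hc
    set Y := devExponent K h μ n x i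
    set θ := √((h ^ d)⁻¹ / n) with hθd
    have hθ0 : 0 < θ := Real.sqrt_pos.2 (by positivity)
    have h1 : b / (2 * C) ≤ θ * (1 + Y) := by
      rw [div_le_iff₀ (by positivity)]
      linarith
    -- The power `12` is chosen so that `θ ^ 12 = D⁶ / n⁶`, which `D³ ≤ n²` bounds by `n⁻²`: one
    -- power of `n` more than the union bound consumes.
    have h2 : θ ^ 12 * (n : ℝ) ^ 2 ≤ 1 := by
      have e : θ ^ 12 = ((h ^ d)⁻¹ ^ 3) ^ 2 / (n : ℝ) ^ 6 := by
        calc θ ^ 12 = (θ ^ 2) ^ 6 := by ring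
          _ = _ := by rw [Real.sq_sqrt (by positivity)]; ring
      rw [e, div_mul_eq_mul_div, div_le_one (by positivity)]
      calc ((h ^ d)⁻¹ ^ 3) ^ 2 * (n : ℝ) ^ 2 ≤ ((n : ℝ) ^ 2) ^ 2 * (n : ℝ) ^ 2 := by gcongr
        _ = _ := by ring
    have h3 := Real.pow_div_factorial_le_exp (x := 1 + Y) (by linarith) 12
    rw [Real.exp_add, ← hF] at h3
    calc κ * n ^ 2 = F⁻¹ * (Real.exp 1)⁻¹ * ((b / (2 * C)) ^ 12 * n ^ 2) := by
          rw [hκ]; ring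
      _ ≤ F⁻¹ * (Real.exp 1)⁻¹ * ((θ * (1 + Y)) ^ 12 * n ^ 2) := by gcongr
      _ = (Real.exp 1)⁻¹ * ((θ ^ 12 * n ^ 2) * ((1 + Y) ^ 12 / F)) := by
        rw [mul_pow]
        generalize (1 + Y) ^ 12 = u
        ring
      _ ≤ (Real.exp 1)⁻¹ * (1 * (Real.exp 1 * Real.exp Y)) := by gcongr
      _ = _ := by
        rw [one_mul, inv_mul_cancel_left₀ (Real.exp_pos 1).ne']
  have hone : ∀ i, ν {x | ENNReal.ofReal (κ * n ^ 2) ≤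
        w (x i) * ENNReal.ofReal (Real.exp (devExponent K h μ n x i))} ≤
      ENNReal.ofReal (2 * Real.exp (7 * C) / (κ * n ^ 2)) := fun i => by
    refine (meas_ge_le_lintegral_div ((hwm.comp (measurable_pi_apply i)).mul
      (hB.meas_exp_devExponent n i).ennreal_ofReal).aemeasurable
      (by simp only [ne_eq, ENNReal.ofReal_eq_zero, not_le]; positivity)
      ENNReal.ofReal_ne_top).trans ?_
    rw [ENNReal.ofReal_div_of_pos (by positivity)]
    gcongr
    refine (hB.lintegral_mul_exp_devExponent_le hν (by omega) hDn hwm i).trans ?_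
    refine mul_le_of_le_one_right' ?_
    rw [hw, lintegral_indicator_one hws]
    exact prob_le_one
  calc _ ≤ _ := measure_mono hsub
    _ ≤ ∑ i ∈ Finset.range n, ν {x | ENNReal.ofReal (κ * n ^ 2) ≤
        w (x i) * ENNReal.ofReal (Real.exp (devExponent K h μ n x i))} :=
      measure_biUnion_finset_le _ _
    _ ≤ ∑ i ∈ Finset.range n, ENNReal.ofReal (2 * Real.exp (7 * C) / (κ * n ^ 2)) :=
      Finset.sum_le_sum fun i _ => hone i
    _ = _ := by
      rw [Finset.sum_const, Finset.card_range, nsmul_eq_mul, ← ENNReal.ofReal_natCast,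
        ← ENNReal.ofReal_mul (Nat.cast_nonneg n)]
      congr 1
      rw [hκ]
      field_simp

end KernelBounds

/-! ### Rates in probability -/

/-- The exceptional sets get at most `ε / 2` for large `n`, and Markov's inequality for the majorant
`Y` gives the other half. Only the majorant has to be measurable. -/
theorem IsBigOP.of_eventually {Ω : Type*} [MeasurableSpace Ω] {P : Measure Ω} {Z : ℕ → Ω → ℝ}
    {a : ℕ → ℝ} (ha : ∀ᶠ n in atTop, 0 < a n) {A : ℝ} (hA : 0 ≤ A)
    (h : ∀ᶠ n : ℕ in atTop, ∃ (B : Set Ω) (Y : Ω → ℝ), Measurable Y ∧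
      P B ≤ ENNReal.ofReal (A / n) ∧ ∫⁻ ω, ENNReal.ofReal |Y ω| ∂P ≤ ENNReal.ofReal (A * a n) ∧
      ∀ ω ∉ B, |Z n ω| ≤ |Y ω|) : IsBigOP P Z a := by
  intro ε hε
  refine ⟨2 * (A + 1) / ε, ?_⟩
  filter_upwards [ha, h, eventually_ge_atTop (⌈2 * (A + 1) / ε⌉₊)]
    with n h1 ⟨B, Y, hY, hB, hYl, hZ⟩ h3
  have hq : 0 < 2 * (A + 1) / ε := by positivity
  have hn : 2 * (A + 1) / ε ≤ n := (Nat.le_ceil _).trans (by exact_mod_cast h3)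
  have hn0 : (0 : ℝ) < n := hq.trans_le hn
  rw [abs_of_pos h1]
  set t : ℝ := 2 * (A + 1) / ε * a n with ht
  have ht0 : 0 < t := by positivity
  calc P {ω | t < |Z n ω|} ≤ P (B ∪ {ω | ENNReal.ofReal t ≤ ENNReal.ofReal |Y ω|}) := by
        refine measure_mono fun ω hω => ?_
        by_cases hωB : ω ∈ B
        · exact Or.inl hωB
        · exact Or.inr (ENNReal.ofReal_le_ofReal ((le_of_lt hω).trans (hZ ω hωB)))
    _ ≤ P B + P {ω | ENNReal.ofReal t ≤ ENNReal.ofReal |Y ω|} := measure_union_le _ _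
    _ ≤ ENNReal.ofReal (ε / 2) + ENNReal.ofReal (ε / 2) := by
        refine add_le_add (hB.trans (ENNReal.ofReal_le_ofReal ?_)) ?_
        · rw [div_le_iff₀ hn0]
          rw [div_le_iff₀ hε] at hn
          linarith
        · refine (meas_ge_le_lintegral_div hY.abs.ennreal_ofReal.aemeasurable (by simpa using ht0)
            ENNReal.ofReal_ne_top).trans ?_
          refine (ENNReal.div_le_div_right hYl _).trans ?_
          rw [← ENNReal.ofReal_div_of_pos ht0]
          refine ENNReal.ofReal_le_ofReal ?_
          rw [div_le_iff₀ ht0]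
          calc A * a n ≤ (A + 1) * a n := by gcongr; linarith
            _ = _ := by rw [ht]; field_simp
    _ = ENNReal.ofReal ε := by
        rw [← ENNReal.ofReal_add (by positivity) (by positivity)]; congr 1; ring

theorem IsBigOP.comp_map {Ω S : Type*} [MeasurableSpace Ω] [MeasurableSpace S] {P : Measure Ω}
    {Y : Ω → S} (hY : Measurable Y) {Z : ℕ → S → ℝ} {a : ℕ → ℝ} (h : IsBigOP (P.map Y) Z a) :
    IsBigOP P (fun n ω => Z n (Y ω)) a := fun ε hε => by
  obtain ⟨M, hM⟩ := h ε hε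
  exact ⟨M, hM.mono fun n hn => (Measure.le_map_apply hY.aemeasurable _).trans hn⟩

theorem lintegral_abs_abs_add_le {Ω : Type*} [MeasurableSpace Ω] {P : Measure Ω} {F G : Ω → ℝ}
    (hF : Measurable F) {a b : ℝ} (ha : 0 ≤ a) (hb : 0 ≤ b)
    (h1 : ∫⁻ ω, ENNReal.ofReal |F ω| ∂P ≤ ENNReal.ofReal a)
    (h2 : ∫⁻ ω, ENNReal.ofReal |G ω| ∂P ≤ ENNReal.ofReal b) :
    ∫⁻ ω, ENNReal.ofReal |(|F ω| + G ω)| ∂P ≤ ENNReal.ofReal (a + b) :=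
  lintegral_abs_add_le (F := fun ω => |F ω|) hF.abs ha hb (by simpa only [abs_abs] using h1) h2

namespace KernelBounds

variable {d : ℕ} {φ K : E d → ℝ} {μ : Measure (E d)} {ν : Measure (ℕ → E d)} {s : ℝ} {r : ℕ}
  {b C h : ℝ} [IsProbabilityMeasure μ] [IsProbabilityMeasure ν]

/-- The constant bounding the probability of a bad sample and the mean of the remainders. -/
def riskConst (b C : ℝ) : ℝ :=
  2 * Real.exp (7 * C) * Real.exp 1 * Nat.factorial 12 * (2 * C / b) ^ 12 +
    ((C + b⁻¹ * C + 4 * ((b ^ 2)⁻¹ * C)) + 6 * ((b ^ 3)⁻¹ * C ^ 3) +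
    (12 * Real.exp 1 * C ^ 3 * (b ^ 3)⁻¹) * (2 * Real.exp (7 * C) * C) +
    2 * (1800 * Real.exp 1 * C ^ 3 * ((b ^ 4)⁻¹ + (b ^ 3)⁻¹)) * (2 * Real.exp (7 * C) * C))

/-- The quadratic remainder has size `√n θ² = D / √n`, which dominates the `√D / √n` of the linear
part since `D ≥ 1`. -/
theorem exists_estimator_bound (hν : ResampleInvariant ν μ) (hB : KernelBounds φ K μ s r b C h)
    {n : ℕ} (hn : 3 ≤ n) (hDn : C ^ 2 * (h ^ d)⁻¹ ≤ n) (hDn' : (h ^ d)⁻¹ ^ 3 ≤ (n : ℝ) ^ 2) :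
    ∃ (B : Set (ℕ → E d)) (Y : (ℕ → E d) → ℝ), Measurable Y ∧
      ν B ≤ ENNReal.ofReal (riskConst b C / n) ∧
      ∫⁻ x, ENNReal.ofReal |Y x| ∂ν ≤
        ENNReal.ofReal (riskConst b C * (h ^ s + √n * h ^ r + (h ^ d)⁻¹ / √n)) ∧
      ∀ x ∉ B, |√n * (estimator φ K h n x - ∫ z, φ z)| ≤ |Y x| := by
  have hb := hB.b_pos
  have hC := zero_lt_one.trans_le hB.one_le_C
  have h0 := hB.h_pos
  have hD1 := hB.one_le_inv_pow
  have hbad := hB.measure_compl_goodSamples_le hν hn hDn hDn'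
  have hlin := hB.lintegral_abs_linearPart_le hν (n := n) (by omega)
  have hexp := hB.lintegral_abs_expAvg_le hν (n := n) (by omega) hDn
  have hmain := fun x hx => hB.abs_estimator_sub_le hn (x := x) hx
  set D := (h ^ d)⁻¹ with hD
  have hD0 : 0 < D := zero_lt_one.trans_le hD1
  have hn0 : (0 : ℝ) < n := by positivity
  have hsn0 : 0 < √(n : ℝ) := Real.sqrt_pos.2 hn0
  have hsn : √(n : ℝ) ^ 2 = n := Real.sq_sqrt hn0.le
  have hsD : √D ≤ D := by
    rw [Real.sqrt_le_left hD0.le]; nlinarith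
  set k := √n * (12 * Real.exp 1 * C ^ 3 * (b ^ 3)⁻¹ * √(D / n) ^ 2) with hk
  have hk0 : 0 ≤ k := by positivity
  have hkD : k = 12 * Real.exp 1 * C ^ 3 * (b ^ 3)⁻¹ * (D / √n) := by
    have : √(n : ℝ) * √(D / n) ^ 2 = D / √n := by
      rw [Real.sq_sqrt (by positivity), eq_div_iff hsn0.ne']
      calc √(n : ℝ) * (D / n) * √n = D / n * √(n : ℝ) ^ 2 := by ring
        _ = D := by rw [hsn]; field_simp
    rw [← this, hk]; ring
  refine ⟨(goodSamples φ K h μ b n)ᶜ, fun x => |√n * linearPart φ K h μ n x| +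
    k * expAvg φ K h μ n x, ?_, ?_, ?_, fun x hx => ?_⟩
  · exact ((hB.meas_linearPart n).const_mul _).abs.add ((hB.meas_expAvg n).const_mul _)
  · refine hbad.trans (ENNReal.ofReal_le_ofReal ?_)
    gcongr
    exact le_add_of_nonneg_right (by positivity)
  · refine (lintegral_abs_abs_add_le ((hB.meas_linearPart n).const_mul _) (by positivity)
      (by positivity) hlin (lintegral_abs_const_mul_le k hexp)).trans
      (ENNReal.ofReal_le_ofReal ?_)
    rw [abs_of_nonneg hk0, hkD]
    set ρ := h ^ s + √n * h ^ r + D / √n with hρ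
    have h1 : h ^ s + √n * h ^ r + √D / √n ≤ ρ := by rw [hρ]; gcongr
    have h2 : D / √n ≤ ρ := by
      rw [hρ]; exact le_add_of_nonneg_left (by positivity)
    have hρ0 : 0 ≤ ρ := by positivity
    calc _ ≤ (C + b⁻¹ * C + 4 * ((b ^ 2)⁻¹ * C)) * ρ +
          12 * Real.exp 1 * C ^ 3 * (b ^ 3)⁻¹ * ρ * (2 * Real.exp (7 * C) * C) := by gcongr
      _ = ((C + b⁻¹ * C + 4 * ((b ^ 2)⁻¹ * C)) +
          (12 * Real.exp 1 * C ^ 3 * (b ^ 3)⁻¹) * (2 * Real.exp (7 * C) * C)) * ρ := by ring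
      _ ≤ _ := by
          gcongr
          rw [riskConst]
          have h3 :
              0 ≤ 2 * Real.exp (7 * C) * Real.exp 1 * Nat.factorial 12 * (2 * C / b) ^ 12 := by
            positivity
          have h4 : 0 ≤ 6 * ((b ^ 3)⁻¹ * C ^ 3) := by positivity
          have h5 : 0 ≤ 2 * (1800 * Real.exp 1 * C ^ 3 * ((b ^ 4)⁻¹ + (b ^ 3)⁻¹)) *
            (2 * Real.exp (7 * C) * C) := by positivity
          linarith
  · exact (hmain x (not_not.1 hx)).trans (le_abs_self _)

/-- The cubic remainder `√n θ³ = D √D / n` dominates both the term `√n θ / n = √D / n` and the `D /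
n` of the quadratic part. -/
theorem exists_corEstimator_bound (hν : ResampleInvariant ν μ)
    (hB : KernelBounds φ K μ s r b C h) (hKs : ∀ x, K (-x) = K x) {n : ℕ} (hn : 3 ≤ n)
    (hDn : C ^ 2 * (h ^ d)⁻¹ ≤ n) (hDn' : (h ^ d)⁻¹ ^ 3 ≤ (n : ℝ) ^ 2) :
    ∃ (B : Set (ℕ → E d)) (Y : (ℕ → E d) → ℝ), Measurable Y ∧
      ν B ≤ ENNReal.ofReal (riskConst b C / n) ∧
      ∫⁻ x, ENNReal.ofReal |Y x| ∂ν ≤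
        ENNReal.ofReal (riskConst b C * (h ^ s + √n * h ^ r + √(h ^ d)⁻¹ / √n +
          (h ^ d)⁻¹ * √(h ^ d)⁻¹ / n)) ∧
      ∀ x ∉ B, |√n * (corEstimator φ K h n x - ∫ z, φ z)| ≤ |Y x| := by
  have hb := hB.b_pos
  have hC := zero_lt_one.trans_le hB.one_le_C
  have h0 := hB.h_pos
  have hD1 := hB.one_le_inv_pow
  have hbad := hB.measure_compl_goodSamples_le hν hn hDn hDn'
  have hlin := hB.lintegral_abs_linearPart_le hν (n := n) (by omega)
  have hquad := hB.lintegral_abs_quadraticPart_le hν (n := n) (by omega)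
  have hexp := hB.lintegral_abs_expAvg_le hν (n := n) (by omega) hDn
  have hDn1 : (h ^ d)⁻¹ ≤ n :=
    (le_mul_of_one_le_left (by positivity) (one_le_pow₀ hB.one_le_C)).trans hDn
  have hmain := fun x hx => hB.abs_corEstimator_sub_le hKs hn hDn1 (x := x) hx
  set D := (h ^ d)⁻¹ with hD
  have hD0 : 0 < D := zero_lt_one.trans_le hD1
  have hn0 : (0 : ℝ) < n := by positivity
  have hsn0 : 0 < √(n : ℝ) := Real.sqrt_pos.2 hn0
  have hsn : √(n : ℝ) ^ 2 = n := Real.sq_sqrt hn0.le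
  have hsD : √D ^ 2 = D := Real.sq_sqrt hD0.le
  have hsD1 : 1 ≤ √D := Real.one_le_sqrt.2 hD1
  have hDD : D ≤ D * √D := le_mul_of_one_le_right hD0.le hsD1
  have hDD' : √D ≤ D * √D := le_mul_of_one_le_left (Real.sqrt_nonneg _) hD1
  set k := √n * (1800 * Real.exp 1 * C ^ 3 * ((b ^ 4)⁻¹ + (b ^ 3)⁻¹) *
        (√(D / n) ^ 3 + √(D / n) / n)) with hk
  have hk0 : 0 ≤ k := by positivity
  have hkD : k ≤ 1800 * Real.exp 1 * C ^ 3 * ((b ^ 4)⁻¹ + (b ^ 3)⁻¹) * (2 * (D * √D / n)) := by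
    have e : √(D / n) = √D / √n := Real.sqrt_div hD0.le _
    have e1 : √(n : ℝ) * √(D / n) ^ 3 = D * √D / n := by
      calc √(n : ℝ) * √(D / n) ^ 3 = √n * (√(D / n) ^ 2 * √(D / n)) := by ring
        _ = D * √D / n := by
          rw [Real.sq_sqrt (by positivity), e]; field_simp
    have e2 : √(n : ℝ) * (√(D / n) / n) = √D / n := by
      rw [e]; field_simp
    have : √(n : ℝ) * (√(D / n) ^ 3 + √(D / n) / n) ≤ 2 * (D * √D / n) := by
      rw [mul_add, e1, e2, two_mul]
      gcongr
    rw [hk, mul_left_comm]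
    gcongr
  refine ⟨(goodSamples φ K h μ b n)ᶜ, fun x => |√n * linearPart φ K h μ n x +
    √n * quadraticPart φ K h μ n x| + k * expAvg φ K h μ n x, ?_, ?_, ?_, fun x hx => ?_⟩
  · exact (((hB.meas_linearPart n).const_mul _).add
      ((hB.meas_quadraticPart n).const_mul _)).abs.add ((hB.meas_expAvg n).const_mul _)
  · refine hbad.trans (ENNReal.ofReal_le_ofReal ?_)
    gcongr
    exact le_add_of_nonneg_right (by positivity)
  · have hlq := lintegral_abs_add_le ((hB.meas_linearPart n).const_mul √(n : ℝ)) (by positivity)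
      (by positivity) hlin hquad
    refine (lintegral_abs_abs_add_le (((hB.meas_linearPart n).const_mul _).add
      ((hB.meas_quadraticPart n).const_mul _)) (by positivity)
      (by positivity) hlq (lintegral_abs_const_mul_le k hexp)).trans
      (ENNReal.ofReal_le_ofReal ?_)
    rw [abs_of_nonneg hk0]
    set ρ := h ^ s + √n * h ^ r + √D / √n + D * √D / n with hρ
    have h1 : h ^ s + √n * h ^ r + √D / √n ≤ ρ := by
      rw [hρ]; exact le_add_of_nonneg_right (by positivity)
    have h2 : D * √D / n ≤ ρ := by
      rw [hρ]; exact le_add_of_nonneg_left (by positivity)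
    have h3 : √D / √n + D / n ≤ ρ := by
      rw [hρ]
      gcongr
      exact le_add_of_nonneg_left (by positivity)
    have hρ0 : 0 ≤ ρ := by positivity
    calc _ ≤ (C + b⁻¹ * C + 4 * ((b ^ 2)⁻¹ * C)) * ρ + 6 * ((b ^ 3)⁻¹ * C ^ 3) * ρ +
          1800 * Real.exp 1 * C ^ 3 * ((b ^ 4)⁻¹ + (b ^ 3)⁻¹) * (2 * ρ) *
            (2 * Real.exp (7 * C) * C) := by
          gcongr
          refine hkD.trans ?_
          gcongr
      _ = ((C + b⁻¹ * C + 4 * ((b ^ 2)⁻¹ * C)) + 6 * ((b ^ 3)⁻¹ * C ^ 3) +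
          2 * (1800 * Real.exp 1 * C ^ 3 * ((b ^ 4)⁻¹ + (b ^ 3)⁻¹)) *
            (2 * Real.exp (7 * C) * C)) * ρ := by ring
      _ ≤ _ := by
          gcongr
          rw [riskConst]
          have h4 :
              0 ≤ 2 * Real.exp (7 * C) * Real.exp 1 * Nat.factorial 12 * (2 * C / b) ^ 12 := by
            positivity
          have h5 : 0 ≤ (12 * Real.exp 1 * C ^ 3 * (b ^ 3)⁻¹) * (2 * Real.exp (7 * C) * C) := by
            positivity
          linarith
  · exact (hmain x (not_not.1 hx)).trans (le_abs_self _)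

end KernelBounds

/-! ### The rates and the conditions they impose on the bandwidth. -/

section Rates

variable {d r : ℕ} {s : ℝ} {h : ℕ → ℝ}

theorem rate_eq (hh : ∀ n, 0 < h n) (n : ℕ) :
    rate d r s h n = h n ^ s + √n * h n ^ r + (h n ^ d)⁻¹ / √n := by
  rw [rate, ← Real.sqrt_eq_rpow, Real.rpow_neg (Nat.cast_nonneg n), ← Real.sqrt_eq_rpow,
    Real.rpow_neg (hh n).le, Real.rpow_natCast]
  ring

theorem corRate_eq (hh : ∀ n, 0 < h n) (n : ℕ) :
    corRate d r s h n = h n ^ s + √n * h n ^ r + √(h n ^ d)⁻¹ / √n +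
      (h n ^ d)⁻¹ * √(h n ^ d)⁻¹ / n := by
  have h0 := hh n
  have e1 : h n ^ (-((d : ℝ) / 2)) = √(h n ^ d)⁻¹ := by
    rw [Real.sqrt_eq_rpow, ← Real.rpow_natCast, ← Real.rpow_neg h0.le, ← Real.rpow_mul h0.le]
    congr 1
    ring
  have e2 : h n ^ (-(3 * (d : ℝ) / 2)) = (h n ^ d)⁻¹ * √(h n ^ d)⁻¹ := by
    rw [← e1, ← Real.rpow_natCast, ← Real.rpow_neg h0.le, ← Real.rpow_add h0]
    congr 1
    ring
  rw [corRate, e1, e2, ← Real.sqrt_eq_rpow, Real.rpow_neg (Nat.cast_nonneg n),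
    ← Real.sqrt_eq_rpow]
  ring

theorem eventually_le_of_rpow_le (hs : 0 < s) (hh : ∀ n, 0 < h n) {a : ℕ → ℝ}
    (ha : Tendsto a atTop (𝓝 0)) (hle : ∀ n, h n ^ s ≤ a n) {h₀ : ℝ} (h0 : 0 < h₀) :
    ∀ᶠ n in atTop, h n ≤ h₀ := by
  filter_upwards [ha.eventually_le_const (Real.rpow_pos_of_pos h0 s)] with n hn
  exact (Real.rpow_le_rpow_iff (hh n).le h0.le hs).1 ((hle n).trans hn)

/-- The last term of the rate makes `C² D ≤ √n` eventually, which is stronger than both conclusions.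
-/
theorem eventually_le_of_rate (hh : ∀ n, 0 < h n)
    (hr : Tendsto (rate d r s h) atTop (𝓝 0)) {C : ℝ} (hC : 1 ≤ C) :
    ∀ᶠ n : ℕ in atTop, C ^ 2 * (h n ^ d)⁻¹ ≤ n ∧ (h n ^ d)⁻¹ ^ 3 ≤ (n : ℝ) ^ 2 := by
  have hC0 := zero_lt_one.trans_le hC
  filter_upwards [hr.eventually_le_const (by positivity : 0 < 1 / C ^ 2),
    eventually_ge_atTop 1] with n hn hn1
  have h0 := hh n
  rw [rate_eq hh] at hn
  set D := (h n ^ d)⁻¹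
  have hD0 : 0 < D := by positivity
  have hn1' : (1 : ℝ) ≤ n := by exact_mod_cast hn1
  have hsn1 : 1 ≤ √(n : ℝ) := Real.one_le_sqrt.2 hn1'
  have hsn : √(n : ℝ) ^ 2 = n := Real.sq_sqrt (by positivity)
  have h1 : D / √n ≤ 1 / C ^ 2 := (le_add_of_nonneg_left (by positivity)).trans hn
  rw [div_le_div_iff₀ (by positivity) (by positivity), one_mul, mul_comm] at h1
  have h2 : √(n : ℝ) ≤ n := by nlinarith
  have h3 : D ≤ √(n : ℝ) := (le_mul_of_one_le_left hD0.le (one_le_pow₀ hC)).trans h1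
  refine ⟨h1.trans h2, ?_⟩
  calc D ^ 3 ≤ √(n : ℝ) ^ 3 := by gcongr
    _ ≤ √(n : ℝ) ^ 4 := pow_le_pow_right₀ hsn1 (by norm_num)
    _ = (√(n : ℝ) ^ 2) ^ 2 := by ring
    _ = _ := by rw [hsn]

/-- The term `√(D / n)` gives the first conclusion, and squaring `D √D / n ≤ 1` gives the second. -/
theorem eventually_le_of_corRate (hh : ∀ n, 0 < h n)
    (hr : Tendsto (corRate d r s h) atTop (𝓝 0)) {C : ℝ} (hC : 1 ≤ C) :
    ∀ᶠ n : ℕ in atTop, C ^ 2 * (h n ^ d)⁻¹ ≤ n ∧ (h n ^ d)⁻¹ ^ 3 ≤ (n : ℝ) ^ 2 := by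
  have hC0 := zero_lt_one.trans_le hC
  filter_upwards [hr.eventually_le_const (by positivity : 0 < 1 / C), eventually_ge_atTop 1]
    with n hn hn1
  have h0 := hh n
  rw [corRate_eq hh] at hn
  set D := (h n ^ d)⁻¹
  have hD0 : 0 < D := by positivity
  have hn1' : (1 : ℝ) ≤ n := by exact_mod_cast hn1
  have hn0 : (0 : ℝ) < n := by positivity
  have hsn0 : 0 < √(n : ℝ) := Real.sqrt_pos.2 hn0
  have hsn : √(n : ℝ) ^ 2 = n := Real.sq_sqrt hn0.le
  have hsD : √D ^ 2 = D := Real.sq_sqrt hD0.le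
  have p1 : 0 ≤ h n ^ s + √n * h n ^ r := by positivity
  have p2 : 0 ≤ √D / √n := by positivity
  have p3 : 0 ≤ D * √D / n := by positivity
  have h1 : √D / √n ≤ 1 / C := by linarith
  have h2 : D * √D / n ≤ 1 := by
    have : 1 / C ≤ 1 := (div_le_one hC0).2 hC
    linarith
  rw [div_le_div_iff₀ hsn0 hC0, one_mul] at h1
  rw [div_le_one hn0] at h2
  constructor
  · calc C ^ 2 * D = (√D * C) ^ 2 := by rw [mul_pow, hsD]; ring
      _ ≤ √(n : ℝ) ^ 2 := by gcongr
      _ = n := hsn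
  · calc D ^ 3 = (D * √D) ^ 2 := by rw [mul_pow, hsD]; ring
      _ ≤ _ := by gcongr

end Rates

theorem riskConst_nonneg {b C : ℝ} (hb : 0 < b) (hC : 0 ≤ C) : 0 ≤ KernelBounds.riskConst b C := by
  unfold KernelBounds.riskConst
  positivity

end KernelAcc

end

/-! ### Conclusion for the i.i.d. sample. -/

theorem theorem1 {d : ℕ} (hd : 1 ≤ d) {Ω : Type*} [MeasurableSpace Ω]
    (P : Measure Ω) [IsProbabilityMeasure P]
    -- the i.i.d. sample, with density `f`
    (X : ℕ → Ω → KernelAcc.E d) (hXm : ∀ i, Measurable (X i)) (hXi : iIndepFun X P)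
    (f : KernelAcc.E d → ℝ) (hf0 : ∀ x, 0 ≤ f x)
    (hXf : ∀ i, P.map (X i) = volume.withDensity (fun x => ENNReal.ofReal (f x)))
    -- the integrand
    (φ : KernelAcc.E d → ℝ) (s : ℝ) (hs : 0 < s)
    (hφ : φ ∈ KernelAcc.Nikolskii s) (hφc : HasCompactSupport φ)
    -- the density
    (r : ℕ) (hfb : ∃ M : ℝ, ∀ x, f x ≤ M) (hfr : KernelAcc.HasBoundedDerivs r f)
    (b : ℝ) (hb : 0 < b) (hfQ : ∀ x ∈ tsupport φ, b ≤ f x)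
    -- the kernel
    (K : KernelAcc.E d → ℝ) (hKs : ∀ x, K (-x) = K x) (hKr : KernelAcc.IsKernelOfOrder r K)
    (hrs : s ≤ r) (hKe : KernelAcc.HasExpTails K)
    -- the bandwidth
    (h : ℕ → ℝ) (hh : ∀ n, 0 < h n) :
    (Tendsto (KernelAcc.rate d r s h) atTop (𝓝 0) →
      KernelAcc.IsBigOP P
        (fun n ω => (n : ℝ) ^ (1 / 2 : ℝ) *
          (KernelAcc.estimator φ K (h n) n (fun i => X i ω) - ∫ x, φ x))
        (KernelAcc.rate d r s h)) ∧
    (Tendsto (KernelAcc.corRate d r s h) atTop (𝓝 0) →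
      KernelAcc.IsBigOP P
        (fun n ω => (n : ℝ) ^ (1 / 2 : ℝ) *
          (KernelAcc.corEstimator φ K (h n) n (fun i => X i ω) - ∫ x, φ x))
        (KernelAcc.corRate d r s h)) := by
  obtain ⟨M, hM⟩ := hfb
  have hXμ : ∀ i, P.map (X i) = KernelAcc.densityMeasure f := hXf
  have : IsProbabilityMeasure (KernelAcc.densityMeasure f) := by
    rw [← hXμ 0]
    exact Measure.isProbabilityMeasure_map (hXm 0).aemeasurable
  have hYm : Measurable fun ω i => X i ω := measurable_pi_iff.2 hXm
  have : IsProbabilityMeasure (P.map fun ω i => X i ω) :=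
    Measure.isProbabilityMeasure_map hYm.aemeasurable
  have hν := KernelAcc.resampleInvariant_of_iIndepFun hXm hXi hXμ
  obtain ⟨b', C, h₀, hh₀, hB⟩ :=
    KernelAcc.exists_kernelBounds hd hs hrs hf0 hφ hφc hM hfr hb hfQ hKs hKr hKe
  -- The constants `b'` and `C` do not depend on the bandwidth, so their signs can be read off at
  -- `h₀`.
  have hb' := (hB h₀ hh₀ le_rfl).b_pos
  have hC := (hB h₀ hh₀ le_rfl).one_le_C
  have hA := KernelAcc.riskConst_nonneg hb' (zero_le_one.trans hC)
  constructor
  · intro hr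
    refine KernelAcc.IsBigOP.comp_map hYm (Z := fun n x => (n : ℝ) ^ (1 / 2 : ℝ) *
      (KernelAcc.estimator φ K (h n) n x - ∫ x, φ x)) (KernelAcc.IsBigOP.of_eventually ?_ hA ?_)
    · refine Eventually.of_forall fun n => ?_
      have := hh n
      rw [KernelAcc.rate_eq hh]
      positivity
    · filter_upwards [KernelAcc.eventually_le_of_rpow_le hs hh hr (fun n => by
        have := hh n
        rw [KernelAcc.rate_eq hh, add_assoc]
        exact le_add_of_nonneg_right (by positivity)) hh₀, KernelAcc.eventually_le_of_rate hh hr hC,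
        eventually_ge_atTop 3] with n h1 h2 h3
      rw [KernelAcc.rate_eq hh, ← Real.sqrt_eq_rpow]
      exact (hB (h n) (hh n) h1).exists_estimator_bound hν h3 h2.1 h2.2
  · intro hr
    refine KernelAcc.IsBigOP.comp_map hYm (Z := fun n x => (n : ℝ) ^ (1 / 2 : ℝ) *
      (KernelAcc.corEstimator φ K (h n) n x - ∫ x, φ x)) (KernelAcc.IsBigOP.of_eventually ?_ hA ?_)
    · refine Eventually.of_forall fun n => ?_
      have := hh n
      rw [KernelAcc.corRate_eq hh]
      positivity
    · filter_upwards [KernelAcc.eventually_le_of_rpow_le hs hh hr (fun n => by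
        have := hh n
        rw [KernelAcc.corRate_eq hh, add_assoc, add_assoc]
        exact le_add_of_nonneg_right (by positivity)) hh₀,
        KernelAcc.eventually_le_of_corRate hh hr hC,
        eventually_ge_atTop 3] with n h1 h2 h3
      rw [KernelAcc.corRate_eq hh, ← Real.sqrt_eq_rpow]
      exact (hB (h n) (hh n) h1).exists_corEstimator_bound hν hKs h3 h2.1 h2.2
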